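/- **Setting.** For $w:\mathbb R\to\mathbb C$ let $\hat w(\xi)=(2\pi)^{-1/2}\int w(y)e^{-iy\xi}\,dy$ (Plancherel extension on $L^2$) and $\widehat{D^a w}(\xi)=|\xi|^a\hat w(\xi)$. For $a>0$ let $H^a$ be the space of $u\in L^2(\mathbb R,\mathbb C)$ with $\|u\|_{H^a}^2=\int(1+|\xi|^{2a})|\hat u(\xi)|^2d\xi<\infty$. Let $s\ge\frac12$, and let $W:\mathbb C\to\mathbb R$ be of class $C^2$ with $W(\psi)$ depending only on $|\psi|$; put $W'(\psi)=\frac{\partial W}{\partial\psi_1}+i\frac{\partial W}{\partial\psi_2}$, $\psi=\psi_1+i\psi_2$, and, for real $r$, $W(r)=E_0r^2+N(r)$ with $E_0=\frac12W''(0)$. Consider $$i\,\partial_t\psi=\tfrac12D^{2s}\psi+\tfrac12W'(\psi),\qquad \psi(t,x)\in\mathbb C,\ x\in\mathbb R,\tag{1}$$ with energy $E(u)=\int\big(\frac12|D^su|^2+W(u)\big)dx$ and charge $C(u)=\int|u|^2dx$ on $H^s$. **Solutions and evolution.** A solution of (1) on a time interval $J$ is a curve $\psi:J\to H^s$, continuous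 in $H^s$, such that $\langle\varphi,\psi(t)\rangle$ is differentiable in $t\in J$ with $i\frac{d}{dt}\langle\varphi,\psi\rangle=\frac12\langle D^{2s}\varphi,\psi\rangle+\frac12\int\bar\varphi\,W'(\psi)\,dx$ for every $\varphi\in C_c^\infty(\mathbb R,\mathbb C)$, where $\langle f,g\rangle=\int\bar f g\,dx$. It is conservative if $E$ and $C$ are constant along it. For $u_0\in H^s$, $T(u_0)\in[0,\infty]$ is the supremum of the $\tau\ge 0$ such that on $[0,\tau)$ there is a conservative solution $\psi$ with $\psi(0)=u_0$; it is the only conservative solution from $u_0$; and conservative solutions depend continuously, in $H^s$, on time and initial value at each $(t,u_0)$, $0\le t<\tau$ (for every $\varepsilon>0$ there is $\eta>0$ such that $\|\chi(t')-\psi(t)\|_{H^s}<\varepsilon$ whenever $\chi$ is a conservative solution on some $[0,\sigma)$ with $\|\chi(0)-u_0\|_{H^s}<\eta$, and $t'\in[0,\sigma)$, $|t'-t|<\eta$). For $t<T(u_0)$ write $\gamma_tu_0=\psi(t)$, and let $X_0=\{u\in H^s: T(u)=\infty\}$. **Hylomorphic solitons.** A set $\Gamma\subset H^s$ is a *hylomorphic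 set of charge $c$* if * $\Gamma=\{u\in H^s: E(u)=e,\ |C(u)|=c\}$, where $e=\min\{E(u): u\in H^s,\ |C(u)|=c\}$ (the minimum being attained); * $\Gamma\subset X_0$; * $\Gamma$ is invariant: $\gamma_tu\in\Gamma$ for $u\in\Gamma$, $0\le t<T(u)$; * $\Gamma$ is stable: for every $\varepsilon>0$ there is $\delta>0$ such that, for $u\in H^s$, $d(u,\Gamma)\le\delta$ implies $d(\gamma_tu,\Gamma)\le\varepsilon$ for all $t\in[0,T(u))$, $d$ being the distance in $H^s$; * $\Gamma$ is compact up to translations: each sequence $(u_n)$ in $\Gamma$ has a subsequence $(u_{n_k})$ such that $u_{n_k}(\cdot-\tau_k)$ converges in $H^s$ for suitable $\tau_k\in\mathbb R$. A *hylomorphic soliton* is an element of a hylomorphic set. **Theorem.** Assume * (W-0) $W(0)=0$ and $W'(0)=0$; * (W-1) $N(r_0)<0$ for some $r_0>0$; * (W-2) there are $2<q_1\le q_2<\infty$ and $c_1$ with $|N'(r)|\le c_1(r^{q_1-1}+r^{q_2-1})$ for all $r\ge0$; * (W-3) there are $p\in(2,4s+2)$ and $c\ge0$ with $N(r)\ge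 -cr^p$ for all large $r$. (No condition on the sign of $W''(0)$ is imposed.) Then equation (1) admits a family of hylomorphic solitons $u_\delta\in H^{2s}$, $\delta\in(0,\delta_\infty)$. More precisely, there are $\delta_\infty>0$, a strictly decreasing function $\delta\mapsto c_\delta>0$ on $(0,\delta_\infty)$ and, for every $\delta\in(0,\delta_\infty)$, a nonempty hylomorphic set $\Gamma_\delta$ of charge $c_\delta$, such that every $u_\delta\in\Gamma_\delta$ is a hylomorphic soliton which lies in $H^{2s}$ and, for some $\omega\in\mathbb R$, is a weak solution of $$\tfrac12D^{2s}u+\tfrac12W'(u)=\omega u,$$ that is, $\frac12\langle D^{2s}\varphi,u\rangle+\frac12\int\bar\varphi\,W'(u)\,dx=\omega\langle\varphi,u\rangle$ for all $\varphi\in C_c^\infty(\mathbb R,\mathbb C)$; and $\psi_\delta(t,x)=u_\delta(x)e^{-i\omega t}$ is a solution of (1) on all of $\mathbb R$. -/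

import Mathlib

open MeasureTheory Set Filter Topology
open scoped FourierTransform ENNReal ComplexConjugate

noncomputable section

namespace FNLS

/-- Complex valued square integrable functions on the line (modulo null sets). -/
abbrev L2 : Type := Lp ℂ 2 (volume : Measure ℝ)

/-! ### Fractional derivatives and Sobolev spaces

Mathlib's Fourier transform is `𝓕 u ξ = ∫ exp (-2 π i x ξ) u x dx`, so the frequency variable of the
unitary convention `(2π)^(-1/2) ∫ exp (-i x ξ) u x dx` is `2 π ξ`. On `L2`, `𝓕` is the Plancherel
extension, which is unitary. -/

/-- The symbol `|ξ|^a` of `D^a`, in Mathlib's frequency variable. -/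
def symb (a ξ : ℝ) : ℂ := ((|2 * Real.pi * ξ| ^ a : ℝ) : ℂ)

/-- `u ∈ H^a`, for `u ∈ L²`: the function `|ξ|^a û` is square integrable. -/
def MemHs (a : ℝ) (u : L2) : Prop :=
  MemLp (fun ξ => symb a ξ * (𝓕 u : L2) ξ) 2 (volume : Measure ℝ)

open Classical in
/-- The operator `D^a` with domain `H^a`: it multiplies the Fourier transform by `|ξ|^a`.
(Outside `H^a` the value is the junk value `0`.) -/
def fracD (a : ℝ) (u : L2) : L2 :=
  if h : MemHs a u then 𝓕⁻ (h.toLp (fun ξ => symb a ξ * (𝓕 u : L2) ξ) : L2) else 0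

/-- The norm of `H^s`: the square root of `∫ (1 + |ξ|^(2s)) |û|² = ‖u‖² + ‖D^s u‖²`. -/
def hsNorm (s : ℝ) (u : L2) : ℝ := Real.sqrt (‖u‖ ^ 2 + ‖fracD s u‖ ^ 2)

/-- The distance in `H^s` of `u` from a (nonempty) set `Γ ⊆ H^s`. -/
def hsInfDist (s : ℝ) (u : L2) (Γ : Set L2) : ℝ := sInf ((fun v => hsNorm s (u - v)) '' Γ)

/-- The translate `x ↦ u (x - τ)`. -/
def translate (τ : ℝ) (u : L2) : L2 :=
  Lp.compMeasurePreserving (fun x : ℝ => x - τ) (measurePreserving_sub_right volume τ) u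

/-- Test functions: classes of compactly supported smooth functions. -/
def IsTest (φ : L2) : Prop :=
  ∃ f : ℝ → ℂ, ContDiff ℝ ((⊤ : ℕ∞) : WithTop ℕ∞) f ∧ HasCompactSupport f ∧ φ =ᵐ[volume] f

/-! ### The nonlinearity, the energy and the charge -/

/-- `W' = ∂W/∂ψ₁ + i ∂W/∂ψ₂`, for `ψ = ψ₁ + i ψ₂`. -/
def cgrad (W : ℂ → ℝ) (z : ℂ) : ℂ :=
  (fderiv ℝ W z 1 : ℂ) + Complex.I * (fderiv ℝ W z Complex.I : ℂ)

/-- `E₀ = W''(0) / 2`, the second derivative being that of `W` along the real axis. -/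
def E₀ (W : ℂ → ℝ) : ℝ := (1 / 2) * iteratedDeriv 2 (fun r : ℝ => W (r : ℂ)) 0

/-- `N(r) = W(r) - E₀ r²`. -/
def Nfun (W : ℂ → ℝ) (r : ℝ) : ℝ := W (r : ℂ) - E₀ W * r ^ 2

/-- The energy `E(u) = ∫ (½ |D^s u|² + W(u)) dx` of `u ∈ H^s`. -/
def energy (s : ℝ) (W : ℂ → ℝ) (u : L2) : ℝ := (1 / 2) * ‖fracD s u‖ ^ 2 + ∫ x, W (u x)

/-- The hylenic charge `C(u) = ∫ |u|² dx`. -/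
def charge (u : L2) : ℝ := ∫ x, ‖u x‖ ^ 2

/-! ### The equations -/

/-- The pairing of `½ D^(2s) u + ½ W'(u)` with a test function `φ` (antilinear in `φ`). -/
def rhsPairing (s : ℝ) (W : ℂ → ℝ) (φ u : L2) : ℂ :=
  (1 / 2) * inner ℂ (fracD (2 * s) φ) u + (1 / 2) * ∫ x, conj (φ x) * cgrad W (u x)

/-- `u` is a weak solution of `½ D^(2s) u + ½ W'(u) = ω u`. -/
def IsWeakStationary (s : ℝ) (W : ℂ → ℝ) (ω : ℝ) (u : L2) : Prop :=
  ∀ φ : L2, IsTest φ → rhsPairing s W φ u = ω * inner ℂ φ u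

/-- `ψ` is, on the time interval `J`, a solution in `H^s` of
`i ∂ₜ ψ = ½ D^(2s) ψ + ½ W'(ψ)`: a curve which is continuous in `H^s` and satisfies the equation
tested in space against every test function. -/
structure IsSolution (s : ℝ) (W : ℂ → ℝ) (J : Set ℝ) (ψ : ℝ → L2) : Prop where
  mem : ∀ t ∈ J, MemHs s (ψ t)
  cont : ∀ t ∈ J, Tendsto (fun t' => hsNorm s (ψ t' - ψ t)) (𝓝[J] t) (𝓝 0)
  eqn : ∀ φ : L2, IsTest φ → ∀ t ∈ J,
    HasDerivWithinAt (fun t' => (inner ℂ φ (ψ t') : ℂ)) (-Complex.I * rhsPairing s W φ (ψ t)) J t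

/-- A solution on `[0, τ)` with initial value `u₀`, along which energy and charge are constant. -/
structure IsConservativeSolution (s : ℝ) (W : ℂ → ℝ) (τ : ℝ) (u₀ : L2) (ψ : ℝ → L2) : Prop where
  sol : IsSolution s W (Ico 0 τ) ψ
  init : ψ 0 = u₀
  energy_eq : ∀ t ∈ Ico 0 τ, energy s W (ψ t) = energy s W u₀
  charge_eq : ∀ t ∈ Ico 0 τ, charge (ψ t) = charge u₀

/-! ### The dynamical system on `H^s` -/

/-- The evolution is well defined on `[0, τ)` at `u₀`, and is given there by `ψ`: the curve `ψ` is
the unique solution (with constant energy and charge) issued from `u₀`, and solutions depend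
continuously on time and initial value at every `(t, u₀)`, `0 ≤ t < τ`. -/
structure IsEvolution (s : ℝ) (W : ℂ → ℝ) (τ : ℝ) (u₀ : L2) (ψ : ℝ → L2) : Prop where
  sol : IsConservativeSolution s W τ u₀ ψ
  unique : ∀ (σ : ℝ) (χ : ℝ → L2), IsConservativeSolution s W σ u₀ χ →
    ∀ t ∈ Ico 0 (min σ τ), χ t = ψ t
  cont : ∀ t ∈ Ico 0 τ, ∀ ε > 0, ∃ η > 0, ∀ v₀ : L2, MemHs s v₀ → hsNorm s (v₀ - u₀) < η →
    ∀ (σ : ℝ) (χ : ℝ → L2), IsConservativeSolution s W σ v₀ χ →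
      ∀ t' ∈ Ico 0 σ, |t' - t| < η → hsNorm s (χ t' - ψ t) < ε

/-- `T(u₀) ∈ [0, ∞]`: the supremum of the `τ` such that the evolution of `u₀` is well defined on
`[0, τ)`. -/
def lifespan (s : ℝ) (W : ℂ → ℝ) (u₀ : L2) : ℝ≥0∞ :=
  ⨆ (τ : ℝ) (_ : ∃ ψ : ℝ → L2, IsEvolution s W τ u₀ ψ), ENNReal.ofReal τ

open Classical in
/-- The evolution map `γ_t u₀`, meaningful for `0 ≤ t < T(u₀)` (and `u₀` otherwise). -/
def flow (s : ℝ) (W : ℂ → ℝ) (t : ℝ) (u₀ : L2) : L2 :=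
  if h : ∃ ψ : ℝ → L2, ∃ τ : ℝ, t < τ ∧ IsEvolution s W τ u₀ ψ then h.choose t else u₀

/-- `X₀`: the states of `H^s` with global evolution. -/
def globalStates (s : ℝ) (W : ℂ → ℝ) : Set L2 := {u | MemHs s u ∧ lifespan s W u = ⊤}

/-- `Γ` is invariant under the evolution. -/
def IsInvariantSet (s : ℝ) (W : ℂ → ℝ) (Γ : Set L2) : Prop :=
  ∀ u ∈ Γ, ∀ t : ℝ, 0 ≤ t → ENNReal.ofReal t < lifespan s W u → flow s W t u ∈ Γ

/-- `Γ` is orbitally stable. -/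
def IsStableSet (s : ℝ) (W : ℂ → ℝ) (Γ : Set L2) : Prop :=
  ∀ ε > 0, ∃ δ > 0, ∀ u : L2, MemHs s u → hsInfDist s u Γ ≤ δ →
    ∀ t : ℝ, 0 ≤ t → ENNReal.ofReal t < lifespan s W u → hsInfDist s (flow s W t u) Γ ≤ ε

/-- `Γ` is compact up to translations: every sequence in `Γ` has a subsequence some translates of
which converge in `H^s`. -/
def IsCompactUpToTranslations (s : ℝ) (Γ : Set L2) : Prop :=
  ∀ u : ℕ → L2, (∀ n, u n ∈ Γ) → ∃ (k : ℕ → ℕ) (τ : ℕ → ℝ) (v : L2), StrictMono k ∧ MemHs s v ∧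
    Tendsto (fun n => hsNorm s (translate (τ n) (u (k n)) - v)) atTop (𝓝 0)

/-- The sets `Γ` that occur in the definition of a soliton. -/
structure IsSolitonSet (s : ℝ) (W : ℂ → ℝ) (Γ : Set L2) : Prop where
  global : Γ ⊆ globalStates s W
  invariant : IsInvariantSet s W Γ
  stable : IsStableSet s W Γ
  compact : IsCompactUpToTranslations s Γ

/-- `Γ(e, c) = {u ∈ H^s | E(u) = e, |C(u)| = c}`. -/
def levelSet (s : ℝ) (W : ℂ → ℝ) (e c : ℝ) : Set L2 :=
  {u | MemHs s u ∧ energy s W u = e ∧ |charge u| = c}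

/-- `Γ` is a set of hylomorphic solitons of charge `c`: it has the properties required in the
definition of a soliton, and `Γ = Γ(e, c)` where `e = min {E(u) | u ∈ H^s, |C(u)| = c}`. -/
def IsHylomorphicSet (s : ℝ) (W : ℂ → ℝ) (c : ℝ) (Γ : Set L2) : Prop :=
  IsSolitonSet s W Γ ∧
    ∃ e : ℝ, IsLeast (energy s W '' {u | MemHs s u ∧ |charge u| = c}) e ∧ Γ = levelSet s W e c

/-- Hylomorphic solitons. -/
def IsHylomorphicSoliton (s : ℝ) (W : ℂ → ℝ) (u : L2) : Prop :=
  ∃ (c : ℝ) (Γ : Set L2), IsHylomorphicSet s W c Γ ∧ u ∈ Γ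

end FNLS

end

noncomputable section

namespace FNLS

/-! ### Square integrable functions and their Fourier transforms -/

/-! At fixed charge c the quadratic part of W contributes the constant E₀c. So the energy and `J` =
½‖D^s u‖² + ∫ N(|u|) have the same minimizers, whatever the sign of E₀. By (W-3) and the subcritical
Gagliardo–Nirenberg inequality, `J` is coercive at bounded charge (`Admissible.coercive`); by (W-2)
its potential part is Lipschitz for the L² norm on bounded subsets of H^s (`Admissible.pot_sub_le`).

The main tool is dilation: for u_a(x) = u(ax) one has J(u_a) = a⁻¹(½a^(2s)‖D^s u‖² + ∫ N(|u|)).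
Stretching a plateau of height r₀ makes `J` negative, so `Jinf` is negative at all large charges.
Taking a = ‖u‖²/c < 1 gives J(u) > (‖u‖²/c)·Jinf(c) for every nonzero u of charge below c
(`Admissible.scale_lt`), which excludes that a minimizing sequence splits. Negativity of `Jinf`
excludes that it vanishes: some L^k norm, k > 2, stays away from 0, and since the values of a band
limited function are L² pairings with translates of one kernel, suitable translates have a nonzero
weak limit. Hence minimizing sequences, even with charges that only tend to c, converge in H^s up to
translations and subsequences (`Admissible.minimizing_compact`). This yields existence, compactness
and, through the conservation laws, orbital stability (`Admissible.orbital_stability`).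

Variation along great circles of the sphere of charge c gives D^(2s)u = 2ωu - W'(u). The right side
is in L², so u is in H^(2s); since 2s ≥ 1, the minimizers of one charge are uniformly bounded
functions. Phase invariance turns them into standing waves.

The lifespan requires uniqueness and continuous dependence, and no well-posedness theory is
available for general data; at a minimizer u it is deduced from stability. A conservative solution χ
issued near u stays H^s-close to some minimizer, hence to a bounded function, so its nonlinear term
differs from that of the standing wave ψ by at most L‖χ - ψ‖ plus a small error
(`Admissible.norm_gradL2_sub_le`). A Gronwall estimate gives closeness in L² on bounded time
intervals, and conservation of energy improves it to H^s
(`Admissible.exists_hsNorm_close_standing`). Thus the standing wave is the evolution of u, and T(u)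
= ∞. -/

theorem normSq_eq_integral (u : L2) : ‖u‖ ^ 2 = ∫ x, ‖u x‖ ^ 2 := by
  have h : (inner ℂ u u : ℂ) = ((∫ x, ‖u x‖ ^ 2 : ℝ) : ℂ) := by
    rw [L2.inner_def, ← integral_complex_ofReal]
    congr 1
    ext x
    rw [inner_self_eq_norm_sq_to_K]
    push_cast
    rfl
  rw [inner_self_eq_norm_sq_to_K] at h
  exact Complex.ofReal_injective (by rw [Complex.ofReal_pow]; exact h)

theorem charge_eq_normSq (u : L2) : charge u = ‖u‖ ^ 2 := (normSq_eq_integral u).symm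

theorem integrable_normSq (u : L2) : Integrable (fun x => ‖u x‖ ^ 2) :=
  (memLp_two_iff_integrable_sq_norm (Lp.aestronglyMeasurable u)).1 (Lp.memLp u)

theorem memLp_mul_bounded {m : ℝ → ℂ} (hm : Measurable m) {C : ℝ} (hC : ∀ x, ‖m x‖ ≤ C) (u : L2) :
    MemLp (fun x => m x * u x) 2 (volume : Measure ℝ) :=
  (Lp.memLp u).of_le_mul (hm.aestronglyMeasurable.mul (Lp.aestronglyMeasurable u))
    (c := C) (ae_of_all _ fun x => by
      rw [norm_mul]; exact mul_le_mul_of_nonneg_right (hC x) (norm_nonneg _))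

/-- Multiplication by a bounded measurable function. -/
def mulCLM (m : ℝ → ℂ) (C : ℝ) (hm : Measurable m) (hC : ∀ x, ‖m x‖ ≤ C) : L2 →L[ℂ] L2 :=
  LinearMap.mkContinuous
    { toFun := fun u => (memLp_mul_bounded hm hC u).toLp _
      map_add' := fun u v => by
        rw [← MemLp.toLp_add]
        refine MemLp.toLp_congr _ _ ?_
        filter_upwards [Lp.coeFn_add u v] with x hx
        rw [hx]
        exact mul_add _ _ _
      map_smul' := fun c u => by
        rw [RingHom.id_apply, ← MemLp.toLp_const_smul]
        refine MemLp.toLp_congr _ _ ?_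
        filter_upwards [Lp.coeFn_smul c u] with x hx
        simp only [hx, Pi.smul_apply, smul_eq_mul]
        ring }
    C (fun u => by
      refine Lp.norm_le_mul_norm_of_ae_le_mul ?_
      filter_upwards [(memLp_mul_bounded hm hC u).coeFn_toLp] with x hx
      simp only [LinearMap.coe_mk, AddHom.coe_mk]
      rw [hx, norm_mul]
      exact mul_le_mul_of_nonneg_right (hC x) (norm_nonneg _))

theorem mulCLM_coeFn {m : ℝ → ℂ} {C : ℝ} (hm : Measurable m) (hC : ∀ x, ‖m x‖ ≤ C) (u : L2) :
    mulCLM m C hm hC u =ᵐ[volume] fun x => m x * u x :=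
  (memLp_mul_bounded hm hC u).coeFn_toLp

/-- Schwartz functions are dense in L², so the rules for 𝓕 of a translate or a dilate need only be
checked where 𝓕 is an integral. -/
theorem fourier_eq_of_schwartz (A B : L2 →L[ℂ] L2)
    (h : ∀ φ : SchwartzMap ℝ ℂ, A (φ.toLp 2) = B (φ.toLp 2)) (u : L2) : A u = B u := by
  refine DenseRange.induction_on (p := fun u => A u = B u)
    (SchwartzMap.denseRange_toLpCLM (F := ℂ) (p := 2) (μ := (volume : Measure ℝ))
      ENNReal.ofNat_ne_top) u (isClosed_eq A.continuous B.continuous) ?_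
  intro φ
  exact h φ

theorem inner_eq_integral (f g : L2) : (inner ℂ f g : ℂ) = ∫ x, conj (f x) * g x := by
  rw [L2.inner_def]
  congr 1
  ext x
  rw [RCLike.inner_apply, mul_comm]

theorem integrable_conj_mul (f g : L2) : Integrable (fun x => conj (f x) * g x) := by
  have := L2.integrable_inner (𝕜 := ℂ) f g
  refine this.congr (ae_of_all _ fun x => ?_)
  simp only [RCLike.inner_apply]
  rw [mul_comm]

theorem inner_fourier (f g : L2) : (inner ℂ (𝓕 f : L2) (𝓕 g : L2) : ℂ) = inner ℂ f g :=
  Lp.inner_fourier_eq f g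

theorem norm_fourier (f : L2) : ‖(𝓕 f : L2)‖ = ‖f‖ := Lp.norm_fourier_eq f

theorem fourier_fourierInv (f : L2) : (𝓕 (𝓕⁻ f : L2) : L2) = f :=
  FourierTransform.fourier_fourierInv_eq f

theorem fourierInv_fourier (f : L2) : (𝓕⁻ (𝓕 f : L2) : L2) = f :=
  FourierTransform.fourierInv_fourier_eq f

theorem fourier_injective {f g : L2} (h : (𝓕 f : L2) = 𝓕 g) : f = g := by
  rw [← fourierInv_fourier f, h, fourierInv_fourier]

theorem fourier_add (f g : L2) : (𝓕 (f + g) : L2) = 𝓕 f + 𝓕 g := FourierTransform.fourier_add f g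

theorem fourier_smul (c : ℂ) (f : L2) : (𝓕 (c • f) : L2) = c • (𝓕 f : L2) :=
  FourierTransform.fourier_smul c f

theorem fourier_sub (f g : L2) : (𝓕 (f - g) : L2) = 𝓕 f - 𝓕 g := by
  have := fourier_add (f - g) g
  rw [sub_add_cancel] at this
  rw [this, add_sub_cancel_right]

theorem continuous_fourierInv {f : ℝ → ℂ} (hf : Integrable f) : Continuous (𝓕⁻ f) := by
  have hL : Continuous fun p : ℝ × ℝ => (-(innerₗ ℝ) : ℝ →ₗ[ℝ] ℝ →ₗ[ℝ] ℝ) p.1 p.2 := by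
    have : Continuous fun p : ℝ × ℝ => -(p.2 * p.1) := by fun_prop
    exact this
  exact VectorFourier.fourierIntegral_continuous Real.continuous_fourierChar hL hf

theorem integral_fourierInv_mul {f g : ℝ → ℂ} (hf : Integrable f) (hg : Integrable g) :
    ∫ ξ, (𝓕⁻ f) ξ * g ξ = ∫ x, f x * (𝓕⁻ g) x := by
  have hL : Continuous fun p : ℝ × ℝ => (-(innerₗ ℝ) : ℝ →ₗ[ℝ] ℝ →ₗ[ℝ] ℝ) p.1 p.2 := by
    have : Continuous fun p : ℝ × ℝ => -(p.2 * p.1) := by fun_prop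
    exact this
  have h4 := VectorFourier.integral_fourierIntegral_smul_eq_flip (μ := (volume : Measure ℝ))
    (ν := (volume : Measure ℝ)) (L := (-(innerₗ ℝ) : ℝ →ₗ[ℝ] ℝ →ₗ[ℝ] ℝ)) (f := f) (g := g)
    (e := Real.fourierChar) Real.continuous_fourierChar hL hf hg
  have h5 : (-(innerₗ ℝ) : ℝ →ₗ[ℝ] ℝ →ₗ[ℝ] ℝ).flip = -(innerₗ ℝ) := by
    ext; simp
  rw [h5] at h4
  exact h4

/-- The inverse transform of an integrable `L²` function is given by the integral. -/
theorem fourierInv_coeFn (F : L2) (hF : Integrable (fun ξ => F ξ)) :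
    (𝓕⁻ F : L2) =ᵐ[volume] 𝓕⁻ (fun ξ => F ξ) := by
  -- Both sides are locally integrable, so it suffices to pair them with real test functions g.
  -- Plancherel moves the L² transform onto g, and Fubini moves the integral transform back.
  refine ae_eq_of_integral_contDiff_smul_eq
    ((Lp.memLp _).locallyIntegrable (by norm_num)) (continuous_fourierInv hF).locallyIntegrable ?_
  intro g hg hgc
  have hg' : HasCompactSupport (fun x => (g x : ℂ)) :=
    hgc.comp_left (g := ((↑) : ℝ → ℂ)) (by simp)
  have hgd : ContDiff ℝ ((⊤ : ℕ∞) : WithTop ℕ∞) (fun x => (g x : ℂ)) :=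
    Complex.ofRealCLM.contDiff.comp hg
  set φ : SchwartzMap ℝ ℂ := hg'.toSchwartzMap hgd with hφ
  have hφx : ∀ x, φ x = (g x : ℂ) := fun x => rfl
  have h1 : ∫ x, g x • (𝓕⁻ F : L2) x = inner ℂ (φ.toLp 2 : L2) (𝓕⁻ F : L2) := by
    rw [inner_eq_integral]
    refine integral_congr_ae ?_
    filter_upwards [φ.coeFn_toLp 2 volume] with x hx
    rw [hx, hφx, Complex.conj_ofReal, Complex.real_smul]
  have h2 : (inner ℂ (φ.toLp 2 : L2) (𝓕⁻ F : L2) : ℂ) = ∫ ξ, conj ((𝓕 φ) ξ) * F ξ := by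
    rw [← inner_fourier, fourier_fourierInv, inner_eq_integral, SchwartzMap.toLp_fourier_eq φ]
    refine integral_congr_ae ?_
    filter_upwards [(𝓕 φ).coeFn_toLp 2 volume] with x hx
    rw [hx]
  -- As g is real, the conjugate of its transform is its inverse transform.
  have h3 : ∀ ξ, conj ((𝓕 φ) ξ) = (𝓕⁻ (fun x => (g x : ℂ)) : ℝ → ℂ) ξ := by
    intro ξ
    rw [SchwartzMap.fourier_coe, Real.fourier_eq, Real.fourierInv_eq, ← integral_conj]
    congr 1
    ext x
    rw [hφx, Circle.smul_def, Circle.smul_def, smul_eq_mul, smul_eq_mul, map_mul,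
      Complex.conj_ofReal, ← Circle.coe_inv_eq_conj, ← AddChar.map_neg_eq_inv, neg_neg]
  rw [h1, h2]
  simp_rw [h3, Complex.real_smul]
  exact integral_fourierInv_mul (φ.integrable) hF

instance : TopologicalSpace.SeparableSpace L2 := by
  have : Fact ((2 : ℝ≥0∞) ≠ ∞) := ⟨by norm_num⟩
  have : SecondCountableTopology L2 := Lp.SecondCountableTopology
  infer_instance

/-- Every bounded sequence has a weakly convergent subsequence. -/
theorem exists_weakly_convergent_subseq (u : ℕ → L2) {R : ℝ} (hu : ∀ n, ‖u n‖ ≤ R) :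
    ∃ (k : ℕ → ℕ) (v : L2), StrictMono k ∧
      ∀ φ : L2, Tendsto (fun n => (inner ℂ φ (u (k n)) : ℂ)) atTop (𝓝 (inner ℂ φ v)) := by
  -- Sequential Banach–Alaoglu in the separable space L², carried over by the Riesz isomorphism; a
  -- final conjugation turns pairings with u_n on the left into pairings on the right.
  have hc := WeakDual.isSeqCompact_closedBall ℂ L2 0 R
  let x : ℕ → WeakDual ℂ L2 := fun n => StrongDual.toWeakDual (InnerProductSpace.toDual ℂ L2 (u n))
  have hx : ∀ n, x n ∈ WeakDual.toStrongDual ⁻¹' Metric.closedBall (0 : StrongDual ℂ L2) R := by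
    intro n
    simp only [mem_preimage, Metric.mem_closedBall, dist_zero_right]
    have : WeakDual.toStrongDual (x n) = InnerProductSpace.toDual ℂ L2 (u n) := rfl
    rw [this, LinearIsometryEquiv.norm_map]
    exact hu n
  obtain ⟨a, -, k, hk, hlim⟩ := hc hx
  refine ⟨k, (InnerProductSpace.toDual ℂ L2).symm (WeakDual.toStrongDual a), hk, fun φ => ?_⟩
  have h1 := ((WeakBilin.eval_continuous (topDualPairing ℂ L2) φ).tendsto a).comp hlim
  have h2 : Tendsto (fun n => (inner ℂ (u (k n)) φ : ℂ)) atTop (𝓝 (a φ)) := h1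
  have h3 := (Complex.continuous_conj.tendsto _).comp h2
  have h4 : conj (a φ) = inner ℂ φ ((InnerProductSpace.toDual ℂ L2).symm
      (WeakDual.toStrongDual a)) := by
    rw [← inner_conj_symm, InnerProductSpace.toDual_symm_apply]
    rfl
  rw [← h4]
  refine h3.congr fun n => ?_
  simp only [Function.comp]
  rw [inner_conj_symm]

/-! ### Translations and dilations -/

theorem translate_coeFn (τ : ℝ) (u : L2) : translate τ u =ᵐ[volume] fun x => u (x - τ) :=
  Lp.coeFn_compMeasurePreserving u (measurePreserving_sub_right volume τ)

theorem ae_comp_sub {p : ℝ → Prop} (h : ∀ᵐ x, p x) (τ : ℝ) : ∀ᵐ x, p (x - τ) :=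
  (measurePreserving_sub_right volume τ).quasiMeasurePreserving.ae h

theorem translate_translate (σ τ : ℝ) (u : L2) :
    translate σ (translate τ u) = translate (σ + τ) u := by
  refine Lp.ext ?_
  filter_upwards [translate_coeFn σ (translate τ u), translate_coeFn (σ + τ) u,
    ae_comp_sub (translate_coeFn τ u) σ] with x h1 h2 h3
  rw [h1, h2, h3, sub_sub]

theorem translate_zero (u : L2) : translate 0 u = u := by
  refine Lp.ext ?_
  filter_upwards [translate_coeFn 0 u] with x h1
  rw [h1, sub_zero]

theorem norm_translate (τ : ℝ) (u : L2) : ‖translate τ u‖ = ‖u‖ :=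
  Lp.norm_compMeasurePreserving u _

/-- Translation as a linear operator. -/
def translateCLM (τ : ℝ) : L2 →L[ℂ] L2 :=
  (Lp.compMeasurePreservingₗᵢ ℂ (fun x : ℝ => x - τ)
    (measurePreserving_sub_right volume τ)).toContinuousLinearMap

theorem translate_sub (τ : ℝ) (u v : L2) : translate τ (u - v) = translate τ u - translate τ v :=
  map_sub (translateCLM τ) u v

theorem integral_comp_translate {E : Type*} [NormedAddCommGroup E] [NormedSpace ℝ E]
    (f : ℂ → E) (τ : ℝ) (u : L2) :
    ∫ x, f (translate τ u x) = ∫ x, f (u x) := by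
  rw [← integral_sub_right_eq_self (fun x => f (u x)) τ]
  refine integral_congr_ae ?_
  filter_upwards [translate_coeFn τ u] with x hx
  rw [hx]

theorem measurable_fourierChar_mul (τ : ℝ) :
    Measurable fun ξ : ℝ => ((Real.fourierChar (-(τ * ξ)) : Circle) : ℂ) :=
  (continuous_subtype_val.comp (Real.continuous_fourierChar.comp (by fun_prop))).measurable

theorem fourier_translate (τ : ℝ) (u : L2) :
    (𝓕 (translate τ u) : L2) =ᵐ[volume]
      fun ξ => ((Real.fourierChar (-(τ * ξ)) : Circle) : ℂ) * (𝓕 u : L2) ξ := by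
  have hC : ∀ ξ : ℝ, ‖((Real.fourierChar (-(τ * ξ)) : Circle) : ℂ)‖ ≤ 1 := fun ξ => (Circle.norm_coe _).le
  have key := fourier_eq_of_schwartz
    ((Lp.fourierTransformₗᵢ ℝ ℂ).toContinuousLinearEquiv.toContinuousLinearMap ∘L translateCLM τ)
    (mulCLM _ 1 (measurable_fourierChar_mul τ) hC ∘L
      (Lp.fourierTransformₗᵢ ℝ ℂ).toContinuousLinearEquiv.toContinuousLinearMap) ?_ u
  · have h1 : (𝓕 (translate τ u) : L2) =
      mulCLM _ 1 (measurable_fourierChar_mul τ) hC (𝓕 u : L2) := key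
    rw [h1]
    exact mulCLM_coeFn _ _ _
  · intro φ
    change (𝓕 (translate τ (φ.toLp 2)) : L2) =
      mulCLM _ 1 (measurable_fourierChar_mul τ) hC (𝓕 (φ.toLp 2) : L2)
    have h2 : translate τ (φ.toLp 2) = (SchwartzMap.compSubConstCLM ℂ τ φ).toLp 2 := by
      refine Lp.ext ?_
      filter_upwards [translate_coeFn τ (φ.toLp 2), ae_comp_sub (φ.coeFn_toLp 2 volume) τ,
        (SchwartzMap.compSubConstCLM ℂ τ φ).coeFn_toLp 2 volume] with x h1 h2 h3
      rw [h1, h2, h3]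
      rfl
    rw [h2, SchwartzMap.toLp_fourier_eq, SchwartzMap.toLp_fourier_eq]
    refine Lp.ext ?_
    filter_upwards [(𝓕 (SchwartzMap.compSubConstCLM ℂ τ φ)).coeFn_toLp 2 volume,
      (𝓕 φ).coeFn_toLp 2 volume,
      mulCLM_coeFn (measurable_fourierChar_mul τ) hC ((𝓕 φ).toLp 2)] with ξ h1 h2 h3
    rw [h1, h3, h2, SchwartzMap.fourier_coe, SchwartzMap.fourier_coe, Real.fourier_eq,
      Real.fourier_eq, ← integral_const_mul,
      ← integral_sub_right_eq_self (fun v => _ * (Real.fourierChar (-inner ℝ v ξ) • φ v)) τ]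
    refine integral_congr_ae (ae_of_all _ fun v => ?_)
    have h5 : (SchwartzMap.compSubConstCLM ℂ τ φ) v = φ (v - τ) := rfl
    simp only [h5, Circle.smul_def, smul_eq_mul, ← mul_assoc]
    rw [← Circle.coe_mul, ← AddChar.map_add_eq_mul]
    congr 4
    simp only [RCLike.inner_apply, conj_trivial]
    ring

theorem quasiMeasurePreserving_mul {a : ℝ} (ha : a ≠ 0) :
    Measure.QuasiMeasurePreserving (fun x : ℝ => a * x) volume volume :=
  ⟨measurable_const_mul a, by
    rw [Real.map_volume_mul_left ha]
    exact Measure.smul_absolutelyContinuous⟩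

theorem memLp_comp_mul {a : ℝ} (ha : a ≠ 0) (u : L2) :
    MemLp (fun x => u (a * x)) 2 (volume : Measure ℝ) := by
  have h : MemLp (fun x => u x) 2 (Measure.map (fun x : ℝ => a * x) volume) := by
    rw [Real.map_volume_mul_left ha]
    exact (Lp.memLp u).smul_measure ENNReal.ofReal_ne_top
  exact h.comp_of_map (measurable_const_mul a).aemeasurable

/-- The dilation `x ↦ u (a x)`. -/
def dilate (a : ℝ) (ha : a ≠ 0) (u : L2) : L2 := (memLp_comp_mul ha u).toLp _

theorem dilate_coeFn {a : ℝ} (ha : a ≠ 0) (u : L2) :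
    dilate a ha u =ᵐ[volume] fun x => u (a * x) := (memLp_comp_mul ha u).coeFn_toLp

theorem normSq_dilate {a : ℝ} (ha : 0 < a) (u : L2) :
    ‖dilate a ha.ne' u‖ ^ 2 = a⁻¹ * ‖u‖ ^ 2 := by
  rw [normSq_eq_integral, normSq_eq_integral]
  have h : ∫ x, ‖dilate a ha.ne' u x‖ ^ 2 = ∫ x, (fun y => ‖u y‖ ^ 2) (a * x) := by
    refine integral_congr_ae ?_
    filter_upwards [dilate_coeFn ha.ne' u] with x hx
    rw [hx]
  rw [h, Measure.integral_comp_mul_left (fun y => ‖u y‖ ^ 2) a, abs_of_pos (inv_pos.2 ha), smul_eq_mul]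

theorem integral_comp_dilate (f : ℂ → ℝ) {a : ℝ} (ha : 0 < a) (u : L2) :
    ∫ x, f (dilate a ha.ne' u x) = a⁻¹ * ∫ x, f (u x) := by
  have h : ∫ x, f (dilate a ha.ne' u x) = ∫ x, (fun y => f (u y)) (a * x) := by
    refine integral_congr_ae ?_
    filter_upwards [dilate_coeFn ha.ne' u] with x hx
    rw [hx]
  rw [h, Measure.integral_comp_mul_left (fun y => f (u y)) a, abs_of_pos (inv_pos.2 ha), smul_eq_mul]

/-- Dilation as a linear operator. -/
def dilateCLM (a : ℝ) (ha : 0 < a) : L2 →L[ℂ] L2 :=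
  LinearMap.mkContinuous
    { toFun := fun u => dilate a ha.ne' u
      map_add' := fun u v => by
        refine Lp.ext ?_
        filter_upwards [dilate_coeFn ha.ne' (u + v), dilate_coeFn ha.ne' u, dilate_coeFn ha.ne' v,
          Lp.coeFn_add (dilate a ha.ne' u) (dilate a ha.ne' v),
          (quasiMeasurePreserving_mul ha.ne').ae (Lp.coeFn_add u v)] with x h1 h2 h3 h4 h5
        rw [h1, h4, h5, Pi.add_apply, Pi.add_apply, h2, h3]
      map_smul' := fun c u => by
        refine Lp.ext ?_
        filter_upwards [dilate_coeFn ha.ne' (c • u), dilate_coeFn ha.ne' u,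
          Lp.coeFn_smul c (dilate a ha.ne' u),
          (quasiMeasurePreserving_mul ha.ne').ae (Lp.coeFn_smul c u)] with x h1 h2 h4 h5
        rw [h1, RingHom.id_apply, h4, h5, Pi.smul_apply, Pi.smul_apply, h2] }
    (Real.sqrt a⁻¹) (fun u => by
      refine le_of_sq_le_sq ?_ (by positivity)
      rw [mul_pow, Real.sq_sqrt (inv_pos.2 ha).le]
      exact (normSq_dilate ha u).le)

theorem fourier_dilate {a : ℝ} (ha : 0 < a) (u : L2) :
    (𝓕 (dilate a ha.ne' u) : L2) =ᵐ[volume] fun ξ => (a : ℂ)⁻¹ * (𝓕 u : L2) (a⁻¹ * ξ) := by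
  have ha' : 0 < a⁻¹ := inv_pos.2 ha
  have key := fourier_eq_of_schwartz
    ((Lp.fourierTransformₗᵢ ℝ ℂ).toContinuousLinearEquiv.toContinuousLinearMap ∘L dilateCLM a ha)
    ((a : ℂ)⁻¹ • (dilateCLM a⁻¹ ha' ∘L
      (Lp.fourierTransformₗᵢ ℝ ℂ).toContinuousLinearEquiv.toContinuousLinearMap)) ?_ u
  · have h1 : (𝓕 (dilate a ha.ne' u) : L2) = (a : ℂ)⁻¹ • dilate a⁻¹ ha'.ne' (𝓕 u : L2) := key
    rw [h1]
    filter_upwards [Lp.coeFn_smul (a : ℂ)⁻¹ (dilate a⁻¹ ha'.ne' (𝓕 u : L2)),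
      dilate_coeFn ha'.ne' (𝓕 u : L2)] with ξ h1 h2
    rw [h1, Pi.smul_apply, h2, smul_eq_mul]
  · intro φ
    change (𝓕 (dilate a ha.ne' (φ.toLp 2)) : L2) =
      (a : ℂ)⁻¹ • dilate a⁻¹ ha'.ne' (𝓕 (φ.toLp 2) : L2)
    let e : ℝ ≃L[ℝ] ℝ := ContinuousLinearEquiv.smulLeft (Units.mk0 a ha.ne')
    have he : ∀ x, e x = a * x := fun x => rfl
    set ψ := SchwartzMap.compCLMOfContinuousLinearEquiv ℂ e φ with hψ
    have h5 : ∀ v, ψ v = φ (a * v) := fun v => rfl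
    have h2 : dilate a ha.ne' (φ.toLp 2) = ψ.toLp 2 := by
      refine Lp.ext ?_
      filter_upwards [dilate_coeFn ha.ne' (φ.toLp 2),
        (quasiMeasurePreserving_mul ha.ne').ae (φ.coeFn_toLp 2 volume),
        ψ.coeFn_toLp 2 volume] with x h1 h2 h3
      rw [h1, h2, h3, h5]
    rw [h2, SchwartzMap.toLp_fourier_eq, SchwartzMap.toLp_fourier_eq]
    refine Lp.ext ?_
    filter_upwards [(𝓕 ψ).coeFn_toLp 2 volume,
      (quasiMeasurePreserving_mul ha'.ne').ae ((𝓕 φ).coeFn_toLp 2 volume),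
      Lp.coeFn_smul (a : ℂ)⁻¹ (dilate a⁻¹ ha'.ne' ((𝓕 φ).toLp 2)),
      dilate_coeFn ha'.ne' ((𝓕 φ).toLp 2)] with ξ h1 h2 h3 h4
    rw [h1, h3, Pi.smul_apply, h4, h2, SchwartzMap.fourier_coe, SchwartzMap.fourier_coe,
      Real.fourier_eq, Real.fourier_eq]
    have h6 := Measure.integral_comp_mul_left
      (fun v => Real.fourierChar (-inner ℝ v (a⁻¹ * ξ)) • φ v) a
    rw [abs_of_pos ha'] at h6
    have h7 : (a : ℂ)⁻¹ • ∫ v, Real.fourierChar (-inner ℝ v (a⁻¹ * ξ)) • φ v =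
        a⁻¹ • ∫ v, Real.fourierChar (-inner ℝ v (a⁻¹ * ξ)) • φ v := by
      rw [Complex.real_smul, smul_eq_mul, Complex.ofReal_inv]
    rw [h7, ← h6]
    refine integral_congr_ae (ae_of_all _ fun v => ?_)
    simp only [h5]
    congr 3
    simp only [RCLike.inner_apply, conj_trivial]
    field_simp

/-! ### The graph of the fractional derivative -/

theorem symb_conj (a ξ : ℝ) : conj (symb a ξ) = symb a ξ := Complex.conj_ofReal _

theorem norm_symb (a ξ : ℝ) : ‖symb a ξ‖ = |2 * Real.pi * ξ| ^ a := by
  rw [symb, Complex.norm_real, Real.norm_of_nonneg (by positivity)]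

theorem measurable_symb (a : ℝ) : Measurable (symb a) := by
  unfold symb
  fun_prop

theorem symb_two_mul (s ξ : ℝ) : symb (2 * s) ξ = symb s ξ * symb s ξ := by
  rw [symb, symb, ← Complex.ofReal_mul, mul_comm 2 s, Real.rpow_mul (abs_nonneg _)]
  norm_num [sq]

theorem symb_ne_zero (a : ℝ) {ξ : ℝ} (hξ : ξ ≠ 0) : symb a ξ ≠ 0 := by
  rw [← norm_ne_zero_iff, norm_symb]
  have : 0 < |2 * Real.pi * ξ| := abs_pos.2 (by positivity)
  positivity

theorem symb_mul {a : ℝ} (s : ℝ) (ha : 0 < a) (ξ : ℝ) :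
    ((a ^ s : ℝ) : ℂ) * symb s ξ = symb s (a * ξ) := by
  rw [symb, symb, ← Complex.ofReal_mul, ← Real.mul_rpow ha.le (abs_nonneg _),
    show 2 * Real.pi * (a * ξ) = a * (2 * Real.pi * ξ) by ring, abs_mul a, abs_of_pos ha]

/-- `v = D^a u`, on the Fourier side. -/
def HasD (a : ℝ) (u v : L2) : Prop :=
  (𝓕 v : L2) =ᵐ[volume] fun ξ => symb a ξ * (𝓕 u : L2) ξ

theorem HasD.memHs {a : ℝ} {u v : L2} (h : HasD a u v) : MemHs a u :=
  (memLp_congr_ae h).1 (Lp.memLp _)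

theorem MemHs.hasD {a : ℝ} {u : L2} (h : MemHs a u) : HasD a u (fracD a u) := by
  unfold HasD fracD
  rw [dif_pos h, fourier_fourierInv]
  exact MemLp.coeFn_toLp _

theorem HasD.unique {a : ℝ} {u v w : L2} (h : HasD a u v) (h' : HasD a u w) : v = w :=
  fourier_injective (Lp.ext (h.trans h'.symm))

theorem HasD.fracD_eq {a : ℝ} {u v : L2} (h : HasD a u v) : fracD a u = v :=
  (h.memHs.hasD).unique h

theorem HasD.add {a : ℝ} {u v u' v' : L2} (h : HasD a u u') (h' : HasD a v v') :
    HasD a (u + v) (u' + v') := by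
  unfold HasD at *
  rw [fourier_add, fourier_add]
  filter_upwards [h, h', Lp.coeFn_add (𝓕 u : L2) (𝓕 v), Lp.coeFn_add (𝓕 u' : L2) (𝓕 v')]
    with ξ h1 h2 h3 h4
  rw [h3, h4, Pi.add_apply, Pi.add_apply, h1, h2, mul_add]

theorem HasD.smul {a : ℝ} {u u' : L2} (c : ℂ) (h : HasD a u u') : HasD a (c • u) (c • u') := by
  unfold HasD at *
  rw [fourier_smul, fourier_smul]
  filter_upwards [h, Lp.coeFn_smul c (𝓕 u : L2), Lp.coeFn_smul c (𝓕 u' : L2)]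
    with ξ h1 h3 h4
  rw [h3, h4, Pi.smul_apply, Pi.smul_apply, h1, smul_eq_mul, smul_eq_mul]
  ring

theorem HasD.sub {a : ℝ} {u v u' v' : L2} (h : HasD a u u') (h' : HasD a v v') :
    HasD a (u - v) (u' - v') := by
  have := h.add (h'.smul (-1))
  simpa [sub_eq_add_neg] using this

theorem HasD.translate {a : ℝ} {u v : L2} (h : HasD a u v) (τ : ℝ) :
    HasD a (translate τ u) (translate τ v) := by
  unfold HasD at *
  filter_upwards [h, fourier_translate τ u, fourier_translate τ v] with ξ h1 h2 h3
  rw [h2, h3, h1]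
  ring

theorem HasD.dilate {s a : ℝ} (ha : 0 < a) {u v : L2} (h : HasD s u v) :
    HasD s (dilate a ha.ne' u) (((a ^ s : ℝ) : ℂ) • FNLS.dilate a ha.ne' v) := by
  have ha' : a⁻¹ ≠ 0 := (inv_pos.2 ha).ne'
  unfold HasD at *
  rw [fourier_smul]
  filter_upwards [(quasiMeasurePreserving_mul ha').ae h, fourier_dilate ha u, fourier_dilate ha v,
    Lp.coeFn_smul ((a ^ s : ℝ) : ℂ) (𝓕 (FNLS.dilate a ha.ne' v) : L2)] with ξ h1 h2 h3 h4
  rw [h4, Pi.smul_apply, h3, h2, h1, smul_eq_mul]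
  have h5 := symb_mul s ha (a⁻¹ * ξ)
  rw [mul_inv_cancel_left₀ ha.ne'] at h5
  rw [← h5]
  ring

/-- The operator D^a is symmetric because its symbol is real. -/
theorem HasD.inner_symm {a : ℝ} {u v u' v' : L2} (h : HasD a u u') (h' : HasD a v v') :
    (inner ℂ u' v : ℂ) = inner ℂ u v' := by
  rw [← inner_fourier u', ← inner_fourier u, inner_eq_integral, inner_eq_integral]
  refine integral_congr_ae ?_
  filter_upwards [h, h'] with ξ h1 h2
  rw [h1, h2, map_mul, symb_conj]
  ring

theorem HasD.comp {s : ℝ} {u u' u'' : L2} (h : HasD s u u') (h2 : HasD (2 * s) u u'') :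
    HasD s u' u'' := by
  unfold HasD at *
  filter_upwards [h, h2] with ξ h1 h2
  rw [h2, h1, symb_two_mul, mul_assoc]

theorem MemHs.add {a : ℝ} {u v : L2} (h : MemHs a u) (h' : MemHs a v) : MemHs a (u + v) :=
  (h.hasD.add h'.hasD).memHs

theorem MemHs.sub {a : ℝ} {u v : L2} (h : MemHs a u) (h' : MemHs a v) : MemHs a (u - v) :=
  (h.hasD.sub h'.hasD).memHs

theorem MemHs.smul {a : ℝ} {u : L2} (c : ℂ) (h : MemHs a u) : MemHs a (c • u) :=
  (h.hasD.smul c).memHs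

theorem MemHs.translate {a : ℝ} {u : L2} (h : MemHs a u) (τ : ℝ) : MemHs a (translate τ u) :=
  (h.hasD.translate τ).memHs

theorem fracD_add {a : ℝ} {u v : L2} (h : MemHs a u) (h' : MemHs a v) :
    fracD a (u + v) = fracD a u + fracD a v := (h.hasD.add h'.hasD).fracD_eq

theorem fracD_sub {a : ℝ} {u v : L2} (h : MemHs a u) (h' : MemHs a v) :
    fracD a (u - v) = fracD a u - fracD a v := (h.hasD.sub h'.hasD).fracD_eq

theorem fracD_smul {a : ℝ} {u : L2} (c : ℂ) (h : MemHs a u) :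
    fracD a (c • u) = c • fracD a u := (h.hasD.smul c).fracD_eq

theorem fracD_translate {a : ℝ} {u : L2} (h : MemHs a u) (τ : ℝ) :
    fracD a (translate τ u) = translate τ (fracD a u) := (h.hasD.translate τ).fracD_eq

theorem eq_zero_of_fracD_eq_zero {a : ℝ} {u : L2} (h : MemHs a u) (h0 : fracD a u = 0) :
    u = 0 := by
  have h1 := h.hasD
  rw [h0] at h1
  refine fourier_injective (Lp.ext ?_)
  have h2 : (𝓕 (0 : L2) : L2) = 0 := by
    simp
  have h3 : ∀ᵐ ξ : ℝ, ξ ≠ 0 := by simp [ae_iff, measure_singleton]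
  unfold HasD at h1
  rw [h2] at h1 ⊢
  filter_upwards [h1, h3, Lp.coeFn_zero ℂ 2 (volume : Measure ℝ)] with ξ h4 h5 h6
  rw [h6, Pi.zero_apply] at h4 ⊢
  exact (mul_eq_zero.1 h4.symm).resolve_left (symb_ne_zero a h5)

theorem memHs_zero (a : ℝ) : MemHs a 0 := by
  have h2 : (𝓕 (0 : L2) : L2) = 0 := by
    simp
  refine HasD.memHs (v := 0) ?_
  unfold HasD
  rw [h2]
  filter_upwards [Lp.coeFn_zero ℂ 2 (volume : Measure ℝ)] with ξ h
  rw [h, Pi.zero_apply, mul_zero]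

/-! ### The norm of `H^s` -/

theorem hsNorm_nonneg (s : ℝ) (u : L2) : 0 ≤ hsNorm s u := Real.sqrt_nonneg _

theorem hsNorm_sq (s : ℝ) (u : L2) : hsNorm s u ^ 2 = ‖u‖ ^ 2 + ‖fracD s u‖ ^ 2 :=
  Real.sq_sqrt (by positivity)

theorem norm_le_hsNorm (s : ℝ) (u : L2) : ‖u‖ ≤ hsNorm s u :=
  Real.le_sqrt_of_sq_le (by nlinarith [sq_nonneg ‖fracD s u‖])

theorem norm_fracD_le_hsNorm (s : ℝ) (u : L2) : ‖fracD s u‖ ≤ hsNorm s u :=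
  Real.le_sqrt_of_sq_le (by nlinarith [sq_nonneg ‖u‖])

theorem hsNorm_le_add (s : ℝ) (u : L2) : hsNorm s u ≤ ‖u‖ + ‖fracD s u‖ :=
  Real.sqrt_le_iff.2 ⟨by positivity, by nlinarith [norm_nonneg u, norm_nonneg (fracD s u)]⟩

/-- The graph of D^s in the Hilbert product L² × L² supplies the triangle inequality and the
homogeneity of `hsNorm`. -/
theorem hsNorm_eq_norm (s : ℝ) (u : L2) :
    hsNorm s u = ‖(WithLp.toLp 2 (u, fracD s u) : WithLp 2 (L2 × L2))‖ := by
  rw [WithLp.prod_norm_eq_of_L2]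
  rfl

theorem hsNorm_add_le {s : ℝ} {u v : L2} (h : MemHs s u) (h' : MemHs s v) :
    hsNorm s (u + v) ≤ hsNorm s u + hsNorm s v := by
  rw [hsNorm_eq_norm, hsNorm_eq_norm, hsNorm_eq_norm, fracD_add h h']
  exact norm_add_le (WithLp.toLp 2 (u, fracD s u) : WithLp 2 (L2 × L2))
    (WithLp.toLp 2 (v, fracD s v))

theorem hsNorm_smul {s : ℝ} {u : L2} (c : ℂ) (h : MemHs s u) :
    hsNorm s (c • u) = ‖c‖ * hsNorm s u := by
  rw [hsNorm_eq_norm, hsNorm_eq_norm, fracD_smul c h]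
  exact norm_smul c (WithLp.toLp 2 (u, fracD s u) : WithLp 2 (L2 × L2))

theorem hsNorm_sub_comm {s : ℝ} {u v : L2} (h : MemHs s u) (h' : MemHs s v) :
    hsNorm s (u - v) = hsNorm s (v - u) := by
  have := hsNorm_smul (-1) (h'.sub h)
  simpa using this

theorem hsNorm_sub_le {s : ℝ} {u v w : L2} (h : MemHs s u) (h' : MemHs s v) (h'' : MemHs s w) :
    hsNorm s (u - w) ≤ hsNorm s (u - v) + hsNorm s (v - w) := by
  have := hsNorm_add_le (h.sub h') (h'.sub h'')
  rwa [sub_add_sub_cancel] at this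

theorem hsNorm_le_add_sub {s : ℝ} {u v : L2} (h : MemHs s u) (h' : MemHs s v) :
    hsNorm s u ≤ hsNorm s v + hsNorm s (u - v) := by
  have := hsNorm_add_le h' (h.sub h')
  rwa [add_sub_cancel] at this

theorem hsNorm_translate {s : ℝ} {u : L2} (h : MemHs s u) (τ : ℝ) :
    hsNorm s (translate τ u) = hsNorm s u := by
  unfold hsNorm
  rw [fracD_translate h, norm_translate, norm_translate]

theorem hsNorm_zero (s : ℝ) : hsNorm s 0 = 0 := by
  have := hsNorm_smul 0 (memHs_zero s)
  simpa using this

/-! ### Bounded Fourier multipliers -/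

/-- The Fourier multiplier with a bounded measurable symbol. -/
def fmul (m : ℝ → ℂ) (C : ℝ) (hm : Measurable m) (hC : ∀ x, ‖m x‖ ≤ C) : L2 →L[ℂ] L2 :=
  (Lp.fourierTransformₗᵢ ℝ ℂ).symm.toContinuousLinearEquiv.toContinuousLinearMap ∘L
    mulCLM m C hm hC ∘L (Lp.fourierTransformₗᵢ ℝ ℂ).toContinuousLinearEquiv.toContinuousLinearMap

theorem fourier_fmul {m : ℝ → ℂ} {C : ℝ} (hm : Measurable m) (hC : ∀ x, ‖m x‖ ≤ C) (u : L2) :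
    (𝓕 (fmul m C hm hC u) : L2) =ᵐ[volume] fun ξ => m ξ * (𝓕 u : L2) ξ := by
  have h : fmul m C hm hC u = (𝓕⁻ (mulCLM m C hm hC (𝓕 u : L2)) : L2) := rfl
  rw [h, fourier_fourierInv]
  exact mulCLM_coeFn hm hC _

theorem fmul_symm {m : ℝ → ℂ} {C : ℝ} (hm : Measurable m) (hC : ∀ x, ‖m x‖ ≤ C)
    (hr : ∀ x, conj (m x) = m x) (u v : L2) :
    (inner ℂ (fmul m C hm hC u) v : ℂ) = inner ℂ u (fmul m C hm hC v) := by
  rw [← inner_fourier, ← inner_fourier u, inner_eq_integral, inner_eq_integral]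
  refine integral_congr_ae ?_
  filter_upwards [fourier_fmul hm hC u, fourier_fmul hm hC v] with ξ h1 h2
  rw [h1, h2, map_mul, hr]
  ring

/-- The symbol of the sharp cut-off of `D^a` to the frequencies `|ξ| ≤ R`. -/
def cutSymb (a R ξ : ℝ) : ℂ := (Icc (-R) R).indicator (symb a) ξ

theorem measurable_cutSymb (a R : ℝ) : Measurable (cutSymb a R) :=
  (measurable_symb a).indicator measurableSet_Icc

theorem norm_cutSymb_le {a : ℝ} (ha : 0 ≤ a) (R ξ : ℝ) :
    ‖cutSymb a R ξ‖ ≤ (2 * Real.pi * |R|) ^ a := by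
  unfold cutSymb
  rw [indicator_apply]
  split_ifs with h
  · rw [norm_symb]
    refine Real.rpow_le_rpow (abs_nonneg _) ?_ ha
    rw [abs_mul, abs_of_pos (by positivity)]
    have : |ξ| ≤ |R| := (abs_le.2 h).trans (le_abs_self R)
    gcongr
  · rw [norm_zero]
    positivity

theorem conj_cutSymb (a R ξ : ℝ) : conj (cutSymb a R ξ) = cutSymb a R ξ := by
  unfold cutSymb
  rw [indicator_apply]
  split_ifs
  · exact symb_conj _ _
  · simp

/-- The sharp cut-off of `D^a` to the frequencies `|ξ| ≤ R`. -/
def cutD (a : ℝ) (ha : 0 ≤ a) (R : ℝ) : L2 →L[ℂ] L2 :=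
  fmul (cutSymb a R) _ (measurable_cutSymb a R) (norm_cutSymb_le ha R)

theorem fourier_cutD {a : ℝ} (ha : 0 ≤ a) (R : ℝ) (u : L2) :
    (𝓕 (cutD a ha R u) : L2) =ᵐ[volume] fun ξ => cutSymb a R ξ * (𝓕 u : L2) ξ :=
  fourier_fmul _ _ _

theorem cutD_symm {a : ℝ} (ha : 0 ≤ a) (R : ℝ) (u v : L2) :
    (inner ℂ (cutD a ha R u) v : ℂ) = inner ℂ u (cutD a ha R v) :=
  fmul_symm _ _ (conj_cutSymb a R) u v

/-- The projection on the frequencies `|ξ| ≤ R`. -/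
def lowpass (R : ℝ) : L2 →L[ℂ] L2 := cutD 0 le_rfl R

theorem symb_zero (ξ : ℝ) : symb 0 ξ = 1 := by simp [symb]

theorem cutSymb_zero (R ξ : ℝ) : cutSymb 0 R ξ = (Icc (-R) R).indicator 1 ξ := by
  unfold cutSymb
  congr 1
  ext ξ
  exact symb_zero ξ

theorem fourier_lowpass (R : ℝ) (u : L2) :
    (𝓕 (lowpass R u) : L2) =ᵐ[volume] (Icc (-R) R).indicator (𝓕 u : L2) := by
  filter_upwards [fourier_cutD le_rfl R u] with ξ h
  rw [lowpass, h, cutSymb_zero, indicator_apply, indicator_apply]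
  split_ifs <;> simp

theorem hasD_lowpass {a : ℝ} (ha : 0 ≤ a) (R : ℝ) (u : L2) :
    HasD a (lowpass R u) (cutD a ha R u) := by
  unfold HasD
  filter_upwards [fourier_cutD ha R u, fourier_lowpass R u] with ξ h1 h2
  rw [h1, h2, cutSymb, indicator_apply, indicator_apply]
  split_ifs <;> simp

theorem lowpass_cutD {a : ℝ} (ha : 0 ≤ a) (R : ℝ) (u : L2) :
    lowpass R (cutD a ha R u) = cutD a ha R u := by
  refine fourier_injective (Lp.ext ?_)
  filter_upwards [fourier_cutD ha R u, fourier_lowpass R (cutD a ha R u)] with ξ h1 h2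
  rw [h2, h1, indicator_apply]
  split_ifs with h
  · exact h1
  · rw [cutSymb, indicator_of_notMem h, zero_mul]

theorem norm_lowpass_le (R : ℝ) (u : L2) : ‖lowpass R u‖ ≤ ‖u‖ := by
  rw [← norm_fourier, ← norm_fourier u]
  refine Lp.norm_le_norm_of_ae_le ?_
  filter_upwards [fourier_lowpass R u] with ξ h
  rw [h]
  exact norm_indicator_le_norm_self _ _

theorem norm_sub_lowpass_le (R : ℝ) (u : L2) : ‖u - lowpass R u‖ ≤ ‖u‖ := by
  rw [← norm_fourier, ← norm_fourier u, fourier_sub]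
  refine Lp.norm_le_norm_of_ae_le ?_
  filter_upwards [fourier_lowpass R u, Lp.coeFn_sub (𝓕 u : L2) (𝓕 (lowpass R u))] with ξ h h'
  rw [h', Pi.sub_apply, h, indicator_apply]
  split_ifs <;> simp

theorem HasD.lowpass {a : ℝ} {u v : L2} (h : HasD a u v) (R : ℝ) :
    HasD a (lowpass R u) (FNLS.lowpass R v) := by
  unfold HasD at *
  filter_upwards [h, fourier_lowpass R u, fourier_lowpass R v] with ξ h1 h2 h3
  rw [h2, h3, indicator_apply, indicator_apply, h1]
  split_ifs <;> simp

theorem hsNorm_sub_lowpass_le {s : ℝ} {u : L2} (h : MemHs s u) (R : ℝ) :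
    hsNorm s (u - lowpass R u) ≤ hsNorm s u := by
  unfold hsNorm
  refine Real.sqrt_le_sqrt ?_
  rw [(h.hasD.sub (h.hasD.lowpass R)).fracD_eq]
  gcongr
  · exact norm_sub_lowpass_le R u
  · exact norm_sub_lowpass_le R _

/-- The high frequency part is controlled by the derivative. -/
theorem rpow_mul_norm_sub_lowpass_le {s R : ℝ} (hs : 0 ≤ s) (hR : 0 ≤ R) {u : L2}
    (h : MemHs s u) :
    (2 * Real.pi * R) ^ s * ‖u - lowpass R u‖ ≤ ‖fracD s u‖ := by
  have h1 : ‖((((2 * Real.pi * R) ^ s : ℝ) : ℂ)) • (u - lowpass R u)‖ ≤ ‖fracD s u‖ := by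
    rw [← norm_fourier, ← norm_fourier (fracD s u), fourier_smul, fourier_sub]
    refine Lp.norm_le_norm_of_ae_le ?_
    filter_upwards [h.hasD, fourier_lowpass R u,
      Lp.coeFn_smul (((2 * Real.pi * R) ^ s : ℝ) : ℂ) ((𝓕 u : L2) - (𝓕 (lowpass R u))),
      Lp.coeFn_sub (𝓕 u : L2) (𝓕 (lowpass R u))] with ξ h1 h2 h3 h4
    rw [h3, Pi.smul_apply, h4, Pi.sub_apply, h2, h1, indicator_apply]
    split_ifs with hξ
    · rw [sub_self, smul_zero, norm_zero]
      exact norm_nonneg _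
    · rw [sub_zero, smul_eq_mul, norm_mul, norm_mul, norm_symb, Complex.norm_real,
        Real.norm_of_nonneg (by positivity)]
      refine mul_le_mul_of_nonneg_right (Real.rpow_le_rpow (by positivity) ?_ hs) (norm_nonneg _)
      rw [abs_mul, abs_of_pos (by positivity)]
      have : R ≤ |ξ| := by
        by_contra hlt
        exact hξ (abs_le.1 (not_le.1 hlt).le)
      gcongr
  rwa [norm_smul, Complex.norm_real, Real.norm_of_nonneg (by positivity)] at h1

/-- Weak characterization of `D^a u` by band limited functions. -/
theorem hasD_of_inner {a : ℝ} (ha : 0 ≤ a) {u g : L2}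
    (h : ∀ (R : ℝ) (φ : L2), (inner ℂ (cutD a ha R φ) u : ℂ) = inner ℂ (lowpass R φ) g) :
    HasD a u g := by
  -- Testing against all φ identifies the truncations to each frequency band. The bands |ξ| ≤ n
  -- exhaust the line, which gives the identity almost everywhere.
  have h1 : ∀ R : ℝ, cutD a ha R u = lowpass R g := by
    intro R
    refine ext_inner_left ℂ fun φ => ?_
    rw [← cutD_symm, h R φ, lowpass, cutD_symm]
  have h2 : ∀ n : ℕ, ∀ᵐ ξ, ξ ∈ Icc (-(n : ℝ)) n → (𝓕 g : L2) ξ = symb a ξ * (𝓕 u : L2) ξ := by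
    intro n
    have h3 := fourier_cutD ha n u
    rw [h1 n] at h3
    filter_upwards [h3, fourier_lowpass n g] with ξ h4 h5 hξ
    rw [h5, indicator_of_mem hξ, cutSymb, indicator_of_mem hξ] at h4
    exact h4
  filter_upwards [ae_all_iff.2 h2] with ξ hξ
  obtain ⟨n, hn⟩ := exists_nat_ge |ξ|
  exact hξ n (abs_le.1 hn)

/-- The evaluation of a band limited function. -/
theorem lowpass_coeFn (R : ℝ) (u : L2) :
    lowpass R u =ᵐ[volume]
      fun x => ∫ ξ in Icc (-R) R, (Real.fourierChar (ξ * x) : Circle) • (𝓕 u : L2) ξ := by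
  have hint : Integrable (fun ξ => (𝓕 (lowpass R u) : L2) ξ) := by
    refine Integrable.congr ?_ (fourier_lowpass R u).symm
    rw [integrable_indicator_iff measurableSet_Icc]
    exact ((Lp.memLp (𝓕 u : L2)).restrict _).integrable (by norm_num)
  have h := fourierInv_coeFn _ hint
  rw [fourierInv_fourier] at h
  filter_upwards [h] with x hx
  rw [hx, Real.fourierInv_eq, ← integral_indicator measurableSet_Icc]
  refine integral_congr_ae ?_
  filter_upwards [fourier_lowpass R u] with ξ h1
  rw [h1, indicator_apply, indicator_apply]
  split_ifs
  · congr 2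
    simp only [RCLike.inner_apply, conj_trivial]
    rw [mul_comm]
  · rw [smul_zero]

/-! ### Integrability of powers -/

theorem integral_mul_le_sqrt_mul_sqrt {α : Type*} [MeasurableSpace α] {μ : Measure α} {f g : α → ℝ}
    (hf0 : ∀ x, 0 ≤ f x) (hg0 : ∀ x, 0 ≤ g x) (hf : MemLp f 2 μ) (hg : MemLp g 2 μ) :
    ∫ x, f x * g x ∂μ ≤ Real.sqrt (∫ x, f x ^ 2 ∂μ) * Real.sqrt (∫ x, g x ^ 2 ∂μ) := by
  have h := integral_mul_le_Lp_mul_Lq_of_nonneg (μ := μ) (p := 2) (q := 2)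
    Real.HolderConjugate.two_two (ae_of_all _ hf0) (ae_of_all _ hg0)
    (by simpa using hf) (by simpa using hg)
  rw [Real.sqrt_eq_rpow, Real.sqrt_eq_rpow]
  simpa using h

/-- A weak type bound implies bounds for the intermediate powers. -/
theorem integral_rpow_le_of_weak (u : L2) {k b D Λ : ℝ} (hk : 2 < k) (hkb : k < b) (hD : 0 ≤ D)
    (hΛ : 0 < Λ)
    (h : ∀ t, Λ ≤ t → volume {x | t < ‖u x‖} ≤ ENNReal.ofReal (D * t ^ (-b))) :
    Integrable (fun x => ‖u x‖ ^ k) ∧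
      ∫ x, ‖u x‖ ^ k ≤ k / 2 * Λ ^ (k - 2) * ‖u‖ ^ 2 + k * D / (b - k) * Λ ^ (k - b) := by
  have hm : AEMeasurable (fun x => ‖u x‖) volume := (Lp.aestronglyMeasurable u).norm.aemeasurable
  have h0 : 0 ≤ᵐ[volume] fun x => ‖u x‖ := ae_of_all _ fun x => norm_nonneg _
  have hk0 : 0 < k := by linarith
  have e1 := lintegral_rpow_eq_lintegral_meas_lt_mul volume h0 hm hk0
  have e2 := lintegral_rpow_eq_lintegral_meas_lt_mul volume h0 hm (p := 2) two_pos
  have e3 : ∫⁻ x, ENNReal.ofReal (‖u x‖ ^ (2 : ℝ)) = ENNReal.ofReal (‖u‖ ^ 2) := by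
    rw [normSq_eq_integral, ofReal_integral_eq_lintegral_ofReal (integrable_normSq u)
      (ae_of_all _ fun x => by positivity)]
    simp
  set F : ℝ → ℝ≥0∞ := fun t => volume {x | t < ‖u x‖} with hF
  -- Layer cake formula, cut at height Λ. Below Λ, t^(k-1) ≤ Λ^(k-2)·t and the L² norm controls the
  -- integral; above Λ, the weak bound leaves t^(k-1-b), which is integrable as k < b.
  have hsplit : ∫⁻ t in Ioi 0, F t * ENNReal.ofReal (t ^ (k - 1)) =
      (∫⁻ t in Ioc 0 Λ, F t * ENNReal.ofReal (t ^ (k - 1))) +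
        ∫⁻ t in Ioi Λ, F t * ENNReal.ofReal (t ^ (k - 1)) := by
    rw [← lintegral_union measurableSet_Ioi (by
      rw [Set.disjoint_left]; intro x hx hx'; exact absurd hx.2 (not_le.2 hx')),
      Ioc_union_Ioi_eq_Ioi hΛ.le]
  have b1 : ∫⁻ t in Ioc 0 Λ, F t * ENNReal.ofReal (t ^ (k - 1)) ≤
      ENNReal.ofReal (Λ ^ (k - 2)) * ∫⁻ t in Ioi 0, F t * ENNReal.ofReal (t ^ ((2 : ℝ) - 1)) := by
    rw [← lintegral_const_mul' _ _ ENNReal.ofReal_ne_top]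
    refine le_trans (setLIntegral_mono' measurableSet_Ioc ?_)
      (lintegral_mono_set Ioc_subset_Ioi_self)
    intro t ht
    rw [mul_left_comm, ← ENNReal.ofReal_mul (by positivity)]
    gcongr
    rw [show k - 1 = (k - 2) + (2 - 1) by ring, Real.rpow_add ht.1]
    have := ht.1
    have := ht.2
    gcongr
  have b2 : ∫⁻ t in Ioi Λ, F t * ENNReal.ofReal (t ^ (k - 1)) ≤
      ENNReal.ofReal (D / (b - k) * Λ ^ (k - b)) := by
    have e4 := integral_Ioi_rpow_of_lt (a := k - 1 - b) (by linarith) hΛ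
    have e5 := integrableOn_Ioi_rpow_of_lt (a := k - 1 - b) (by linarith) hΛ
    have e6 : D / (b - k) * Λ ^ (k - b) = ∫ t in Ioi Λ, D * t ^ (k - 1 - b) := by
      rw [integral_const_mul, e4, show k - 1 - b + 1 = -(b - k) by ring, neg_div_neg_eq,
        show k - b = -(b - k) by ring]
      ring
    rw [e6, ofReal_integral_eq_lintegral_ofReal (e5.const_mul D) (by
      filter_upwards [ae_restrict_mem measurableSet_Ioi] with t ht
      have : 0 < t := hΛ.trans ht
      simp only [Pi.zero_apply]
      positivity)]
    refine setLIntegral_mono' measurableSet_Ioi fun t ht => ?_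
    have ht0 : 0 < t := hΛ.trans ht
    refine (mul_le_mul_left (h t (le_of_lt ht)) _).trans (le_of_eq ?_)
    rw [← ENNReal.ofReal_mul (by positivity), mul_assoc, ← Real.rpow_add ht0]
    congr 3
    ring
  have hbk : 0 < b - k := sub_pos.2 hkb
  have htot : ∫⁻ x, ENNReal.ofReal (‖u x‖ ^ k) ≤
      ENNReal.ofReal (k / 2 * Λ ^ (k - 2) * ‖u‖ ^ 2 + k * D / (b - k) * Λ ^ (k - b)) := by
    rw [e3] at e2
    have e7 : ∫⁻ t in Ioi 0, F t * ENNReal.ofReal (t ^ ((2 : ℝ) - 1)) =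
        ENNReal.ofReal (‖u‖ ^ 2 / 2) := by
      rw [ENNReal.ofReal_div_of_pos two_pos, e2, mul_comm, ENNReal.mul_div_cancel_right]
      · simp
      · simp
    rw [e1, hsplit]
    calc _ ≤ ENNReal.ofReal k * (ENNReal.ofReal (Λ ^ (k - 2)) * ENNReal.ofReal (‖u‖ ^ 2 / 2) +
          ENNReal.ofReal (D / (b - k) * Λ ^ (k - b))) := by
          rw [← e7]
          gcongr
      _ = _ := by
          rw [← ENNReal.ofReal_mul (by positivity), ← ENNReal.ofReal_add (by positivity)
            (by positivity), ← ENNReal.ofReal_mul (by positivity)]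
          congr 1
          ring
  have hsm : AEStronglyMeasurable (fun x => ‖u x‖ ^ k) volume :=
    (hm.pow_const k).aestronglyMeasurable
  have hnn : 0 ≤ᵐ[volume] fun x => ‖u x‖ ^ k := ae_of_all _ fun x => by positivity
  refine ⟨⟨hsm, ?_⟩, ?_⟩
  · rw [hasFiniteIntegral_iff_ofReal hnn]
    exact htot.trans_lt ENNReal.ofReal_lt_top
  · rw [integral_eq_lintegral_of_nonneg_ae hnn hsm]
    exact ENNReal.toReal_le_of_le_ofReal (by positivity) htot

/-- Distribution function of `u` in terms of its high frequency part. -/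
theorem volume_lt_norm_le {u : L2} {R t M : ℝ} (ht : 0 < t)
    (hM : ∀ᵐ x, ‖lowpass R u x‖ ≤ M) (hMt : M ≤ t / 2) :
    volume {x | t < ‖u x‖} ≤ ENNReal.ofReal (4 / t ^ 2 * ‖u - lowpass R u‖ ^ 2) := by
  set Q := u - lowpass R u with hQ
  -- Where |u| > t the low frequency part is at most t/2, so the high frequency part is at least
  -- t/2; Chebyshev's inequality concludes.
  have h1 : volume {x | t < ‖u x‖} ≤
      volume {x | ENNReal.ofReal (t ^ 2 / 4) ≤ ENNReal.ofReal (‖Q x‖ ^ 2)} := by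
    refine measure_mono_ae ?_
    filter_upwards [hM, Lp.coeFn_sub u (lowpass R u)] with x h2 h3 h4
    have h4 : t < ‖u x‖ := h4
    change ENNReal.ofReal (t ^ 2 / 4) ≤ ENNReal.ofReal (‖Q x‖ ^ 2)
    refine ENNReal.ofReal_le_ofReal ?_
    have h5 : ‖u x‖ - ‖lowpass R u x‖ ≤ ‖Q x‖ := by
      rw [hQ, h3]
      exact norm_sub_norm_le _ _
    have h6 : t / 2 ≤ ‖Q x‖ := by linarith
    nlinarith
  refine h1.trans ?_
  have h2 := mul_meas_ge_le_lintegral₀ (μ := (volume : Measure ℝ))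
    (f := fun x => ENNReal.ofReal (‖Q x‖ ^ 2))
    ((Lp.aestronglyMeasurable Q).norm.aemeasurable.pow_const 2).ennreal_ofReal
    (ENNReal.ofReal (t ^ 2 / 4))
  rw [← ofReal_integral_eq_lintegral_ofReal (integrable_normSq Q)
    (ae_of_all _ fun x => by positivity), ← normSq_eq_integral] at h2
  have h3 : ENNReal.ofReal (t ^ 2 / 4) ≠ 0 := by
    rw [Ne, ENNReal.ofReal_eq_zero, not_le]; positivity
  rw [mul_comm, ← ENNReal.le_div_iff_mul_le (Or.inl h3) (Or.inl ENNReal.ofReal_ne_top),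
    ← ENNReal.ofReal_div_of_pos (by positivity)] at h2
  refine h2.trans (le_of_eq ?_)
  congr 1
  field_simp

theorem norm_lowpass_le_integral (R : ℝ) (u : L2) :
    ∀ᵐ x, ‖lowpass R u x‖ ≤ ∫ ξ in Icc (-R) R, ‖(𝓕 u : L2) ξ‖ := by
  filter_upwards [lowpass_coeFn R u] with x hx
  rw [hx]
  refine (norm_integral_le_integral_norm _).trans (le_of_eq ?_)
  congr 1
  ext ξ
  rw [Circle.norm_smul]

theorem setIntegral_normSq_le (u : L2) (S : Set ℝ) : ∫ x in S, ‖u x‖ ^ 2 ≤ ‖u‖ ^ 2 := by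
  rw [normSq_eq_integral]
  exact setIntegral_le_integral (integrable_normSq u) (ae_of_all _ fun x => by positivity)

theorem integral_fourier_le_sqrt {R : ℝ} (hR : 0 ≤ R) (u : L2) :
    ∫ ξ in Icc (-R) R, ‖(𝓕 u : L2) ξ‖ ≤ Real.sqrt (2 * R) * ‖u‖ := by
  have h := integral_mul_le_sqrt_mul_sqrt (μ := volume.restrict (Icc (-R) R)) (f := fun _ => 1)
    (g := fun ξ => ‖(𝓕 u : L2) ξ‖) (fun _ => zero_le_one) (fun _ => norm_nonneg _)
    (memLp_const 1) ((Lp.memLp (𝓕 u : L2)).restrict _).norm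
  simp only [one_mul, one_pow] at h
  refine h.trans ?_
  gcongr
  · refine le_of_eq ?_
    rw [setIntegral_const, smul_eq_mul, mul_one, Real.volume_real_Icc_of_le (by linarith)]
    ring
  · refine Real.sqrt_le_iff.2 ⟨norm_nonneg _, ?_⟩
    rw [← norm_fourier u]
    exact setIntegral_normSq_le _ _

theorem norm_le_one_add_symb {a ξ : ℝ} (ha : 1 ≤ a) : |ξ| ≤ 1 + |2 * Real.pi * ξ| ^ a := by
  rcases le_total |ξ| 1 with h | h
  · have : 0 ≤ |2 * Real.pi * ξ| ^ a := by positivity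
    linarith
  · have h2 : |ξ| ≤ |2 * Real.pi * ξ| := by
      rw [abs_mul, abs_of_pos Real.two_pi_pos]
      nlinarith [Real.pi_gt_three]
    have h3 : |2 * Real.pi * ξ| ^ (1 : ℝ) ≤ |2 * Real.pi * ξ| ^ a :=
      Real.rpow_le_rpow_of_exponent_le (h.trans h2) ha
    rw [Real.rpow_one] at h3
    linarith

/-- Logarithmic growth (in the form of arbitrarily small powers) of the low frequency part of a
function of `H^s`, `s ≥ 1/2`. -/
theorem integral_fourier_le_rpow {s : ℝ} (hs : 1 / 2 ≤ s) {δ : ℝ} (hδ : 0 < δ) :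
    ∃ C : ℝ, 0 < C ∧ ∀ R, 1 ≤ R → ∀ u : L2, MemHs s u →
      ∫ ξ in Icc (-R) R, ‖(𝓕 u : L2) ξ‖ ≤ C * R ^ δ * hsNorm s u := by
  -- Cauchy–Schwarz with the weight (1+|ξ|)^(1/2): since 2s ≥ 1, the integral of (1+|ξ|)|û|² is
  -- bounded by the square of the H^s norm. The other factor, ∫ (1+|ξ|)⁻¹ over |ξ| ≤ R, is of order
  -- log R and is bounded here by (2R)^(2δ)·K, because 1+|ξ| ≤ 2R there.
  set K : ℝ := ∫ ξ : ℝ, (1 + ‖ξ‖) ^ (-(1 + 2 * δ)) with hK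
  have hint : Integrable (fun ξ : ℝ => (1 + ‖ξ‖) ^ (-(1 + 2 * δ))) :=
    integrable_one_add_norm (by simp; exact hδ)
  have hK0 : 0 ≤ K := integral_nonneg fun ξ => by positivity
  refine ⟨Real.sqrt (2 ^ (2 * δ) * K) * Real.sqrt 2 + 1, by positivity, fun R hR u hu => ?_⟩
  have hw0 : ∀ ξ : ℝ, 0 < 1 + ‖ξ‖ := fun ξ => by positivity
  -- the two factors
  have hpt : ∀ ξ, ((1 + ‖ξ‖) ^ (1 / 2 : ℝ) * ‖(𝓕 u : L2) ξ‖) ^ 2 ≤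
      2 * (‖(𝓕 u : L2) ξ‖ ^ 2 + ‖symb s ξ * (𝓕 u : L2) ξ‖ ^ 2) := by
    intro ξ
    rw [mul_pow, ← Real.rpow_natCast ((1 + ‖ξ‖) ^ (1 / 2 : ℝ)), ← Real.rpow_mul (hw0 ξ).le,
      norm_mul, mul_pow, norm_symb, ← Real.rpow_natCast (|2 * Real.pi * ξ| ^ s),
      ← Real.rpow_mul (abs_nonneg _)]
    have h1 := norm_le_one_add_symb (a := s * (2 : ℕ)) (ξ := ξ) (by push_cast; linarith)
    have h2 : (1 / 2 : ℝ) * (2 : ℕ) = 1 := by norm_num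
    have h3 : 0 ≤ |2 * Real.pi * ξ| ^ (s * (2 : ℕ)) := by positivity
    rw [h2, Real.rpow_one, Real.norm_eq_abs]
    nlinarith [sq_nonneg ‖(𝓕 u : L2) ξ‖]
  have hd : ∫ ξ, ‖symb s ξ * (𝓕 u : L2) ξ‖ ^ 2 = ‖fracD s u‖ ^ 2 := by
    rw [← norm_fourier (fracD s u), normSq_eq_integral]
    refine integral_congr_ae ?_
    filter_upwards [hu.hasD] with ξ h
    rw [h]
  have hsi : Integrable fun ξ => ‖symb s ξ * (𝓕 u : L2) ξ‖ ^ 2 :=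
    (memLp_two_iff_integrable_sq_norm hu.1).1 hu
  have hsum : Integrable fun ξ =>
      2 * (‖(𝓕 u : L2) ξ‖ ^ 2 + ‖symb s ξ * (𝓕 u : L2) ξ‖ ^ 2) :=
    ((integrable_normSq _).add hsi).const_mul 2
  have hgm : AEStronglyMeasurable (fun ξ => (1 + ‖ξ‖) ^ (1 / 2 : ℝ) * ‖(𝓕 u : L2) ξ‖) volume :=
    (by fun_prop : Measurable fun ξ : ℝ => (1 + ‖ξ‖) ^ (1 / 2 : ℝ)).aestronglyMeasurable.mul
      (Lp.aestronglyMeasurable _).norm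
  have hgi : Integrable fun ξ => ((1 + ‖ξ‖) ^ (1 / 2 : ℝ) * ‖(𝓕 u : L2) ξ‖) ^ 2 :=
    hsum.mono' (hgm.pow 2) (ae_of_all _ fun ξ => by
      rw [Real.norm_of_nonneg (by positivity)]; exact hpt ξ)
  have hg2 : ∫ ξ in Icc (-R) R, ((1 + ‖ξ‖) ^ (1 / 2 : ℝ) * ‖(𝓕 u : L2) ξ‖) ^ 2 ≤
      2 * hsNorm s u ^ 2 := by
    refine (setIntegral_le_integral hgi (ae_of_all _ fun ξ => by positivity)).trans ?_
    refine (integral_mono hgi hsum hpt).trans (le_of_eq ?_)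
    rw [integral_const_mul, integral_add (integrable_normSq _) hsi, hd, hsNorm_sq,
      ← normSq_eq_integral, norm_fourier]
  have hfm : Measurable fun ξ : ℝ => (1 + ‖ξ‖) ^ (-(1 / 2) : ℝ) := by fun_prop
  have hf2 : ∫ ξ in Icc (-R) R, ((1 + ‖ξ‖) ^ (-(1 / 2) : ℝ)) ^ 2 ≤ (2 * R) ^ (2 * δ) * K := by
    rw [hK, ← integral_const_mul]
    refine le_trans ?_ (setIntegral_le_integral (s := Icc (-R) R) (hint.const_mul _)
      (ae_of_all _ fun ξ => by
        simp only [Pi.zero_apply]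
        positivity))
    refine setIntegral_mono_on ?_ (hint.const_mul _).integrableOn measurableSet_Icc ?_
    · refine (continuous_iff_continuousAt.2 fun ξ => ?_).continuousOn.integrableOn_Icc
      exact ((by fun_prop : ContinuousAt (fun ξ : ℝ => 1 + ‖ξ‖) ξ).rpow_const
        (Or.inl (hw0 ξ).ne')).pow 2
    · intro ξ hξ
      have h1 : 1 + ‖ξ‖ ≤ 2 * R := by
        have := abs_le.2 hξ
        rw [Real.norm_eq_abs]; linarith
      rw [← Real.rpow_natCast ((1 + ‖ξ‖) ^ (-(1 / 2) : ℝ)), ← Real.rpow_mul (hw0 ξ).le]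
      have h2 : (1 + ‖ξ‖) ^ (-(1 / 2) * (2 : ℕ) : ℝ) =
          (1 + ‖ξ‖) ^ (2 * δ) * (1 + ‖ξ‖) ^ (-(1 + 2 * δ)) := by
        rw [← Real.rpow_add (hw0 ξ)]
        congr 1
        push_cast
        ring
      rw [h2]
      gcongr
  have hfL : MemLp (fun ξ : ℝ => (1 + ‖ξ‖) ^ (-(1 / 2) : ℝ)) 2 (volume.restrict (Icc (-R) R)) := by
    refine MemLp.of_bound hfm.aestronglyMeasurable 1 (ae_of_all _ fun ξ => ?_)
    rw [Real.norm_of_nonneg (by positivity)]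
    exact Real.rpow_le_one_of_one_le_of_nonpos (by linarith [norm_nonneg ξ]) (by norm_num)
  have hgL : MemLp (fun ξ => (1 + ‖ξ‖) ^ (1 / 2 : ℝ) * ‖(𝓕 u : L2) ξ‖) 2
      (volume.restrict (Icc (-R) R)) :=
    ((memLp_two_iff_integrable_sq hgm).2 hgi).restrict _
  have hmul : ∫ ξ in Icc (-R) R, ‖(𝓕 u : L2) ξ‖ = ∫ ξ in Icc (-R) R,
      (1 + ‖ξ‖) ^ (-(1 / 2) : ℝ) * ((1 + ‖ξ‖) ^ (1 / 2 : ℝ) * ‖(𝓕 u : L2) ξ‖) := by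
    congr 1
    ext ξ
    rw [← mul_assoc, ← Real.rpow_add (hw0 ξ)]
    norm_num
  rw [hmul]
  refine (integral_mul_le_sqrt_mul_sqrt (fun ξ => by positivity) (fun ξ => by positivity)
    hfL hgL).trans ?_
  have hsq1 : Real.sqrt ((2 * R) ^ (2 * δ) * K) = Real.sqrt (2 ^ (2 * δ) * K) * R ^ δ := by
    rw [Real.mul_rpow (by norm_num) (by linarith), mul_right_comm,
      Real.sqrt_mul' _ (by positivity)]
    congr 1
    rw [Real.sqrt_eq_rpow, ← Real.rpow_mul (by linarith)]
    congr 1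
    ring
  have hsq2 : Real.sqrt (2 * hsNorm s u ^ 2) = Real.sqrt 2 * hsNorm s u := by
    rw [Real.sqrt_mul' _ (by positivity), Real.sqrt_sq (hsNorm_nonneg _ _)]
  calc _ ≤ Real.sqrt ((2 * R) ^ (2 * δ) * K) * Real.sqrt (2 * hsNorm s u ^ 2) := by gcongr
    _ = (Real.sqrt (2 ^ (2 * δ) * K) * Real.sqrt 2) * (R ^ δ * hsNorm s u) := by
        rw [hsq1, hsq2]; ring
    _ ≤ (Real.sqrt (2 ^ (2 * δ) * K) * Real.sqrt 2 + 1) * (R ^ δ * hsNorm s u) := by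
        have := hsNorm_nonneg s u
        gcongr
        linarith
    _ = _ := by ring

/-! ### Sobolev and Gagliardo–Nirenberg inequalities -/

theorem eq_zero_of_hsNorm_eq_zero {s : ℝ} {u : L2} (h : hsNorm s u = 0) : u = 0 :=
  norm_le_zero_iff.1 (h ▸ norm_le_hsNorm s u)

/-- At s = 1/2 there is no embedding in L^∞, so u is cut at a frequency that depends on the height
t. With A the H^s norm, Λ = 2CA and R = (t/Λ)^k, the low part is at most C·R^(1/k)·A = t/2, and the
high part has squared L² norm at most A²/R. The distribution function then decays like t^(-k-2),
which is enough for the power k. -/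
theorem integral_rpow_le_hsNorm {s : ℝ} (hs : 1 / 2 ≤ s) {k : ℝ} (hk : 2 < k) :
    ∃ C : ℝ, 0 < C ∧ ∀ u : L2, MemHs s u →
      Integrable (fun x => ‖u x‖ ^ k) ∧ ∫ x, ‖u x‖ ^ k ≤ C * hsNorm s u ^ k := by
  have hk0 : 0 < k := by linarith
  obtain ⟨C, hC, hlog⟩ := integral_fourier_le_rpow hs (δ := 1 / k) (by positivity)
  refine ⟨k * (5 / 2) * (2 * C) ^ (k - 2), by positivity, fun u hu => ?_⟩
  -- A vanishing norm is treated apart, since Λ must be positive.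
  rcases (hsNorm_nonneg s u).eq_or_lt with h0 | hA
  · have hu0 := eq_zero_of_hsNorm_eq_zero h0.symm
    have h1 : (fun x => ‖u x‖ ^ k) =ᵐ[volume] fun _ => 0 := by
      rw [hu0]
      filter_upwards [Lp.coeFn_zero ℂ 2 (volume : Measure ℝ)] with x hx
      rw [hx, Pi.zero_apply, norm_zero, Real.zero_rpow hk0.ne']
    refine ⟨(integrable_zero _ _ _).congr h1.symm, ?_⟩
    rw [integral_congr_ae h1, integral_zero]
    positivity
  set A := hsNorm s u with hAdef
  set Λ : ℝ := 2 * C * A with hΛdef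
  have hΛ : 0 < Λ := by positivity
  obtain ⟨hi, hle⟩ := integral_rpow_le_of_weak u (k := k) (b := k + 2) (D := 4 * A ^ 2 * Λ ^ k)
    (Λ := Λ) hk (by linarith) (by positivity) hΛ (fun t ht => by
      have ht0 : 0 < t := hΛ.trans_le ht
      set R : ℝ := (t / Λ) ^ k with hR
      have hR1 : 1 ≤ R := Real.one_le_rpow ((one_le_div hΛ).2 ht) hk0.le
      have hM : ∀ᵐ x, ‖lowpass R u x‖ ≤ C * R ^ (1 / k) * A := by
        filter_upwards [norm_lowpass_le_integral R u] with x hx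
        exact hx.trans (hlog R hR1 u hu)
      refine (volume_lt_norm_le ht0 hM (le_of_eq ?_)).trans (ENNReal.ofReal_le_ofReal ?_)
      · rw [hR, ← Real.rpow_mul (by positivity), mul_one_div_cancel hk0.ne', Real.rpow_one, hΛdef]
        field_simp
      · have h2 := rpow_mul_norm_sub_lowpass_le (s := s) (R := R) (by linarith) (by linarith) hu
        have h3 : R ^ (1 / 2 : ℝ) ≤ (2 * Real.pi * R) ^ s := by
          have h4 : R ≤ 2 * Real.pi * R := by nlinarith [Real.pi_gt_three]
          exact (Real.rpow_le_rpow (by positivity) h4 (by norm_num)).trans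
            (Real.rpow_le_rpow_of_exponent_le (hR1.trans h4) hs)
        have h5 : R ^ (1 / 2 : ℝ) * ‖u - lowpass R u‖ ≤ A :=
          (mul_le_mul_of_nonneg_right h3 (norm_nonneg _)).trans
            (h2.trans (norm_fracD_le_hsNorm s u))
        have h6 : R * ‖u - lowpass R u‖ ^ 2 ≤ A ^ 2 := by
          have h7 := pow_le_pow_left₀ (by positivity) h5 2
          rwa [mul_pow, ← Real.rpow_natCast (R ^ (1 / 2 : ℝ)), ← Real.rpow_mul (by positivity),
            show (1 / 2 : ℝ) * (2 : ℕ) = 1 by norm_num, Real.rpow_one] at h7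
        have h8 : 4 * A ^ 2 * Λ ^ k * t ^ (-(k + 2)) = 4 / t ^ 2 * (A ^ 2 / R) := by
          rw [hR, Real.div_rpow ht0.le hΛ.le, Real.rpow_neg ht0.le, Real.rpow_add ht0,
            Real.rpow_two]
          have := (Real.rpow_pos_of_pos ht0 k).ne'
          have := (Real.rpow_pos_of_pos hΛ k).ne'
          field_simp
        rw [h8]
        gcongr
        rw [le_div_iff₀ (by positivity)]
        linarith)
  refine ⟨hi, hle.trans ?_⟩
  have h9 : ‖u‖ ^ 2 ≤ A ^ 2 := pow_le_pow_left₀ (norm_nonneg _) (norm_le_hsNorm s u) 2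
  have h10 : Λ ^ (k - 2) * A ^ 2 = (2 * C) ^ (k - 2) * A ^ k := by
    rw [hΛdef, Real.mul_rpow (by positivity) hA.le, mul_assoc, ← Real.rpow_two,
      ← Real.rpow_add hA, sub_add_cancel]
  have h11 : Λ ^ k * Λ ^ (k - (k + 2)) = Λ ^ (k - 2) := by
    rw [← Real.rpow_add hΛ]; congr 1; ring
  calc _ ≤ k / 2 * Λ ^ (k - 2) * A ^ 2 +
        k * (4 * A ^ 2 * Λ ^ k) / (k + 2 - k) * Λ ^ (k - (k + 2)) := by gcongr
    _ = k * (5 / 2) * (Λ ^ (k - 2) * A ^ 2) := by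
        rw [← h11]; ring
    _ = _ := by rw [h10]; ring

/-- `H^s ⊆ L^k` for `s ≥ 1/2` and `2 ≤ k < ∞`. -/
theorem integral_pow_le_hsNorm {s : ℝ} (hs : 1 / 2 ≤ s) {k : ℕ} (hk : 2 ≤ k) :
    ∃ C : ℝ, 0 < C ∧ ∀ u : L2, MemHs s u →
      Integrable (fun x => ‖u x‖ ^ k) ∧ ∫ x, ‖u x‖ ^ k ≤ C * hsNorm s u ^ k := by
  rcases hk.eq_or_lt with rfl | hk
  · refine ⟨1, one_pos, fun u _ => ⟨integrable_normSq u, ?_⟩⟩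
    rw [← normSq_eq_integral, one_mul]
    exact pow_le_pow_left₀ (norm_nonneg _) (norm_le_hsNorm s u) 2
  · obtain ⟨C, hC, h⟩ := integral_rpow_le_hsNorm hs (k := k) (by exact_mod_cast hk)
    refine ⟨C, hC, fun u hu => ?_⟩
    simpa only [Real.rpow_natCast] using h u hu

/-- The subcritical Gagliardo–Nirenberg inequality, for bounded charge. -/
theorem integral_rpow_le_fracD {s : ℝ} (hs : 0 < s) {p : ℝ} (hp : 2 < p) (hp' : p < 4 * s + 2)
    {B ε : ℝ} (hB : 0 < B) (hε : 0 < ε) :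
    ∃ K : ℝ, 0 ≤ K ∧ ∀ u : L2, MemHs s u → ‖u‖ ≤ B →
      Integrable (fun x => ‖u x‖ ^ p) ∧ ∫ x, ‖u x‖ ^ p ≤ K + ε * ‖fracD s u‖ ^ 2 := by
  -- The cut at frequency R = t²/(8B²) bounds the low part by √(2R)·B = t/2 and the high part in L²
  -- by R^(-s)‖D^s u‖. The weak exponent is thus 4s+2 > p, and the coefficient c·Λ^(p-4s-2) of ‖D^s
  -- u‖² is at most ε for large Λ.
  set c : ℝ := p * (4 * (8 * B ^ 2) ^ (2 * s)) / (4 * s + 2 - p) with hc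
  have hgap : 0 < 4 * s + 2 - p := by linarith
  have hlim : Tendsto (fun Λ : ℝ => c * Λ ^ (-(4 * s + 2 - p))) atTop (𝓝 (c * 0)) :=
    (tendsto_rpow_neg_atTop hgap).const_mul c
  rw [mul_zero] at hlim
  obtain ⟨Λ, hΛε, hΛ⟩ := ((hlim.eventually (ge_mem_nhds hε)).and (eventually_gt_atTop 0)).exists
  refine ⟨p / 2 * Λ ^ (p - 2) * B ^ 2, by positivity, fun u hu huB => ?_⟩
  set A := ‖fracD s u‖ with hA
  obtain ⟨hi, hle⟩ := integral_rpow_le_of_weak u (k := p) (b := 4 * s + 2)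
    (D := 4 * (8 * B ^ 2) ^ (2 * s) * A ^ 2) (Λ := Λ) hp hp' (by positivity) hΛ (fun t ht => by
      have ht0 : 0 < t := hΛ.trans_le ht
      set R : ℝ := t ^ 2 / (8 * B ^ 2) with hR
      have hR0 : 0 < R := by positivity
      have hM : ∀ᵐ x, ‖lowpass R u x‖ ≤ Real.sqrt (2 * R) * B := by
        filter_upwards [norm_lowpass_le_integral R u] with x hx
        refine hx.trans ((integral_fourier_le_sqrt hR0.le u).trans ?_)
        gcongr
      refine (volume_lt_norm_le ht0 hM (le_of_eq ?_)).trans (ENNReal.ofReal_le_ofReal ?_)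
      · have : 2 * R = (t / (2 * B)) ^ 2 := by rw [hR]; field_simp; ring
        rw [this, Real.sqrt_sq (by positivity)]
        field_simp
      · have h2 := rpow_mul_norm_sub_lowpass_le hs.le hR0.le hu
        have h3 : R ^ s ≤ (2 * Real.pi * R) ^ s :=
          Real.rpow_le_rpow hR0.le (by nlinarith [Real.pi_gt_three]) hs.le
        have h5 : R ^ s * ‖u - lowpass R u‖ ≤ A :=
          (mul_le_mul_of_nonneg_right h3 (norm_nonneg _)).trans h2
        have h6 : R ^ (2 * s) * ‖u - lowpass R u‖ ^ 2 ≤ A ^ 2 := by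
          have h7 := pow_le_pow_left₀ (by positivity) h5 2
          rwa [mul_pow, ← Real.rpow_natCast (R ^ s), ← Real.rpow_mul hR0.le,
            show s * (2 : ℕ) = 2 * s by push_cast; ring] at h7
        have h8 : 4 * (8 * B ^ 2) ^ (2 * s) * A ^ 2 * t ^ (-(4 * s + 2)) =
            4 / t ^ 2 * (A ^ 2 / R ^ (2 * s)) := by
          rw [hR, Real.div_rpow (by positivity) (by positivity), Real.rpow_neg ht0.le,
            Real.rpow_add ht0, Real.rpow_two, ← Real.rpow_natCast t 2, ← Real.rpow_mul ht0.le,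
            show ((2 : ℕ) : ℝ) * (2 * s) = 4 * s by push_cast; ring]
          have := (Real.rpow_pos_of_pos ht0 (4 * s)).ne'
          field_simp
        rw [h8]
        gcongr
        rw [le_div_iff₀ (by positivity)]
        linarith)
  refine ⟨hi, hle.trans ?_⟩
  have h1 : p * (4 * (8 * B ^ 2) ^ (2 * s) * A ^ 2) / (4 * s + 2 - p) * Λ ^ (p - (4 * s + 2)) =
      c * Λ ^ (-(4 * s + 2 - p)) * A ^ 2 := by
    rw [hc, neg_sub]; ring
  rw [h1]
  gcongr

/-- `H^a ⊆ L^∞` for `a ≥ 1`. -/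
theorem ae_norm_le_of_memHs {a : ℝ} (ha : 1 ≤ a) :
    ∃ C : ℝ, 0 < C ∧ ∀ u : L2, MemHs a u → ∀ᵐ x, ‖u x‖ ≤ C * hsNorm a u := by
  have hint : Integrable (fun ξ : ℝ => (1 + ‖ξ‖) ^ (-2 : ℝ)) :=
    integrable_one_add_norm (by simp)
  set K : ℝ := ∫ ξ : ℝ, ((1 + ‖ξ‖)⁻¹) ^ 2 with hK
  have hw0 : ∀ ξ : ℝ, 0 < 1 + ‖ξ‖ := fun ξ => by positivity
  have heq : ∀ ξ : ℝ, ((1 + ‖ξ‖)⁻¹) ^ 2 = (1 + ‖ξ‖) ^ (-2 : ℝ) := by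
    intro ξ
    rw [Real.rpow_neg (hw0 ξ).le, Real.rpow_two, inv_pow]
  have hfL : MemLp (fun ξ : ℝ => (1 + ‖ξ‖)⁻¹) 2 volume := by
    refine (memLp_two_iff_integrable_sq (by fun_prop)).2 ?_
    simpa only [heq] using hint
  refine ⟨Real.sqrt K * 3 + 1, by positivity, fun u hu => ?_⟩
  have hgL : MemLp (fun ξ => 2 * ‖(𝓕 u : L2) ξ‖ + ‖(𝓕 (fracD a u) : L2) ξ‖) 2 volume :=
    ((Lp.memLp _).norm.const_mul 2).add (Lp.memLp _).norm
  have hprod : Integrable fun ξ =>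
      (1 + ‖ξ‖)⁻¹ * (2 * ‖(𝓕 u : L2) ξ‖ + ‖(𝓕 (fracD a u) : L2) ξ‖) :=
    hfL.integrable_mul hgL
  -- For a ≥ 1, (1+|ξ|)|û| ≤ 2|û| + |ξ|^a|û|, up to the factor 2π in the frequency; so û is a
  -- product of two L² functions and hence integrable.
  have hpt : ∀ᵐ ξ, ‖(𝓕 u : L2) ξ‖ ≤
      (1 + ‖ξ‖)⁻¹ * (2 * ‖(𝓕 u : L2) ξ‖ + ‖(𝓕 (fracD a u) : L2) ξ‖) := by
    filter_upwards [hu.hasD] with ξ h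
    rw [h, norm_mul, norm_symb, ← div_eq_inv_mul, le_div_iff₀ (hw0 ξ), Real.norm_eq_abs]
    nlinarith [norm_le_one_add_symb (ξ := ξ) ha, norm_nonneg ((𝓕 u : L2) ξ)]
  have hu1 : Integrable fun ξ => (𝓕 u : L2) ξ :=
    hprod.mono' (Lp.aestronglyMeasurable _) hpt
  have hval := fourierInv_coeFn (𝓕 u : L2) hu1
  rw [fourierInv_fourier] at hval
  have hL1 : ∫ ξ, ‖(𝓕 u : L2) ξ‖ ≤ (Real.sqrt K * 3 + 1) * hsNorm a u := by
    refine (integral_mono_ae hu1.norm hprod hpt).trans ?_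
    refine (integral_mul_le_sqrt_mul_sqrt (fun ξ => by positivity) (fun ξ => by positivity)
      hfL hgL).trans ?_
    -- The 3 comes from (2x+y)² ≤ 8x² + 2y² ≤ 9(x²+y²).
    have h1 : Real.sqrt (∫ ξ, (2 * ‖(𝓕 u : L2) ξ‖ + ‖(𝓕 (fracD a u) : L2) ξ‖) ^ 2) ≤
        3 * hsNorm a u := by
      refine Real.sqrt_le_iff.2 ⟨by linarith [hsNorm_nonneg a u], ?_⟩
      have h2 : Integrable fun ξ =>
          8 * ‖(𝓕 u : L2) ξ‖ ^ 2 + 2 * ‖(𝓕 (fracD a u) : L2) ξ‖ ^ 2 :=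
        ((integrable_normSq _).const_mul 8).add ((integrable_normSq _).const_mul 2)
      refine (integral_mono ((memLp_two_iff_integrable_sq hgL.1).1 hgL) h2 fun ξ => ?_).trans ?_
      · simp only
        nlinarith [sq_nonneg (2 * ‖(𝓕 u : L2) ξ‖ - ‖(𝓕 (fracD a u) : L2) ξ‖)]
      · rw [integral_add ((integrable_normSq _).const_mul 8) ((integrable_normSq _).const_mul 2),
          integral_const_mul, integral_const_mul, ← normSq_eq_integral, ← normSq_eq_integral,
          norm_fourier, norm_fourier, mul_pow, hsNorm_sq]
        nlinarith [sq_nonneg ‖u‖, sq_nonneg ‖fracD a u‖]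
    have := hsNorm_nonneg a u
    calc _ ≤ Real.sqrt K * (3 * hsNorm a u) := by gcongr
      _ ≤ _ := by nlinarith [Real.sqrt_nonneg K]
  filter_upwards [hval] with x hx
  rw [hx, Real.fourierInv_eq]
  refine (norm_integral_le_integral_norm _).trans (le_trans (le_of_eq ?_) hL1)
  congr 1
  ext ξ
  rw [Circle.norm_smul]

/-! ### The nonlinearity -/

/-- The superquadratic part of `W`, as a function on the plane. -/
def NC (W : ℂ → ℝ) (z : ℂ) : ℝ := W z - E₀ W * ‖z‖ ^ 2

/-- The properties of the nonlinearity which are used in the analysis. -/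
structure Admissible (s p : ℝ) (m : ℕ) (W : ℂ → ℝ) : Prop where
  half_le : 1 / 2 ≤ s
  two_le : 2 ≤ m
  contDiff : ContDiff ℝ 2 W
  radial : ∀ z : ℂ, W z = W ((‖z‖ : ℝ) : ℂ)
  zero : W 0 = 0
  lip : ∃ C : ℝ, 0 ≤ C ∧ ∀ a b : ℂ,
    |NC W a - NC W b| ≤ C * ‖a - b‖ * (‖a‖ + ‖a‖ ^ m + (‖b‖ + ‖b‖ ^ m))
  small : ∀ ε > 0, ∃ C : ℝ, 0 ≤ C ∧ ∀ z : ℂ, |NC W z| ≤ ε * ‖z‖ ^ 2 + C * ‖z‖ ^ (m + 1)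
  two_lt : 2 < p
  lt_crit : p < 4 * s + 2
  lower : ∃ C : ℝ, 0 ≤ C ∧ ∀ z : ℂ, -C * ‖z‖ ^ 2 - C * ‖z‖ ^ p ≤ NC W z
  neg : ∃ r₀ : ℝ, 0 < r₀ ∧ NC W r₀ < 0
  grad_le : ∃ C : ℝ, 0 ≤ C ∧ ∀ z : ℂ, ‖cgrad W z‖ ≤ C * (‖z‖ + ‖z‖ ^ m)

/-! ### The gradient of a radial function on the plane. -/

theorem fderiv_eq_re_cgrad (W : ℂ → ℝ) (z h : ℂ) :
    fderiv ℝ W z h = (conj (cgrad W z) * h).re := by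
  have h1 : h = h.re • (1 : ℂ) + h.im • Complex.I := by
    apply Complex.ext <;> simp
  conv_lhs => rw [h1]
  rw [map_add, map_smul, map_smul]
  simp [cgrad]
  ring

theorem eq_of_forall_re_mul_eq {a b : ℂ} (h : ∀ w : ℂ, (a * w).re = (b * w).re) : a = b := by
  have h1 := h 1
  have h2 := h Complex.I
  simp at h1 h2
  exact Complex.ext h1 h2

theorem radial_eq {W : ℂ → ℝ} (hrad : ∀ z : ℂ, W z = W ((‖z‖ : ℝ) : ℂ)) {z w : ℂ}
    (h : ‖z‖ = ‖w‖) : W z = W w := by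
  rw [hrad z, hrad w, h]

/-- Differentiation of W(cw) = W(w). This phase equivariance of W' is what makes standing waves
solve the evolution equation. -/
theorem cgrad_rotate {W : ℂ → ℝ} (hd : Differentiable ℝ W)
    (hrad : ∀ z : ℂ, W z = W ((‖z‖ : ℝ) : ℂ)) {c : ℂ} (hc : ‖c‖ = 1) (z : ℂ) :
    cgrad W (c * z) = c * cgrad W z := by
  have h1 : ∀ h : ℂ, fderiv ℝ W (c * z) (c * h) = fderiv ℝ W z h := by
    intro h
    have h2 : (fun w => W (c * w)) = W := by
      ext w
      exact radial_eq hrad (by rw [norm_mul, hc, one_mul])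
    have h3 : HasFDerivAt (fun w : ℂ => c * w) (ContinuousLinearMap.mul ℝ ℂ c) z :=
      (ContinuousLinearMap.mul ℝ ℂ c).hasFDerivAt
    have h4 := (hd (c * z)).hasFDerivAt.comp z h3
    have h5 : W ∘ (fun w : ℂ => c * w) = W := h2
    rw [h5] at h4
    rw [h4.fderiv]
    rfl
  have h6 : conj (cgrad W (c * z)) * c = conj (cgrad W z) := by
    refine eq_of_forall_re_mul_eq fun w => ?_
    rw [mul_assoc, ← fderiv_eq_re_cgrad, ← fderiv_eq_re_cgrad, h1]
  have h7 := congrArg conj h6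
  rw [map_mul, Complex.conj_conj, Complex.conj_conj] at h7
  rw [← h7, mul_left_comm, Complex.mul_conj, Complex.normSq_eq_norm_sq, hc]
  simp

theorem hasDerivAt_restrict {W : ℂ → ℝ} (hd : Differentiable ℝ W) (r : ℝ) :
    HasDerivAt (fun t : ℝ => W (t : ℂ)) (fderiv ℝ W r 1) r := by
  have h1 : HasDerivAt (fun t : ℝ => (t : ℂ)) 1 r := Complex.ofRealCLM.hasDerivAt
  exact (hd (r : ℂ)).hasFDerivAt.comp_hasDerivAt r h1

/-- The function t ↦ W(r + it) is even, so the derivative across the real axis vanishes. -/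
theorem cgrad_real {W : ℂ → ℝ} (hd : Differentiable ℝ W)
    (hrad : ∀ z : ℂ, W z = W ((‖z‖ : ℝ) : ℂ)) (r : ℝ) :
    cgrad W r = ((deriv (fun t : ℝ => W (t : ℂ)) r : ℝ) : ℂ) := by
  have h0 : fderiv ℝ W r Complex.I = 0 := by
    have h1 : HasDerivAt (fun t : ℝ => (r : ℂ) + (t : ℂ) * Complex.I) Complex.I 0 := by
      have := ((Complex.ofRealCLM.hasDerivAt (x := (0 : ℝ))).mul_const Complex.I).const_add (r : ℂ)
      simpa using this
    have h2 : HasDerivAt (fun t : ℝ => W ((r : ℂ) + (t : ℂ) * Complex.I))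
        (fderiv ℝ W r Complex.I) 0 := by
      have h := HasFDerivAt.comp_hasDerivAt (f := fun t : ℝ => (r : ℂ) + (t : ℂ) * Complex.I) 0
        (hd _).hasFDerivAt h1
      simp only [Complex.ofReal_zero, zero_mul, add_zero] at h
      exact h
    have h3 : HasDerivAt (fun t : ℝ => W ((r : ℂ) + ((-t : ℝ) : ℂ) * Complex.I))
        (-(fderiv ℝ W r Complex.I)) 0 := by
      have h2' : HasDerivAt (fun t : ℝ => W ((r : ℂ) + (t : ℂ) * Complex.I))
        (fderiv ℝ W r Complex.I) (-0) := by simpa using h2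
      have := h2'.comp (0 : ℝ) (hasDerivAt_neg (0 : ℝ))
      rw [mul_neg_one] at this
      exact this
    have h4 : (fun t : ℝ => W ((r : ℂ) + ((-t : ℝ) : ℂ) * Complex.I)) =
        fun t : ℝ => W ((r : ℂ) + (t : ℂ) * Complex.I) := by
      ext t
      refine radial_eq hrad ?_
      rw [Complex.norm_add_mul_I, Complex.norm_add_mul_I, neg_sq]
    rw [h4] at h3
    linarith [h2.unique h3]
  rw [cgrad, h0, (hasDerivAt_restrict hd r).deriv]
  simp

/-- A rotation takes z to the positive real axis, which turns the one-variable bounds on N' into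
bounds on the complex gradient. -/
theorem norm_cgrad {W : ℂ → ℝ} (hd : Differentiable ℝ W)
    (hrad : ∀ z : ℂ, W z = W ((‖z‖ : ℝ) : ℂ)) (z : ℂ) :
    ‖cgrad W z‖ = |deriv (fun t : ℝ => W (t : ℂ)) ‖z‖| := by
  rcases eq_or_ne z 0 with rfl | hz
  · have := cgrad_real hd hrad 0
    rw [Complex.ofReal_zero] at this
    rw [this, norm_zero, Complex.norm_real, Real.norm_eq_abs]
  · have hn : (‖z‖ : ℂ) ≠ 0 := by exact_mod_cast norm_ne_zero_iff.2 hz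
    have h1 := cgrad_rotate hd hrad (c := z / ‖z‖) (by
      rw [norm_div, Complex.norm_real, norm_norm, div_self (norm_ne_zero_iff.2 hz)]) (‖z‖ : ℂ)
    rw [div_mul_cancel₀ _ hn] at h1
    rw [h1, norm_mul, norm_div, Complex.norm_real, norm_norm, div_self (norm_ne_zero_iff.2 hz),
      one_mul, cgrad_real hd hrad, Complex.norm_real, Real.norm_eq_abs]

theorem NC_eq_Nfun {W : ℂ → ℝ} (hrad : ∀ z : ℂ, W z = W ((‖z‖ : ℝ) : ℂ)) (z : ℂ) :
    NC W z = Nfun W ‖z‖ := by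
  rw [NC, Nfun, hrad z]

/-- Since q > 2, the square wins below a radius d with d^(q-2) ≤ ε; above d the higher power k wins,
with constant d^(q-k). -/
theorem rpow_le_sq_add_pow {q : ℝ} (hq : 2 < q) {k : ℕ} (hk : q < k) {ε : ℝ} (hε : 0 < ε) :
    ∃ C : ℝ, 0 ≤ C ∧ ∀ r : ℝ, 0 ≤ r → r ^ q ≤ ε * r ^ 2 + C * r ^ k := by
  have hgap : 0 < q - 2 := by linarith
  have hlim : Tendsto (fun x : ℝ => x ^ (q - 2)) (𝓝[>] 0) (𝓝 0) := by
    have h := (Real.continuousAt_rpow_const 0 (q - 2) (Or.inr hgap.le)).tendsto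
    rw [Real.zero_rpow hgap.ne'] at h
    exact h.mono_left nhdsWithin_le_nhds
  obtain ⟨d, hd, hd0⟩ := ((hlim.eventually (ge_mem_nhds hε)).and self_mem_nhdsWithin).exists
  have hd0 : 0 < d := hd0
  refine ⟨d ^ (q - k), by positivity, fun r hr => ?_⟩
  rcases hr.eq_or_lt with rfl | hr
  · rw [Real.zero_rpow (by linarith)]
    positivity
  rcases le_total r d with h | h
  · have h1 : r ^ q = r ^ (q - 2) * r ^ 2 := by
      rw [← Real.rpow_two, ← Real.rpow_add hr, sub_add_cancel]
    have h2 : r ^ (q - 2) ≤ ε := (Real.rpow_le_rpow hr.le h hgap.le).trans hd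
    have : 0 ≤ d ^ (q - k) * r ^ k := by positivity
    rw [h1]
    nlinarith [sq_nonneg r]
  · have h1 : r ^ q = r ^ (q - k) * r ^ k := by
      rw [← Real.rpow_natCast, ← Real.rpow_add hr, sub_add_cancel]
    have h2 : r ^ (q - k) ≤ d ^ (q - k) :=
      Real.rpow_le_rpow_of_nonpos hd0 h (by linarith)
    rw [h1]
    have : 0 ≤ ε * r ^ 2 := by positivity
    have : 0 ≤ r ^ k := by positivity
    nlinarith

theorem rpow_le_add_pow {q : ℝ} (hq : 1 ≤ q) {m : ℕ} (hm : q ≤ m) {r : ℝ} (hr : 0 ≤ r) :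
    r ^ q ≤ r + r ^ m := by
  rcases hr.eq_or_lt with rfl | hr
  · rw [Real.zero_rpow (by linarith)]
    positivity
  rcases le_total r 1 with h | h
  · have h1 := Real.rpow_le_rpow_of_exponent_ge hr h hq
    rw [Real.rpow_one] at h1
    have : 0 ≤ r ^ m := by positivity
    linarith
  · have h1 := Real.rpow_le_rpow_of_exponent_le h hm
    rw [Real.rpow_natCast] at h1
    linarith

/-- The bounds on N' integrate, by the mean value inequality on the half-line, to bounds on N;
radial symmetry transfers them to the plane. -/
theorem exists_admissible (s : ℝ) (hs : 1 / 2 ≤ s) (W : ℂ → ℝ)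
    (hreg : ContDiff ℝ 2 W) (hrad : ∀ z : ℂ, W z = W ((‖z‖ : ℝ) : ℂ)) (hW0 : W 0 = 0)
    (hW1 : ∃ r₀ : ℝ, 0 < r₀ ∧ Nfun W r₀ < 0)
    (hW2 : ∃ q₁ q₂ c₁ : ℝ, 2 < q₁ ∧ q₁ ≤ q₂ ∧
      ∀ r : ℝ, 0 ≤ r → |deriv (Nfun W) r| ≤ c₁ * (r ^ (q₁ - 1) + r ^ (q₂ - 1)))
    (hW3 : ∃ p : ℝ, 2 < p ∧ p < 4 * s + 2 ∧ ∃ c : ℝ, 0 ≤ c ∧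
      ∀ᶠ r : ℝ in Filter.atTop, -c * r ^ p ≤ Nfun W r) :
    ∃ (p : ℝ) (m : ℕ), Admissible s p m W := by
  obtain ⟨q₁, q₂, c₁, hq₁, hq, hN'⟩ := hW2
  obtain ⟨p, hp2, hp, c, hc, hlow⟩ := hW3
  have hd : Differentiable ℝ W := hreg.differentiable (by norm_num)
  have hc₁ : 0 ≤ c₁ := by
    have := (abs_nonneg _).trans (hN' 1 zero_le_one)
    norm_num at this
    exact this
  -- One integer power replaces both real exponents: q₁-1 and q₂-1 lie between 1 and m, so r + r^m
  -- dominates both powers, and q₁, q₂ < m+1.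
  set m : ℕ := ⌈q₂⌉₊ with hm
  have hmq : q₂ ≤ m := Nat.le_ceil _
  have hm2 : 2 ≤ m := by
    have : (2 : ℝ) < m := by linarith
    exact_mod_cast this.le
  have hNd : Differentiable ℝ (Nfun W) := fun r =>
    (hasDerivAt_restrict hd r).differentiableAt.sub ((differentiableAt_pow 2).const_mul _)
  have hderiv : ∀ r, deriv (Nfun W) r = deriv (fun t : ℝ => W (t : ℂ)) r - 2 * E₀ W * r := by
    intro r
    have h1 : HasDerivAt (Nfun W) (fderiv ℝ W r 1 - E₀ W * (2 * r)) r := by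
      have := (hasDerivAt_restrict hd r).sub ((hasDerivAt_pow 2 r).const_mul (E₀ W))
      simpa using! this
    rw [h1.deriv, (hasDerivAt_restrict hd r).deriv]
    ring
  have hN0 : Nfun W 0 = 0 := by simp [Nfun, hW0]
  have hb : ∀ r, 0 ≤ r → |deriv (Nfun W) r| ≤ 2 * c₁ * (r + r ^ m) := by
    intro r hr
    have h1 := rpow_le_add_pow (q := q₁ - 1) (m := m) (by linarith) (by linarith) hr
    have h2 := rpow_le_add_pow (q := q₂ - 1) (m := m) (by linarith) (by linarith) hr
    refine (hN' r hr).trans ?_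
    nlinarith
  have hmv : ∀ x y B : ℝ, 0 ≤ x → 0 ≤ y →
      (∀ r, 0 ≤ r → r ≤ max x y → |deriv (Nfun W) r| ≤ B) →
      |Nfun W x - Nfun W y| ≤ B * |x - y| := by
    intro x y B hx hy hB
    have := Convex.norm_image_sub_le_of_norm_deriv_le (f := Nfun W) (s := Icc 0 (max x y))
      (C := B) (x := y) (y := x) (fun r _ => hNd r) (fun r hr => hB r hr.1 hr.2)
      (convex_Icc _ _) ⟨hy, le_max_right _ _⟩ ⟨hx, le_max_left _ _⟩
    exact this
  have hsm : ∀ ε > 0, ∃ C : ℝ, 0 ≤ C ∧ ∀ r : ℝ, 0 ≤ r →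
      |Nfun W r| ≤ ε * r ^ 2 + C * r ^ (m + 1) := by
    intro ε hε
    -- The 2 shares ε between the two powers of the bound; c₁+1 replaces c₁, which may be 0.
    have hε' : 0 < ε / (2 * (c₁ + 1)) := by positivity
    obtain ⟨C₁, hC₁, h1⟩ := rpow_le_sq_add_pow hq₁ (k := m + 1) (by push_cast; linarith) hε'
    obtain ⟨C₂, hC₂, h2⟩ := rpow_le_sq_add_pow (hq₁.trans_le hq) (k := m + 1)
      (by push_cast; linarith) hε'
    refine ⟨c₁ * (C₁ + C₂), by positivity, fun r hr => ?_⟩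
    rcases hr.eq_or_lt with rfl | hr0
    · rw [hN0]; simp
    have h3 := hmv r 0 (c₁ * (r ^ (q₁ - 1) + r ^ (q₂ - 1))) hr le_rfl (by
      intro t ht htr
      rw [max_eq_left hr] at htr
      refine (hN' t ht).trans ?_
      gcongr <;> linarith)
    rw [hN0, sub_zero, sub_zero, abs_of_nonneg hr] at h3
    have h4 : c₁ * (r ^ (q₁ - 1) + r ^ (q₂ - 1)) * r = c₁ * (r ^ q₁ + r ^ q₂) := by
      rw [Real.rpow_sub_one hr0.ne', Real.rpow_sub_one hr0.ne']
      field_simp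
    rw [h4] at h3
    have h5 : c₁ * (r ^ q₁ + r ^ q₂) ≤
        c₁ * (2 * (ε / (2 * (c₁ + 1)) * r ^ 2) + (C₁ + C₂) * r ^ (m + 1)) := by
      have := h1 r hr
      have := h2 r hr
      exact mul_le_mul_of_nonneg_left (by linarith) hc₁
    have h6 : c₁ * (2 * (ε / (2 * (c₁ + 1)) * r ^ 2)) ≤ ε * r ^ 2 := by
      have : c₁ * (2 * (ε / (2 * (c₁ + 1)) * r ^ 2)) = c₁ / (c₁ + 1) * (ε * r ^ 2) := by
        field_simp
      rw [this]
      have h7 : c₁ / (c₁ + 1) ≤ 1 := by rw [div_le_one (by positivity)]; linarith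
      have : 0 ≤ ε * r ^ 2 := by positivity
      nlinarith
    linarith
  refine ⟨p, m, ⟨hs, hm2, hreg, hrad, hW0, ?_, ?_, hp2, hp, ?_, ?_, ?_⟩⟩
  · refine ⟨2 * c₁, by positivity, fun a b => ?_⟩
    rw [NC_eq_Nfun hrad, NC_eq_Nfun hrad]
    have h1 := hmv ‖a‖ ‖b‖ (2 * c₁ * (‖a‖ + ‖a‖ ^ m + (‖b‖ + ‖b‖ ^ m))) (norm_nonneg _)
      (norm_nonneg _) (by
        intro t ht htm
        refine (hb t ht).trans ?_
        rcases le_max_iff.1 htm with h | h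
        · have h2 : t ^ m ≤ ‖a‖ ^ m := pow_le_pow_left₀ ht h m
          have : 0 ≤ ‖b‖ + ‖b‖ ^ m := by positivity
          exact mul_le_mul_of_nonneg_left (by linarith) (by positivity)
        · have h2 : t ^ m ≤ ‖b‖ ^ m := pow_le_pow_left₀ ht h m
          have : 0 ≤ ‖a‖ + ‖a‖ ^ m := by positivity
          exact mul_le_mul_of_nonneg_left (by linarith) (by positivity))
    refine h1.trans ?_
    have := abs_norm_sub_norm_le a b
    calc _ ≤ 2 * c₁ * (‖a‖ + ‖a‖ ^ m + (‖b‖ + ‖b‖ ^ m)) * ‖a - b‖ := by gcongr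
      _ = _ := by ring
  · intro ε hε
    obtain ⟨C, hC, h⟩ := hsm ε hε
    refine ⟨C, hC, fun z => ?_⟩
    rw [NC_eq_Nfun hrad]
    exact h _ (norm_nonneg _)
  -- (W-3) speaks of large r only. For r ≤ R the bound |N(r)| ≤ r² + C·r^(m+1) is quadratic, as
  -- r^(m+1) ≤ R'^(m-1)·r².
  · obtain ⟨R, hR⟩ := eventually_atTop.1 hlow
    obtain ⟨C, hC, h⟩ := hsm 1 one_pos
    set R' := max R 0 with hR'
    have hR'0 : 0 ≤ R' := le_max_right _ _
    refine ⟨c + (1 + C * R' ^ (m - 1)), by positivity, fun z => ?_⟩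
    rw [NC_eq_Nfun hrad]
    set r := ‖z‖ with hr
    have hr0 : 0 ≤ r := norm_nonneg z
    have hp0 : 0 ≤ r ^ p := by positivity
    have hX : 0 ≤ C * R' ^ (m - 1) := by positivity
    rcases le_total R r with h1 | h1
    · have := hR r h1
      nlinarith [mul_nonneg hX hp0, mul_nonneg hX (sq_nonneg r), mul_nonneg hc (sq_nonneg r),
        sq_nonneg r]
    · have h2 := (abs_le.1 (h r hr0)).1
      have h3 : r ^ (m + 1) ≤ R' ^ (m - 1) * r ^ 2 := by
        rw [show m + 1 = (m - 1) + 2 by omega, pow_add]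
        have : r ^ (m - 1) ≤ R' ^ (m - 1) :=
          pow_le_pow_left₀ hr0 (h1.trans (le_max_left _ _)) _
        gcongr
      have h4 : C * r ^ (m + 1) ≤ C * R' ^ (m - 1) * r ^ 2 := by
        rw [mul_assoc]; gcongr
      nlinarith [mul_nonneg hX hp0, mul_nonneg hc hp0, mul_nonneg hc (sq_nonneg r)]
  · obtain ⟨r₀, h0, h1⟩ := hW1
    refine ⟨r₀, h0, ?_⟩
    rw [NC_eq_Nfun hrad, Complex.norm_real, Real.norm_of_nonneg h0.le]
    exact h1
  · refine ⟨2 * |E₀ W| + 2 * c₁, by positivity, fun z => ?_⟩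
    rw [norm_cgrad hd hrad]
    have h1 := hderiv ‖z‖
    have h2 : deriv (fun t : ℝ => W (t : ℂ)) ‖z‖ = deriv (Nfun W) ‖z‖ + 2 * E₀ W * ‖z‖ := by
      rw [h1]; ring
    rw [h2]
    refine (abs_add_le _ _).trans ?_
    have h3 : |2 * E₀ W * ‖z‖| = 2 * |E₀ W| * ‖z‖ := by
      rw [abs_mul, abs_mul, abs_two, abs_norm]
    rw [h3]
    have h4 := hb ‖z‖ (norm_nonneg z)
    have h5 : 0 ≤ 2 * |E₀ W| * ‖z‖ ^ m := by positivity
    nlinarith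

/-! ### The functionals on `H^s` -/

/-- The integral of the superquadratic part of `W`. -/
def pot (W : ℂ → ℝ) (u : L2) : ℝ := ∫ x, NC W (u x)

/-- The energy without its quadratic zero order part. -/
def J (s : ℝ) (W : ℂ → ℝ) (u : L2) : ℝ := 1 / 2 * ‖fracD s u‖ ^ 2 + pot W u

theorem Admissible.pos {s p : ℝ} {m : ℕ} {W : ℂ → ℝ} (h : Admissible s p m W) : 0 < s := by
  linarith [h.half_le]

theorem Admissible.differentiable {s p : ℝ} {m : ℕ} {W : ℂ → ℝ} (h : Admissible s p m W) :
    Differentiable ℝ W := h.contDiff.differentiable (by norm_num)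

theorem Admissible.continuous_NC {s p : ℝ} {m : ℕ} {W : ℂ → ℝ} (h : Admissible s p m W) :
    Continuous (NC W) := by
  unfold NC
  exact h.contDiff.continuous.sub (by fun_prop)

theorem Admissible.NC_zero {s p : ℝ} {m : ℕ} {W : ℂ → ℝ} (h : Admissible s p m W) :
    NC W 0 = 0 := by simp [NC, h.zero]

theorem Admissible.aestronglyMeasurable_NC {s p : ℝ} {m : ℕ} {W : ℂ → ℝ}
    (h : Admissible s p m W) (u : L2) : AEStronglyMeasurable (fun x => NC W (u x)) volume :=
  h.continuous_NC.comp_aestronglyMeasurable (Lp.aestronglyMeasurable u)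

theorem Admissible.integrable_NC {s p : ℝ} {m : ℕ} {W : ℂ → ℝ} (h : Admissible s p m W) {u : L2}
    (hu : MemHs s u) : Integrable (fun x => NC W (u x)) := by
  obtain ⟨C, hC, hb⟩ := h.small 1 one_pos
  obtain ⟨C', -, hk⟩ := integral_pow_le_hsNorm h.half_le (k := m + 1) (by have := h.two_le; omega)
  exact (((integrable_normSq u).const_mul 1).add ((hk u hu).1.const_mul C)).mono'
    (h.aestronglyMeasurable_NC u) (ae_of_all _ fun x => hb _)

/-- At fixed charge the last term is constant. This is why the sign of E₀ is irrelevant. -/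
theorem Admissible.energy_eq {s p : ℝ} {m : ℕ} {W : ℂ → ℝ} (h : Admissible s p m W) {u : L2}
    (hu : MemHs s u) : energy s W u = J s W u + E₀ W * ‖u‖ ^ 2 := by
  have h1 : ∫ x, W (u x) = ∫ x, (NC W (u x) + E₀ W * ‖u x‖ ^ 2) := by
    congr 1; ext x; simp [NC]
  rw [energy, J, pot, h1, integral_add (h.integrable_NC hu) ((integrable_normSq u).const_mul _),
    integral_const_mul, ← normSq_eq_integral]
  ring

/-- The growth function of the gradient is square integrable. -/
theorem memLp_growth {s : ℝ} (hs : 1 / 2 ≤ s) {m : ℕ} (hm : 1 ≤ m) :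
    ∃ C : ℝ, 0 < C ∧ ∀ u : L2, MemHs s u →
      MemLp (fun x => ‖u x‖ + ‖u x‖ ^ m) 2 volume ∧
        ∫ x, (‖u x‖ + ‖u x‖ ^ m) ^ 2 ≤ C * (hsNorm s u ^ 2 + hsNorm s u ^ (2 * m)) := by
  obtain ⟨C, hC, hk⟩ := integral_pow_le_hsNorm hs (k := 2 * m) (by omega)
  refine ⟨2 + 2 * C, by positivity, fun u hu => ?_⟩
  have hb : ∀ x, (‖u x‖ + ‖u x‖ ^ m) ^ 2 ≤ 2 * ‖u x‖ ^ 2 + 2 * ‖u x‖ ^ (2 * m) := by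
    intro x
    rw [pow_mul' _ 2 m]
    nlinarith [sq_nonneg (‖u x‖ - ‖u x‖ ^ m)]
  have hi : Integrable fun x => 2 * ‖u x‖ ^ 2 + 2 * ‖u x‖ ^ (2 * m) :=
    ((integrable_normSq u).const_mul 2).add ((hk u hu).1.const_mul 2)
  have hmeas : AEStronglyMeasurable (fun x => ‖u x‖ + ‖u x‖ ^ m) volume :=
    (Lp.aestronglyMeasurable u).norm.add ((Lp.aestronglyMeasurable u).norm.pow m)
  have hi2 : Integrable fun x => (‖u x‖ + ‖u x‖ ^ m) ^ 2 :=
    hi.mono' (hmeas.pow 2) (ae_of_all _ fun x => by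
      rw [Real.norm_of_nonneg (by positivity)]; exact hb x)
  refine ⟨(memLp_two_iff_integrable_sq hmeas).2 hi2, (integral_mono hi2 hi hb).trans ?_⟩
  rw [integral_add ((integrable_normSq u).const_mul 2) ((hk u hu).1.const_mul 2),
    integral_const_mul, integral_const_mul, ← normSq_eq_integral]
  have h1 := (hk u hu).2
  have h2 := pow_le_pow_left₀ (norm_nonneg _) (norm_le_hsNorm s u) 2
  have h3 : 0 ≤ hsNorm s u ^ (2 * m) := pow_nonneg (hsNorm_nonneg _ _) _
  have h4 : 0 ≤ hsNorm s u ^ 2 := sq_nonneg _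
  nlinarith

/-- Local Lipschitz estimate for the potential energy. -/
theorem Admissible.setIntegral_NC_sub_le {s p : ℝ} {m : ℕ} {W : ℂ → ℝ} (h : Admissible s p m W)
    (A : ℝ) : ∃ C : ℝ, 0 ≤ C ∧ ∀ u v : L2, MemHs s u → MemHs s v → hsNorm s u ≤ A →
      hsNorm s v ≤ A → ∀ S : Set ℝ,
        ∫ x in S, |NC W (u x) - NC W (v x)| ≤ C * Real.sqrt (∫ x in S, ‖(u - v) x‖ ^ 2) := by
  obtain ⟨C₁, hC₁, hlip⟩ := h.lip
  obtain ⟨C₂, hC₂, hg⟩ := memLp_growth h.half_le (m := m) (by have := h.two_le; omega)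
  set K := C₂ * (A ^ 2 + A ^ (2 * m)) with hK
  refine ⟨C₁ * (2 * Real.sqrt K), by positivity, fun u v hu hv huA hvA S => ?_⟩
  obtain ⟨hgu, hgu'⟩ := hg u hu
  obtain ⟨hgv, hgv'⟩ := hg v hv
  have hsub : ∀ᵐ x, |NC W (u x) - NC W (v x)| ≤
      C₁ * (‖(u - v) x‖ * (‖u x‖ + ‖u x‖ ^ m + (‖v x‖ + ‖v x‖ ^ m))) := by
    filter_upwards [Lp.coeFn_sub u v] with x hx
    rw [hx, Pi.sub_apply, ← mul_assoc]
    exact hlip _ _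
  have hgs : MemLp (fun x => ‖u x‖ + ‖u x‖ ^ m + (‖v x‖ + ‖v x‖ ^ m)) 2 volume := hgu.add hgv
  have huv : MemLp (fun x => ‖(u - v) x‖) 2 volume := (Lp.memLp (u - v)).norm
  have hprod : Integrable fun x =>
      ‖(u - v) x‖ * (‖u x‖ + ‖u x‖ ^ m + (‖v x‖ + ‖v x‖ ^ m)) := huv.integrable_mul hgs
  have hKu : ∫ x, (‖u x‖ + ‖u x‖ ^ m) ^ 2 ≤ K := by
    refine hgu'.trans ?_
    have := hsNorm_nonneg s u
    rw [hK]
    gcongr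
  have hKv : ∫ x, (‖v x‖ + ‖v x‖ ^ m) ^ 2 ≤ K := by
    refine hgv'.trans ?_
    have := hsNorm_nonneg s v
    rw [hK]
    gcongr
  have hiu := (memLp_two_iff_integrable_sq hgu.1).1 hgu
  have hiv := (memLp_two_iff_integrable_sq hgv.1).1 hgv
  -- After Cauchy–Schwarz the growth factor is bounded in L² by the H^s bound, while the difference
  -- is measured on S alone; this localization serves the splitting of the potential.
  have hG : ∫ x in S, (‖u x‖ + ‖u x‖ ^ m + (‖v x‖ + ‖v x‖ ^ m)) ^ 2 ≤ 4 * K := by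
    refine (setIntegral_le_integral ((memLp_two_iff_integrable_sq hgs.1).1 hgs)
      (ae_of_all _ fun x => by positivity)).trans ?_
    have h1 : ∫ x, (‖u x‖ + ‖u x‖ ^ m + (‖v x‖ + ‖v x‖ ^ m)) ^ 2 ≤
        ∫ x, (2 * (‖u x‖ + ‖u x‖ ^ m) ^ 2 + 2 * (‖v x‖ + ‖v x‖ ^ m) ^ 2) := by
      refine integral_mono ((memLp_two_iff_integrable_sq hgs.1).1 hgs)
        ((hiu.const_mul 2).add (hiv.const_mul 2)) fun x => ?_
      simp only
      nlinarith [sq_nonneg (‖u x‖ + ‖u x‖ ^ m - (‖v x‖ + ‖v x‖ ^ m))]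
    rw [integral_add (hiu.const_mul 2) (hiv.const_mul 2), integral_const_mul,
      integral_const_mul] at h1
    linarith
  have hK0 : 0 ≤ K := (integral_nonneg fun x => by positivity).trans hKu
  calc ∫ x in S, |NC W (u x) - NC W (v x)|
      ≤ ∫ x in S, C₁ * (‖(u - v) x‖ * (‖u x‖ + ‖u x‖ ^ m + (‖v x‖ + ‖v x‖ ^ m))) :=
        integral_mono_ae ((h.integrable_NC hu).sub (h.integrable_NC hv)).abs.restrict
          (hprod.const_mul C₁).restrict (ae_restrict_of_ae hsub)
    _ = C₁ * ∫ x in S, ‖(u - v) x‖ * (‖u x‖ + ‖u x‖ ^ m + (‖v x‖ + ‖v x‖ ^ m)) :=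
        integral_const_mul _ _
    _ ≤ C₁ * (Real.sqrt (∫ x in S, ‖(u - v) x‖ ^ 2) *
          Real.sqrt (∫ x in S, (‖u x‖ + ‖u x‖ ^ m + (‖v x‖ + ‖v x‖ ^ m)) ^ 2)) := by
        gcongr
        exact integral_mul_le_sqrt_mul_sqrt (fun x => by positivity) (fun x => by positivity)
          (huv.restrict S) (hgs.restrict S)
    _ ≤ C₁ * (Real.sqrt (∫ x in S, ‖(u - v) x‖ ^ 2) * Real.sqrt (4 * K)) := by
        gcongr
    _ = _ := by
        rw [show (4 : ℝ) * K = 2 ^ 2 * K by norm_num, Real.sqrt_mul (by norm_num),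
          Real.sqrt_sq (by norm_num)]
        ring

theorem Admissible.pot_sub_le {s p : ℝ} {m : ℕ} {W : ℂ → ℝ} (h : Admissible s p m W)
    (A : ℝ) : ∃ C : ℝ, 0 ≤ C ∧ ∀ u v : L2, MemHs s u → MemHs s v → hsNorm s u ≤ A →
      hsNorm s v ≤ A → |pot W u - pot W v| ≤ C * ‖u - v‖ := by
  obtain ⟨C, hC, hb⟩ := h.setIntegral_NC_sub_le A
  refine ⟨C, hC, fun u v hu hv huA hvA => ?_⟩
  have h1 := hb u v hu hv huA hvA univ
  rw [Measure.restrict_univ, ← normSq_eq_integral, Real.sqrt_sq (norm_nonneg _)] at h1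
  rw [pot, pot, ← integral_sub (h.integrable_NC hu) (h.integrable_NC hv)]
  exact (abs_integral_le_integral_abs).trans h1

theorem Admissible.pot_zero {s p : ℝ} {m : ℕ} {W : ℂ → ℝ} (h : Admissible s p m W) :
    pot W 0 = 0 := by
  rw [pot]
  have h1 : (fun x => NC W ((0 : L2) x)) =ᵐ[volume] fun _ => 0 := by
    filter_upwards [Lp.coeFn_zero ℂ 2 (volume : Measure ℝ)] with x hx
    rw [hx, Pi.zero_apply, h.NC_zero]
  rw [integral_congr_ae h1, integral_zero]

/-- On bounded subsets of `H^s`, smallness in `L²` implies smallness in `L^k`. -/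
theorem integral_pow_small {s : ℝ} (hs : 1 / 2 ≤ s) {k : ℕ} (hk : 2 ≤ k) (A : ℝ) {ε : ℝ}
    (hε : 0 < ε) : ∃ δ > 0, ∀ u : L2, MemHs s u → hsNorm s u ≤ A → ‖u‖ ≤ δ →
      ∫ x, ‖u x‖ ^ k ≤ ε := by
  obtain ⟨C, hC, hb⟩ := integral_pow_le_hsNorm hs (k := 2 * k) (by omega)
  have hA' : 0 ≤ |A| := abs_nonneg A
  obtain ⟨Λ, hΛ, hΛ'⟩ : ∃ Λ : ℝ, 0 < Λ ∧ C * |A| ^ (2 * k) / Λ ^ k ≤ ε / 2 := by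
    have hlim : Tendsto (fun Λ : ℝ => C * |A| ^ (2 * k) / Λ ^ k) atTop (𝓝 0) :=
      tendsto_const_nhds.div_atTop (tendsto_pow_atTop (by omega))
    obtain ⟨Λ, h1, h2⟩ := ((hlim.eventually (ge_mem_nhds (half_pos hε))).and
      (eventually_gt_atTop 0)).exists
    exact ⟨Λ, h2, h1⟩
  refine ⟨Real.sqrt (ε / 2 / Λ ^ (k - 2)), by positivity, fun u hu huA hud => ?_⟩
  -- Interpolation between L² and L^(2k), with the cut at the height Λ for which the L^(2k) part
  -- costs at most ε/2.
  have hpt : ∀ x, ‖u x‖ ^ k ≤ Λ ^ (k - 2) * ‖u x‖ ^ 2 + ‖u x‖ ^ (2 * k) / Λ ^ k := by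
    intro x
    rcases le_total ‖u x‖ Λ with h | h
    · have h1 : ‖u x‖ ^ k = ‖u x‖ ^ (k - 2) * ‖u x‖ ^ 2 := by
        rw [← pow_add, Nat.sub_add_cancel hk]
      have h2 : 0 ≤ ‖u x‖ ^ (2 * k) / Λ ^ k := by positivity
      rw [h1]
      have : ‖u x‖ ^ (k - 2) * ‖u x‖ ^ 2 ≤ Λ ^ (k - 2) * ‖u x‖ ^ 2 := by gcongr
      linarith
    · have h1 : ‖u x‖ ^ k ≤ ‖u x‖ ^ (2 * k) / Λ ^ k := by
        rw [le_div_iff₀ (by positivity), two_mul, pow_add]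
        gcongr
      have : 0 ≤ Λ ^ (k - 2) * ‖u x‖ ^ 2 := by positivity
      linarith
  obtain ⟨hi, hle⟩ := hb u hu
  have hi1 : Integrable fun x => Λ ^ (k - 2) * ‖u x‖ ^ 2 := (integrable_normSq u).const_mul _
  have hi2 : Integrable fun x => ‖u x‖ ^ (2 * k) / Λ ^ k := hi.div_const _
  obtain ⟨C', -, hb'⟩ := integral_pow_le_hsNorm hs hk
  refine (integral_mono (hb' u hu).1 (hi1.add hi2) hpt).trans ?_
  simp only [Pi.add_apply]
  rw [integral_add hi1 hi2, integral_const_mul, integral_div, ← normSq_eq_integral]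
  have h1 : ‖u‖ ^ 2 ≤ ε / 2 / Λ ^ (k - 2) := by
    have := pow_le_pow_left₀ (norm_nonneg u) hud 2
    rwa [Real.sq_sqrt (by positivity)] at this
  have h2 : Λ ^ (k - 2) * ‖u‖ ^ 2 ≤ ε / 2 := by
    rw [le_div_iff₀ (by positivity)] at h1
    linarith
  have h3 : (∫ x, ‖u x‖ ^ (2 * k)) / Λ ^ k ≤ C * |A| ^ (2 * k) / Λ ^ k := by
    have := hsNorm_nonneg s u
    refine div_le_div_of_nonneg_right (hle.trans ?_) (by positivity)
    gcongr
    exact huA.trans (le_abs_self A)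
  linarith

/-- Coercivity of the energy on bounded sets of charges. -/
theorem Admissible.coercive {s p : ℝ} {m : ℕ} {W : ℂ → ℝ} (h : Admissible s p m W) {B : ℝ}
    (hB : 0 < B) : ∃ K : ℝ, 0 ≤ K ∧ ∀ u : L2, MemHs s u → ‖u‖ ≤ B →
      1 / 4 * ‖fracD s u‖ ^ 2 - K ≤ J s W u := by
  obtain ⟨C, hC, hl⟩ := h.lower
  -- With this ε, C·ε ≤ 1/4, so half of the kinetic term ½‖D^s u‖² survives.
  obtain ⟨K, hK, hGN⟩ := integral_rpow_le_fracD h.pos h.two_lt h.lt_crit hB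
    (ε := 1 / (4 * (C + 1))) (by positivity)
  refine ⟨C * B ^ 2 + C * K, by positivity, fun u hu huB => ?_⟩
  obtain ⟨hi, hle⟩ := hGN u hu huB
  have h1 : ∫ x, (-C * ‖u x‖ ^ 2 - C * ‖u x‖ ^ p) ≤ pot W u :=
    integral_mono (((integrable_normSq u).const_mul _).sub (hi.const_mul _)) (h.integrable_NC hu)
      fun x => hl _
  rw [integral_sub ((integrable_normSq u).const_mul _) (hi.const_mul _), integral_const_mul,
    integral_const_mul, ← normSq_eq_integral] at h1
  have h2 : C * ∫ x, ‖u x‖ ^ p ≤ C * K + 1 / 4 * ‖fracD s u‖ ^ 2 := by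
    have h3 : C * (1 / (4 * (C + 1)) * ‖fracD s u‖ ^ 2) ≤ 1 / 4 * ‖fracD s u‖ ^ 2 := by
      have : C * (1 / (4 * (C + 1))) ≤ 1 / 4 := by
        rw [mul_one_div, div_le_div_iff₀ (by positivity) (by norm_num)]
        linarith
      nlinarith [sq_nonneg ‖fracD s u‖]
    nlinarith [mul_le_mul_of_nonneg_left hle hC]
  have h4 : C * ‖u‖ ^ 2 ≤ C * B ^ 2 := by gcongr
  unfold J
  linarith

theorem J_translate {s : ℝ} (W : ℂ → ℝ) {u : L2} (hu : MemHs s u) (τ : ℝ) :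
    J s W (translate τ u) = J s W u := by
  rw [J, J, fracD_translate hu, norm_translate, pot, pot, integral_comp_translate]

theorem J_dilate {s a : ℝ} (ha : 0 < a) (W : ℂ → ℝ) {u : L2} (hu : MemHs s u) :
    J s W (dilate a ha.ne' u) = a⁻¹ * (1 / 2 * a ^ (2 * s) * ‖fracD s u‖ ^ 2 + pot W u) := by
  rw [J, (hu.hasD.dilate ha).fracD_eq, norm_smul, mul_pow, normSq_dilate ha, pot, pot,
    integral_comp_dilate _ ha, Complex.norm_real, Real.norm_of_nonneg (by positivity),
    ← Real.rpow_natCast (a ^ s), ← Real.rpow_mul ha.le, show s * (2 : ℕ) = 2 * s by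
      push_cast; ring]
  ring

/-! ### Test functions -/

theorem memHs_schwartz {a : ℝ} (ha : 0 ≤ a) (φ : SchwartzMap ℝ ℂ) : MemHs a (φ.toLp 2) := by
  obtain ⟨n, hn⟩ := exists_nat_ge a
  set ψ := 𝓕 φ with hψ
  obtain ⟨C, hC⟩ : ∃ C : ℝ, ∀ ξ, (1 + ‖ξ‖) ^ (n + 1) * ‖ψ ξ‖ ≤ C := by
    refine ⟨2 ^ (n + 1) * ((Finset.Iic (n + 1, 0)).sup fun m => SchwartzMap.seminorm ℝ m.1 m.2) ψ,
      fun ξ => ?_⟩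
    have := SchwartzMap.one_add_le_sup_seminorm_apply (𝕜 := ℝ) (m := (n + 1, 0)) (k := n + 1)
      (n := 0) le_rfl le_rfl ψ ξ
    simpa only [norm_iteratedFDeriv_zero] using this
  have hint : Integrable (fun ξ : ℝ => (1 + ‖ξ‖) ^ (-2 : ℝ)) :=
    integrable_one_add_norm (by simp)
  have hw0 : ∀ ξ : ℝ, 0 < 1 + ‖ξ‖ := fun ξ => by positivity
  have hfL : MemLp (fun ξ : ℝ => (1 + ‖ξ‖)⁻¹) 2 volume := by
    refine (memLp_two_iff_integrable_sq (by fun_prop)).2 (hint.congr (ae_of_all _ fun ξ => ?_))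
    simp only
    rw [Real.rpow_neg (hw0 ξ).le, Real.rpow_two, inv_pow]
  have hval : (𝓕 (φ.toLp 2) : L2) =ᵐ[volume] ψ := by
    rw [SchwartzMap.toLp_fourier_eq]
    exact ψ.coeFn_toLp 2 volume
  refine hfL.of_le_mul (c := (2 * Real.pi) ^ a * C)
    ((measurable_symb a).aestronglyMeasurable.mul (Lp.aestronglyMeasurable _)) ?_
  filter_upwards [hval] with ξ hξ
  rw [hξ, norm_mul, norm_symb, norm_inv, Real.norm_of_nonneg (hw0 ξ).le, ← div_eq_mul_inv,
    le_div_iff₀ (hw0 ξ)]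
  have h1 : |2 * Real.pi * ξ| ^ a ≤ (2 * Real.pi) ^ a * (1 + ‖ξ‖) ^ n := by
    rw [abs_mul, abs_of_pos Real.two_pi_pos, Real.mul_rpow Real.two_pi_pos.le (abs_nonneg _)]
    gcongr
    rw [← Real.rpow_natCast]
    have h2 : |ξ| ^ a ≤ (1 + ‖ξ‖) ^ a :=
      Real.rpow_le_rpow (abs_nonneg _) (by rw [Real.norm_eq_abs]; linarith) ha
    exact h2.trans (Real.rpow_le_rpow_of_exponent_le (by linarith [norm_nonneg ξ]) hn)
  calc _ ≤ (2 * Real.pi) ^ a * (1 + ‖ξ‖) ^ n * ‖ψ ξ‖ * (1 + ‖ξ‖) := by gcongr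
    _ = (2 * Real.pi) ^ a * ((1 + ‖ξ‖) ^ (n + 1) * ‖ψ ξ‖) := by ring
    _ ≤ _ := by
      have := hC ξ
      gcongr

theorem IsTest.exists_schwartz {φ : L2} (h : IsTest φ) :
    ∃ f : SchwartzMap ℝ ℂ, HasCompactSupport f ∧ φ = f.toLp 2 := by
  obtain ⟨f, hf, hc, hφ⟩ := h
  refine ⟨hc.toSchwartzMap hf, hc, Lp.ext (hφ.trans ?_)⟩
  exact ((hc.toSchwartzMap hf).coeFn_toLp 2 volume).symm

theorem IsTest.memHs {a : ℝ} (ha : 0 ≤ a) {φ : L2} (h : IsTest φ) : MemHs a φ := by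
  obtain ⟨f, -, rfl⟩ := h.exists_schwartz
  exact memHs_schwartz ha f

/-! ### The minimization problem -/

/-- The infimum of `J` on the states of charge `c`. -/
def Jinf (s : ℝ) (W : ℂ → ℝ) (c : ℝ) : ℝ := sInf (J s W '' {u | MemHs s u ∧ ‖u‖ ^ 2 = c})

theorem Admissible.bddBelow_J {s p : ℝ} {m : ℕ} {W : ℂ → ℝ} (h : Admissible s p m W) (c : ℝ) :
    BddBelow (J s W '' {u | MemHs s u ∧ ‖u‖ ^ 2 = c}) := by
  obtain ⟨K, -, hK⟩ := h.coercive (B := Real.sqrt c + 1) (by positivity)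
  refine ⟨-K, ?_⟩
  rintro _ ⟨u, ⟨hu, hc⟩, rfl⟩
  have h1 := hK u hu (by
    rw [← hc, Real.sqrt_sq (norm_nonneg _)]; linarith)
  nlinarith [sq_nonneg ‖fracD s u‖]

theorem Admissible.Jinf_le {s p : ℝ} {m : ℕ} {W : ℂ → ℝ} (h : Admissible s p m W) {c : ℝ} {u : L2}
    (hu : MemHs s u) (hc : ‖u‖ ^ 2 = c) : Jinf s W c ≤ J s W u :=
  csInf_le (h.bddBelow_J c) ⟨u, ⟨hu, hc⟩, rfl⟩

theorem fracD_zero (s : ℝ) : fracD s 0 = 0 := by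
  have := fracD_smul 0 (memHs_zero s)
  simpa using this

theorem Admissible.J_zero {s p : ℝ} {m : ℕ} {W : ℂ → ℝ} (h : Admissible s p m W) :
    J s W 0 = 0 := by
  simp [J, fracD_zero, h.pot_zero]

theorem MemHs.dilate {s a : ℝ} (ha : 0 < a) {u : L2} (hu : MemHs s u) :
    MemHs s (dilate a ha.ne' u) := (hu.hasD.dilate ha).memHs

/-- The dilation by a = ‖u‖²/c ≤ 1 raises the charge to c and multiplies the kinetic part of aJ by
a^(2s) ≤ 1. The inequality takes the place of subadditivity of the infimum. -/
theorem Admissible.scale_le {s p : ℝ} {m : ℕ} {W : ℂ → ℝ} (h : Admissible s p m W) {c : ℝ}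
    {u : L2} (hu : MemHs s u) (hc0 : 0 < c) (hc : ‖u‖ ^ 2 ≤ c) :
    ‖u‖ ^ 2 / c * Jinf s W c ≤ J s W u := by
  rcases eq_or_ne u 0 with rfl | hu0
  · rw [h.J_zero]; simp
  set a := ‖u‖ ^ 2 / c with ha
  have hn : 0 < ‖u‖ := norm_pos_iff.2 hu0
  have ha0 : 0 < a := by positivity
  have ha1 : a ≤ 1 := (div_le_one hc0).2 hc
  have h1 : ‖dilate a ha0.ne' u‖ ^ 2 = c := by
    rw [normSq_dilate ha0, ha]; field_simp
  have h2 := h.Jinf_le (hu.dilate ha0) h1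
  rw [J_dilate ha0 W hu] at h2
  have h3 : a * Jinf s W c ≤ 1 / 2 * a ^ (2 * s) * ‖fracD s u‖ ^ 2 + pot W u := by
    have := mul_le_mul_of_nonneg_left h2 ha0.le
    rwa [mul_inv_cancel_left₀ ha0.ne'] at this
  have h4 : a ^ (2 * s) ≤ 1 := Real.rpow_le_one ha0.le ha1 (by linarith [h.pos])
  unfold J
  nlinarith [sq_nonneg ‖fracD s u‖]

/-- Strict because a^(2s) < 1 and D^s is injective, so the kinetic term of a nonzero state is
positive. It later forces a weak limit to carry the whole charge. -/
theorem Admissible.scale_lt {s p : ℝ} {m : ℕ} {W : ℂ → ℝ} (h : Admissible s p m W) {c : ℝ}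
    {u : L2} (hu : MemHs s u) (hu0 : u ≠ 0) (hc : ‖u‖ ^ 2 < c) :
    ‖u‖ ^ 2 / c * Jinf s W c < J s W u := by
  have hn : 0 < ‖u‖ := norm_pos_iff.2 hu0
  have hc0 : 0 < c := lt_of_le_of_lt (sq_nonneg _) hc
  set a := ‖u‖ ^ 2 / c with ha
  have ha0 : 0 < a := by positivity
  have ha1 : a < 1 := (div_lt_one hc0).2 hc
  have h1 : ‖dilate a ha0.ne' u‖ ^ 2 = c := by
    rw [normSq_dilate ha0, ha]; field_simp
  have h2 := h.Jinf_le (hu.dilate ha0) h1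
  rw [J_dilate ha0 W hu] at h2
  have h3 : a * Jinf s W c ≤ 1 / 2 * a ^ (2 * s) * ‖fracD s u‖ ^ 2 + pot W u := by
    have := mul_le_mul_of_nonneg_left h2 ha0.le
    rwa [mul_inv_cancel_left₀ ha0.ne'] at this
  have h4 : a ^ (2 * s) < 1 := Real.rpow_lt_one ha0.le ha1 (by linarith [h.pos])
  have h5 : 0 < ‖fracD s u‖ := by
    rw [norm_pos_iff]
    exact fun h0 => hu0 (eq_zero_of_fracD_eq_zero hu h0)
  have h6 : 0 < ‖fracD s u‖ ^ 2 := by positivity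
  unfold J
  nlinarith

/-! ### Negativity of the infimum at large charge. -/

theorem exists_schwartz_plateau {r₀ d : ℝ} (hr₀ : 0 ≤ r₀) (hd : 0 < d) :
    ∃ (φ : SchwartzMap ℝ ℂ) (f : ℝ → ℝ), (∀ x, φ x = (f x : ℂ)) ∧ (∀ x, 0 ≤ f x) ∧
      (∀ x, f x ≤ r₀) ∧ (∀ x ∈ Icc (-1 : ℝ) 1, f x = r₀) ∧
      ∀ x, x ∉ Icc (-(1 + d)) (1 + d) → f x = 0 := by
  let b : ContDiffBump (0 : ℝ) := ⟨1, 1 + d, one_pos, by linarith⟩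
  have hbc : HasCompactSupport (fun x : ℝ => ((r₀ * b x : ℝ) : ℂ)) :=
    b.hasCompactSupport.comp_left (g := fun t : ℝ => ((r₀ * t : ℝ) : ℂ)) (by simp)
  have hbd : ContDiff ℝ ((⊤ : ℕ∞) : WithTop ℕ∞) (fun x : ℝ => ((r₀ * b x : ℝ) : ℂ)) :=
    Complex.ofRealCLM.contDiff.comp (contDiff_const.mul b.contDiff)
  refine ⟨hbc.toSchwartzMap hbd, fun x => r₀ * b x, fun x => rfl,
    fun x => mul_nonneg hr₀ b.nonneg, fun x => mul_le_of_le_one_right hr₀ b.le_one, ?_, ?_⟩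
  · intro x hx
    have h3 : b x = 1 := b.one_of_mem_closedBall (by
      rw [mem_closedBall_zero_iff, Real.norm_eq_abs]
      exact abs_le.2 hx)
    simp only [h3, mul_one]
  · intro x hx
    have h3 : b x = 0 := b.zero_of_le_dist (by
      rw [dist_zero_right, Real.norm_eq_abs]
      by_contra hlt
      exact hx (abs_le.1 (not_le.1 hlt).le))
    simp only [h3, mul_zero]

/-- A plateau with negative potential energy. -/
theorem Admissible.exists_pot_neg {s p : ℝ} {m : ℕ} {W : ℂ → ℝ} (h : Admissible s p m W) :
    ∃ u : L2, MemHs s u ∧ pot W u < 0 := by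
  obtain ⟨r₀, hr₀, hneg⟩ := h.neg
  obtain ⟨C, hC, hb⟩ := h.small 1 one_pos
  set M := r₀ ^ 2 + C * r₀ ^ (m + 1) with hM
  have hM0 : 0 ≤ M := by positivity
  -- The plateau [-1,1] contributes 2N(r₀); the two transition layers of width d contribute at most
  -- 2dM, where M bounds |N| on [0,r₀]. This d gives dM < -N(r₀).
  obtain ⟨d, hd⟩ : ∃ d, d = -NC W r₀ / (2 * (M + 1)) := ⟨_, rfl⟩
  have hd0 : 0 < d := hd ▸ div_pos (by linarith) (by positivity)
  obtain ⟨φ, f, hcoe, hf0, hfr, hf1, hf2⟩ := exists_schwartz_plateau hr₀.le hd0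
  refine ⟨_, memHs_schwartz h.pos.le φ, ?_⟩
  set g : ℝ → ℝ := fun x => (Icc (-(1 + d)) (1 + d)).indicator (fun _ => M) x +
    (Icc (-1 : ℝ) 1).indicator (fun _ => NC W r₀ - M) x with hg
  have hi1 : Integrable ((Icc (-(1 + d)) (1 + d)).indicator (fun _ : ℝ => M)) :=
    (integrable_indicator_iff measurableSet_Icc).2 (by simp)
  have hi2 : Integrable ((Icc (-1 : ℝ) 1).indicator (fun _ : ℝ => NC W r₀ - M)) :=
    (integrable_indicator_iff measurableSet_Icc).2 (by simp)
  have hle : ∀ᵐ x, NC W ((φ.toLp 2 : L2) x) ≤ g x := by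
    filter_upwards [φ.coeFn_toLp 2 volume] with x hx
    rw [hx, hcoe]
    by_cases h1 : x ∈ Icc (-1 : ℝ) 1
    · have h2 : x ∈ Icc (-(1 + d)) (1 + d) := ⟨by linarith [h1.1], by linarith [h1.2]⟩
      simp only [hg, indicator_of_mem h1, indicator_of_mem h2, hf1 x h1]
      linarith
    · by_cases h2 : x ∈ Icc (-(1 + d)) (1 + d)
      · simp only [hg, indicator_of_notMem h1, indicator_of_mem h2, add_zero]
        refine (le_abs_self _).trans ((hb _).trans ?_)
        rw [Complex.norm_real, Real.norm_of_nonneg (hf0 x), hM, one_mul]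
        have h3 := hf0 x
        have h4 := hfr x
        gcongr
      · simp only [hg, indicator_of_notMem h1, indicator_of_notMem h2, hf2 x h2,
          Complex.ofReal_zero, h.NC_zero, add_zero, le_refl]
  have hint := h.integrable_NC (memHs_schwartz h.pos.le φ)
  have h7 : pot W (φ.toLp 2) ≤ ∫ x, g x := integral_mono_ae hint (hi1.add hi2) hle
  have h8 : ∫ x, g x = (1 + d - -(1 + d)) * M + (1 - -1) * (NC W r₀ - M) := by
    rw [hg, integral_add hi1 hi2, integral_indicator measurableSet_Icc,
      integral_indicator measurableSet_Icc, setIntegral_const, setIntegral_const,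
      Real.volume_real_Icc_of_le (by linarith), Real.volume_real_Icc_of_le (by norm_num),
      smul_eq_mul, smul_eq_mul]
  have h5 : d * M < -NC W r₀ := by
    have h6 : d * (2 * (M + 1)) = -NC W r₀ := by rw [hd]; field_simp
    nlinarith
  rw [h8] at h7
  nlinarith

/-- Stretching by a → 0 multiplies the kinetic term by a^(2s) relative to the potential, so the
negative potential prevails. -/
theorem Admissible.exists_J_neg {s p : ℝ} {m : ℕ} {W : ℂ → ℝ} (h : Admissible s p m W) :
    ∃ u : L2, MemHs s u ∧ u ≠ 0 ∧ J s W u < 0 := by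
  obtain ⟨u, hu, hneg⟩ := h.exists_pot_neg
  have hgap : 0 < 2 * s := by linarith [h.pos]
  have hlim : Tendsto (fun a : ℝ => 1 / 2 * a ^ (2 * s) * ‖fracD s u‖ ^ 2 + pot W u) (𝓝[>] 0)
      (𝓝 (1 / 2 * 0 * ‖fracD s u‖ ^ 2 + pot W u)) := by
    have h1 := (Real.continuousAt_rpow_const 0 (2 * s) (Or.inr hgap.le)).tendsto
    rw [Real.zero_rpow hgap.ne'] at h1
    exact (((h1.mono_left nhdsWithin_le_nhds).const_mul _).mul_const _).add_const _
  obtain ⟨a, ha, ha0⟩ := ((hlim.eventually (gt_mem_nhds (by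
    simpa using hneg : 1 / 2 * 0 * ‖fracD s u‖ ^ 2 + pot W u < 0))).and self_mem_nhdsWithin).exists
  have ha0 : 0 < a := ha0
  have hJ : J s W (dilate a ha0.ne' u) < 0 := by
    rw [J_dilate ha0 W hu]
    exact mul_neg_of_pos_of_neg (inv_pos.2 ha0) ha
  refine ⟨dilate a ha0.ne' u, hu.dilate ha0, fun h0 => ?_, hJ⟩
  rw [h0, h.J_zero] at hJ
  exact lt_irrefl _ hJ

/-- By `Admissible.scale_le`, one state with negative `J` makes the infimum negative at its charge
and at every larger one. -/
theorem Admissible.exists_Jinf_neg {s p : ℝ} {m : ℕ} {W : ℂ → ℝ} (h : Admissible s p m W) :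
    ∃ c₀ : ℝ, 0 < c₀ ∧ ∀ c, c₀ ≤ c → Jinf s W c < 0 := by
  obtain ⟨u, hu, hu0, hneg⟩ := h.exists_J_neg
  have hn : 0 < ‖u‖ := norm_pos_iff.2 hu0
  refine ⟨‖u‖ ^ 2, by positivity, fun c hc => ?_⟩
  have hc0 : 0 < c := lt_of_lt_of_le (by positivity) hc
  have h1 := (h.scale_le hu hc0 hc).trans_lt hneg
  have h2 : 0 < ‖u‖ ^ 2 / c := by positivity
  exact neg_of_mul_neg_right h1 h2.le

theorem Admissible.exists_charge {s p : ℝ} {m : ℕ} {W : ℂ → ℝ} (h : Admissible s p m W) {c : ℝ}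
    (hc : 0 < c) : ∃ u : L2, MemHs s u ∧ ‖u‖ ^ 2 = c := by
  obtain ⟨u, hu, hu0, -⟩ := h.exists_J_neg
  have hn : 0 < ‖u‖ := norm_pos_iff.2 hu0
  have ha0 : 0 < ‖u‖ ^ 2 / c := by positivity
  refine ⟨dilate _ ha0.ne' u, hu.dilate ha0, ?_⟩
  rw [normSq_dilate ha0]
  field_simp

theorem Admissible.exists_minimizing {s p : ℝ} {m : ℕ} {W : ℂ → ℝ} (h : Admissible s p m W)
    {c : ℝ} (hc : 0 < c) : ∃ u : ℕ → L2, (∀ n, MemHs s (u n)) ∧ (∀ n, ‖u n‖ ^ 2 = c) ∧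
      Tendsto (fun n => J s W (u n)) atTop (𝓝 (Jinf s W c)) := by
  obtain ⟨u₀, hu₀, hc₀⟩ := h.exists_charge hc
  obtain ⟨x, -, hx, hmem⟩ := exists_seq_tendsto_sInf
    (S := J s W '' {u | MemHs s u ∧ ‖u‖ ^ 2 = c}) ⟨_, u₀, ⟨hu₀, hc₀⟩, rfl⟩ (h.bddBelow_J c)
  choose u hu hux using hmem
  refine ⟨u, fun n => (hu n).1, fun n => (hu n).2, ?_⟩
  simpa only [hux] using! hx

/-! ### Evaluation of band limited functions -/

/-- The reproducing kernel of the functions with frequencies in `[-R, R]`. -/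
def kern (R : ℝ) : L2 :=
  𝓕⁻ (indicatorConstLp 2 (measurableSet_Icc (a := -R) (b := R))
    (by simp [Real.volume_Icc]) (1 : ℂ) : L2)

theorem inner_kern_translate (R y : ℝ) (u : L2) :
    (inner ℂ (kern R) (translate (-y) u) : ℂ) =
      ∫ ξ in Icc (-R) R, (Real.fourierChar (ξ * y) : Circle) • (𝓕 u : L2) ξ := by
  rw [← inner_fourier, kern, fourier_fourierInv, inner_eq_integral,
    ← integral_indicator measurableSet_Icc]
  refine integral_congr_ae ?_
  filter_upwards [fourier_translate (-y) u, indicatorConstLp_coeFn (p := 2)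
    (hs := measurableSet_Icc (a := -R) (b := R))
    (hμs := by simp [Real.volume_Icc]) (c := (1 : ℂ))] with ξ h1 h2
  rw [h1, h2, indicator_apply, indicator_apply]
  split_ifs
  · rw [map_one, one_mul, Circle.smul_def, smul_eq_mul]
    congr 3
    ring
  · simp

/-- Values of a band limited function are pairings with one fixed kernel. Weak L² convergence
therefore becomes pointwise convergence, and large values yield translates that do not tend weakly
to 0. -/
theorem lowpass_eq_inner (R : ℝ) (u : L2) :
    lowpass R u =ᵐ[volume] fun y => inner ℂ (kern R) (translate (-y) u) := by
  filter_upwards [lowpass_coeFn R u] with y hy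
  rw [hy, inner_kern_translate]

theorem inner_translate (y : ℝ) (f g : L2) :
    (inner ℂ f (translate (-y) g) : ℂ) = inner ℂ (translate y f) g := by
  have h1 : (inner ℂ (translate y f) (translate y (translate (-y) g)) : ℂ) =
      inner ℂ f (translate (-y) g) :=
    (Lp.compMeasurePreservingₗᵢ ℂ (fun x : ℝ => x - y)
      (measurePreserving_sub_right volume y)).inner_map_map f (translate (-y) g)
  rw [translate_translate, add_neg_cancel, translate_zero] at h1
  exact h1.symm

theorem exists_lowpass_close {s : ℝ} (hs : 0 < s) (A : ℝ) {δ : ℝ} (hδ : 0 < δ) :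
    ∃ R : ℝ, 0 < R ∧ ∀ u : L2, MemHs s u → hsNorm s u ≤ A → ‖u - lowpass R u‖ ≤ δ := by
  have hlim : Tendsto (fun R : ℝ => R ^ s * δ) atTop atTop :=
    (tendsto_rpow_atTop hs).atTop_mul_const hδ
  obtain ⟨R, hR, hR0⟩ := ((hlim.eventually_ge_atTop A).and (eventually_gt_atTop 0)).exists
  refine ⟨R, hR0, fun u hu huA => ?_⟩
  have h1 := rpow_mul_norm_sub_lowpass_le hs.le hR0.le hu
  have h3 : R ^ s ≤ (2 * Real.pi * R) ^ s :=
    Real.rpow_le_rpow hR0.le (by nlinarith [Real.pi_gt_three]) hs.le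
  have h4 : R ^ s * ‖u - lowpass R u‖ ≤ R ^ s * δ :=
    (mul_le_mul_of_nonneg_right h3 (norm_nonneg _)).trans
      (h1.trans ((norm_fracD_le_hsNorm s u).trans (huA.trans hR)))
  exact le_of_mul_le_mul_left h4 (by positivity)

/-- Bounded sequences which do not vanish in `L^k` do not vanish locally. -/
theorem exists_translate_inner_ge {s : ℝ} (hs : 1 / 2 ≤ s) {k : ℕ} (hk : 3 ≤ k) (A : ℝ) {η : ℝ}
    (hη : 0 < η) : ∃ R η' : ℝ, 0 < η' ∧ ∀ u : L2, MemHs s u → hsNorm s u ≤ A →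
      η ≤ ∫ x, ‖u x‖ ^ k → ∃ y : ℝ, η' ≤ ‖(inner ℂ (kern R) (translate (-y) u) : ℂ)‖ := by
  -- With u = P + Q split into low and high frequencies, |u|^k ≤ 2^k(|P|^k + |Q|^k). If both parts
  -- integrate to at most ε, one of them strictly, then ∫|u|^k < 2^k·2ε = η.
  set ε := η / 2 ^ (k + 1) with hε
  have hε0 : 0 < ε := by positivity
  obtain ⟨δ, hδ, hsmall⟩ := integral_pow_small hs (k := k) (by omega) A hε0
  obtain ⟨R, hR, hclose⟩ := exists_lowpass_close (by linarith : 0 < s) A hδ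
  set η' := min 1 (ε / (2 * (A ^ 2 + 1))) with hη'
  have hη'0 : 0 < η' := by positivity
  refine ⟨R, η', hη'0, fun u hu huA hge => ?_⟩
  by_contra! hcon
  obtain ⟨C, hC, hb⟩ := integral_pow_le_hsNorm hs (k := k) (by omega)
  set P := lowpass R u with hP
  have hPm : MemHs s P := (hu.hasD.lowpass R).memHs
  have hQm : MemHs s (u - P) := hu.sub hPm
  have hQ : ∫ x, ‖(u - P) x‖ ^ k ≤ ε :=
    hsmall _ hQm ((hsNorm_sub_lowpass_le hu R).trans huA) (hclose u hu huA)
  have hPb : ∀ᵐ x, ‖P x‖ ≤ η' := by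
    filter_upwards [lowpass_eq_inner R u] with x hx
    rw [hx]
    exact (hcon x).le
  -- If all pairings are below η' ≤ 1, then |P| ≤ η' almost everywhere, and |P|^k ≤ η'|P|² because k
  -- ≥ 3.
  have hPk : ∫ x, ‖P x‖ ^ k ≤ η' * A ^ 2 := by
    have h1 : ∫ x, ‖P x‖ ^ k ≤ ∫ x, η' * ‖P x‖ ^ 2 := by
      refine integral_mono_ae (hb P hPm).1 ((integrable_normSq P).const_mul _) ?_
      filter_upwards [hPb] with x hx
      have h2 : ‖P x‖ ^ k = ‖P x‖ ^ (k - 3) * ‖P x‖ * ‖P x‖ ^ 2 := by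
        rw [← pow_succ, ← pow_add]; congr 1; omega
      have h3 : ‖P x‖ ^ (k - 3) ≤ 1 :=
        pow_le_one₀ (norm_nonneg _) (hx.trans (min_le_left _ _))
      rw [h2]
      have : ‖P x‖ ^ (k - 3) * ‖P x‖ ≤ 1 * η' := by gcongr
      rw [one_mul] at this
      gcongr
    rw [integral_const_mul, ← normSq_eq_integral] at h1
    refine h1.trans ?_
    have h2 : ‖P‖ ≤ A := (norm_lowpass_le R u).trans ((norm_le_hsNorm s u).trans huA)
    gcongr
  have hη'A : η' * A ^ 2 < ε := by
    have h1 : η' * (2 * (A ^ 2 + 1)) ≤ ε := by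
      rw [← le_div_iff₀ (by positivity)]
      exact min_le_right _ _
    nlinarith [sq_nonneg A]
  have hsum : ∫ x, ‖u x‖ ^ k ≤ 2 ^ k * (∫ x, ‖P x‖ ^ k) + 2 ^ k * ∫ x, ‖(u - P) x‖ ^ k := by
    rw [← integral_const_mul, ← integral_const_mul,
      ← integral_add ((hb P hPm).1.const_mul _) ((hb _ hQm).1.const_mul _)]
    refine integral_mono_ae (hb u hu).1 (((hb P hPm).1.const_mul _).add
      ((hb _ hQm).1.const_mul _)) ?_
    filter_upwards [Lp.coeFn_sub u P] with x hx
    rw [hx, Pi.sub_apply]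
    have h1 : ‖u x‖ ≤ ‖P x‖ + ‖u x - P x‖ := by
      have := norm_add_le (P x) (u x - P x)
      rwa [add_sub_cancel] at this
    have h2 := add_pow_le (norm_nonneg (P x)) (norm_nonneg (u x - P x)) k
    have h3 : (2 : ℝ) ^ (k - 1) ≤ 2 ^ k := pow_le_pow_right₀ (by norm_num) (by omega)
    calc ‖u x‖ ^ k ≤ (‖P x‖ + ‖u x - P x‖) ^ k := by gcongr
      _ ≤ 2 ^ (k - 1) * (‖P x‖ ^ k + ‖u x - P x‖ ^ k) := h2
      _ ≤ 2 ^ k * (‖P x‖ ^ k + ‖u x - P x‖ ^ k) := by gcongr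
      _ = _ := by ring
  have h2k : (0 : ℝ) < 2 ^ k := by positivity
  have h4 : η = 2 ^ k * (2 * ε) := by
    rw [hε, pow_succ]; field_simp
  nlinarith

/-! ### Concentration compactness -/

/-- Weak convergence in `L²`. -/
def WeakTendsto (u : ℕ → L2) (v : L2) : Prop :=
  ∀ φ : L2, Tendsto (fun n => (inner ℂ φ (u n) : ℂ)) atTop (𝓝 (inner ℂ φ v))

theorem WeakTendsto.sub {u u' : ℕ → L2} {v v' : L2} (h : WeakTendsto u v)
    (h' : WeakTendsto u' v') : WeakTendsto (fun n => u n - u' n) (v - v') := by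
  intro φ
  simp only [inner_sub_right]
  exact (h φ).sub (h' φ)

theorem weakTendsto_const (v : L2) : WeakTendsto (fun _ => v) v := fun _ => tendsto_const_nhds

theorem WeakTendsto.comp {u : ℕ → L2} {v : L2} (h : WeakTendsto u v) {k : ℕ → ℕ}
    (hk : StrictMono k) : WeakTendsto (fun n => u (k n)) v :=
  fun φ => (h φ).comp hk.tendsto_atTop

/-- The square of the norm splits along a weakly convergent sequence. -/
theorem WeakTendsto.normSq_sub {u : ℕ → L2} {v : L2} (h : WeakTendsto u v) :
    Tendsto (fun n => ‖u n‖ ^ 2 - ‖v‖ ^ 2 - ‖u n - v‖ ^ 2) atTop (𝓝 0) := by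
  have h1 : ∀ n, ‖u n‖ ^ 2 - ‖v‖ ^ 2 - ‖u n - v‖ ^ 2 =
      2 * ((inner ℂ v (u n) : ℂ).re - (inner ℂ v v : ℂ).re) := by
    intro n
    have h2 := norm_sub_sq (𝕜 := ℂ) (u n) v
    have h3 : (inner ℂ v v : ℂ).re = ‖v‖ ^ 2 := by
      exact inner_self_eq_norm_sq (𝕜 := ℂ) v
    have h4 : RCLike.re (inner ℂ (u n) v : ℂ) = (inner ℂ v (u n) : ℂ).re :=
      inner_re_symm (𝕜 := ℂ) _ _
    rw [h2, h4, h3]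
    ring
  simp_rw [h1]
  have h5 := ((Complex.continuous_re.tendsto _).comp (h v)).sub_const (inner ℂ v v : ℂ).re
  rw [sub_self] at h5
  have h6 := h5.const_mul 2
  rw [mul_zero] at h6
  exact h6

/-- The graph of D^s is weakly closed, since membership in it can be tested against band limited
functions. -/
theorem hasD_of_weakTendsto {s : ℝ} (hs : 0 ≤ s) {u u' : ℕ → L2} {v v' : L2}
    (h : ∀ n, HasD s (u n) (u' n)) (hu : WeakTendsto u v) (hu' : WeakTendsto u' v') :
    HasD s v v' := by
  refine hasD_of_inner hs fun R φ => ?_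
  refine tendsto_nhds_unique (hu (cutD s hs R φ)) ?_
  refine (hu' (lowpass R φ)).congr fun n => ?_
  exact ((hasD_lowpass hs R φ).inner_symm (h n)).symm

theorem exists_weak_subseq_hs {s : ℝ} (hs : 0 ≤ s) {u : ℕ → L2} (hu : ∀ n, MemHs s (u n)) {A : ℝ}
    (hA : ∀ n, hsNorm s (u n) ≤ A) : ∃ (k : ℕ → ℕ) (v : L2), StrictMono k ∧ MemHs s v ∧
      WeakTendsto (fun n => u (k n)) v ∧
      WeakTendsto (fun n => fracD s (u (k n))) (fracD s v) := by
  obtain ⟨k₁, v, hk₁, hv⟩ := exists_weakly_convergent_subseq u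
    (fun n => (norm_le_hsNorm s _).trans (hA n))
  obtain ⟨k₂, v', hk₂, hv'⟩ := exists_weakly_convergent_subseq (fun n => fracD s (u (k₁ n)))
    (fun n => (norm_fracD_le_hsNorm s _).trans (hA _))
  have hv2 : WeakTendsto (fun n => u (k₁ (k₂ n))) v := WeakTendsto.comp hv hk₂
  have hD : HasD s v v' := hasD_of_weakTendsto hs (fun n => (hu _).hasD) hv2 hv'
  refine ⟨fun n => k₁ (k₂ n), v, hk₁.comp hk₂, hD.memHs, hv2, ?_⟩
  rw [hD.fracD_eq]
  exact hv'

/-- Local compactness: weak convergence to zero in `H^s` implies strong convergence in `L²_loc`. -/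
theorem tendsto_setIntegral_normSq {s : ℝ} (hs : 0 < s) {w : ℕ → L2} (hw : ∀ n, MemHs s (w n))
    {A : ℝ} (hA : ∀ n, hsNorm s (w n) ≤ A) (hweak : WeakTendsto w 0) (B : ℝ) :
    Tendsto (fun n => ∫ x in Icc (-B) B, ‖w n x‖ ^ 2) atTop (𝓝 0) := by
  -- For a fixed cut-off the low part tends to 0 pointwise and is bounded by ‖kern R‖·A, so
  -- dominated convergence applies on the bounded interval. The high part is small in L² uniformly
  -- in n.
  have hlow : ∀ R, Tendsto (fun n => ∫ x in Icc (-B) B, ‖lowpass R (w n) x‖ ^ 2) atTop (𝓝 0) := by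
    intro R
    have h0 : (0 : ℝ) = ∫ x in Icc (-B) B, (0 : ℝ) := by simp
    rw [h0]
    refine tendsto_integral_of_dominated_convergence (fun _ => (‖kern R‖ * A) ^ 2)
      (fun n => ((Lp.aestronglyMeasurable _).norm.pow 2).restrict) (integrable_const _) ?_ ?_
    · intro n
      refine ae_restrict_of_ae ?_
      filter_upwards [lowpass_eq_inner R (w n)] with x hx
      rw [hx, norm_pow, norm_norm]
      have h1 := norm_inner_le_norm (𝕜 := ℂ) (kern R) (translate (-x) (w n))
      rw [norm_translate] at h1
      have h2 := (norm_le_hsNorm s _).trans (hA n)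
      refine pow_le_pow_left₀ (norm_nonneg _) (h1.trans ?_) 2
      gcongr
    · refine ae_restrict_of_ae ?_
      filter_upwards [ae_all_iff.2 fun n => lowpass_eq_inner R (w n)] with x hx
      simp_rw [hx, inner_translate]
      have h1 := (hweak (translate x (kern R))).norm.pow 2
      rw [inner_zero_right, norm_zero] at h1
      simpa using h1
  refine Metric.tendsto_atTop.2 fun ε hε => ?_
  obtain ⟨R, -, hR⟩ := exists_lowpass_close hs A (δ := Real.sqrt (ε / 8)) (by positivity)
  obtain ⟨N, hN⟩ := Metric.tendsto_atTop.1 (hlow R) (ε / 4) (by positivity)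
  refine ⟨N, fun n hn => ?_⟩
  have h1 := hN n hn
  have hnn : ∀ f : ℝ → ℝ, 0 ≤ ∫ x in Icc (-B) B, f x ^ 2 :=
    fun f => integral_nonneg fun x => sq_nonneg _
  rw [dist_zero_right, Real.norm_of_nonneg (hnn _)] at h1 ⊢
  have h2 : ∫ x in Icc (-B) B, ‖w n x‖ ^ 2 ≤ 2 * (∫ x in Icc (-B) B, ‖lowpass R (w n) x‖ ^ 2) +
      2 * ∫ x in Icc (-B) B, ‖(w n - lowpass R (w n)) x‖ ^ 2 := by
    rw [← integral_const_mul, ← integral_const_mul, ← integral_add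
      ((integrable_normSq _).const_mul 2).restrict ((integrable_normSq _).const_mul 2).restrict]
    refine integral_mono_ae (integrable_normSq _).restrict
      (((integrable_normSq _).const_mul 2).restrict.add
        ((integrable_normSq _).const_mul 2).restrict) (ae_restrict_of_ae ?_)
    filter_upwards [Lp.coeFn_sub (w n) (lowpass R (w n))] with x hx
    simp only [hx, Pi.sub_apply]
    have h3 := norm_add_le (lowpass R (w n) x) (w n x - lowpass R (w n) x)
    rw [add_sub_cancel] at h3
    nlinarith [norm_nonneg (w n x),
      sq_nonneg (‖lowpass R (w n) x‖ - ‖w n x - lowpass R (w n) x‖)]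
  have h4 := setIntegral_normSq_le (w n - lowpass R (w n)) (Icc (-B) B)
  have h5 := pow_le_pow_left₀ (norm_nonneg _) (hR _ (hw n) (hA n)) 2
  rw [Real.sq_sqrt (by positivity)] at h5
  linarith

theorem tendsto_setIntegral_compl (v : L2) :
    Tendsto (fun n : ℕ => ∫ x in (Icc (-(n : ℝ)) n)ᶜ, ‖v x‖ ^ 2) atTop (𝓝 0) := by
  have h1 := (aecover_Icc (μ := (volume : Measure ℝ)) (l := atTop) (a := fun n : ℕ => -(n : ℝ))
    (b := fun n : ℕ => (n : ℝ)) (tendsto_neg_atTop_atBot.comp tendsto_natCast_atTop_atTop)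
    tendsto_natCast_atTop_atTop).integral_tendsto_of_countably_generated (integrable_normSq v)
  have h2 := h1.const_sub (∫ x, ‖v x‖ ^ 2)
  rw [sub_self] at h2
  refine h2.congr fun n => ?_
  have := integral_add_compl (measurableSet_Icc (a := -(n : ℝ)) (b := n)) (integrable_normSq v)
  linarith

/-- The potential energy splits along a weakly convergent sequence. -/
theorem Admissible.pot_splitting {s p : ℝ} {m : ℕ} {W : ℂ → ℝ} (h : Admissible s p m W)
    {u : ℕ → L2} {v : L2} (hu : ∀ n, MemHs s (u n)) (hv : MemHs s v) {A : ℝ}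
    (hA : ∀ n, hsNorm s (u n) ≤ A) (hweak : WeakTendsto u v) :
    Tendsto (fun n => pot W (u n) - pot W v - pot W (u n - v)) atTop (𝓝 0) := by
  set A' := A + hsNorm s v with hA'
  have hA0 : 0 ≤ A := (hsNorm_nonneg _ _).trans (hA 0)
  have hv0 := hsNorm_nonneg s v
  obtain ⟨C, hC, hlip⟩ := h.setIntegral_NC_sub_le A'
  have hw : ∀ n, MemHs s (u n - v) := fun n => (hu n).sub hv
  have hwA : ∀ n, hsNorm s (u n - v) ≤ A' := by
    intro n
    have h1 := hsNorm_sub_le (hu n) (memHs_zero s) hv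
    have h2 := hsNorm_sub_comm (memHs_zero s) hv
    rw [sub_zero] at h1 h2
    rw [h2] at h1
    linarith [hA n]
  have hwweak : WeakTendsto (fun n => u n - v) 0 := by
    have := hweak.sub (weakTendsto_const v)
    rwa [sub_self] at this
  have hNi : ∀ {u : L2}, MemHs s u → Integrable (fun x => NC W (u x)) := h.integrable_NC
  have hz : ∀ (f : L2) (S : Set ℝ), ∫ x in S, |NC W (f x) - NC W ((0 : L2) x)| =
      ∫ x in S, |NC W (f x)| := by
    intro f S
    refine integral_congr_ae (ae_restrict_of_ae ?_)
    filter_upwards [Lp.coeFn_zero ℂ 2 (volume : Measure ℝ)] with x hx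
    rw [hx, Pi.zero_apply, h.NC_zero, sub_zero]
  -- A splitting of Brezis–Lieb type. On [-j,j] the pairs (u_n, v) and (u_n - v, 0) are both
  -- L²-close; off it the pairs (u_n, u_n - v) and (v, 0) are. The local Lipschitz estimate handles
  -- all four, with j chosen before n.
  have hbound : ∀ (n j : ℕ), |pot W (u n) - pot W v - pot W (u n - v)| ≤
      2 * C * Real.sqrt (∫ x in Icc (-(j : ℝ)) j, ‖(u n - v) x‖ ^ 2) +
        2 * C * Real.sqrt (∫ x in (Icc (-(j : ℝ)) j)ᶜ, ‖v x‖ ^ 2) := by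
    intro n j
    set S := Icc (-(j : ℝ)) j with hS
    have e1 : pot W (u n) - pot W v - pot W (u n - v) =
        ∫ x, (NC W (u n x) - NC W (v x) - NC W ((u n - v) x)) := by
      have h1 := integral_sub ((hNi (hu n)).sub (hNi hv)) (hNi (hw n))
      have h2 := integral_sub (hNi (hu n)) (hNi hv)
      simp only [Pi.sub_apply] at h1
      rw [h1, h2]
      rfl
    have hi : Integrable fun x => NC W (u n x) - NC W (v x) - NC W ((u n - v) x) :=
      ((hNi (hu n)).sub (hNi hv)).sub (hNi (hw n))
    rw [e1, ← integral_add_compl (measurableSet_Icc (a := -(j : ℝ)) (b := j)) hi]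
    refine (abs_add_le _ _).trans (add_le_add ?_ ?_)
    · refine (abs_integral_le_integral_abs).trans ?_
      have i1 : IntegrableOn (fun x => |NC W (u n x) - NC W (v x)|) S :=
        ((hNi (hu n)).sub (hNi hv)).abs.restrict
      have i2 : IntegrableOn (fun x => |NC W ((u n - v) x)|) S := (hNi (hw n)).abs.restrict
      have h1 : ∫ x in S, |NC W (u n x) - NC W (v x) - NC W ((u n - v) x)| ≤
          (∫ x in S, |NC W (u n x) - NC W (v x)|) + ∫ x in S, |NC W ((u n - v) x)| := by
        rw [← integral_add i1 i2]
        exact integral_mono hi.abs.restrict (i1.add i2) fun x => abs_sub _ _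
      have h2 := hlip (u n) v (hu n) hv ((hA n).trans (by linarith)) (by linarith) S
      have h3 := hlip (u n - v) 0 (hw n) (memHs_zero s) (hwA n) (by
        rw [hsNorm_zero]; linarith) S
      rw [hz, sub_zero] at h3
      linarith
    · refine (abs_integral_le_integral_abs).trans ?_
      have i1 : IntegrableOn (fun x => |NC W (u n x) - NC W ((u n - v) x)|) Sᶜ :=
        ((hNi (hu n)).sub (hNi (hw n))).abs.restrict
      have i2 : IntegrableOn (fun x => |NC W (v x)|) Sᶜ := (hNi hv).abs.restrict
      have h1 : ∫ x in Sᶜ, |NC W (u n x) - NC W (v x) - NC W ((u n - v) x)| ≤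
          (∫ x in Sᶜ, |NC W (u n x) - NC W ((u n - v) x)|) + ∫ x in Sᶜ, |NC W (v x)| := by
        rw [← integral_add i1 i2]
        refine integral_mono hi.abs.restrict (i1.add i2) fun x => ?_
        simp only
        rw [sub_right_comm]
        exact abs_sub _ _
      have h2 := hlip (u n) (u n - v) (hu n) (hw n) ((hA n).trans (by linarith)) (hwA n) Sᶜ
      have h3 := hlip v 0 hv (memHs_zero s) (by linarith) (by
        rw [hsNorm_zero]; linarith) Sᶜ
      rw [hz, sub_zero] at h3
      rw [sub_sub_cancel] at h2
      linarith
  refine Metric.tendsto_atTop.2 fun ε hε => ?_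
  have hsq : ∀ {f : ℕ → ℝ}, Tendsto f atTop (𝓝 0) →
      Tendsto (fun n => 2 * C * Real.sqrt (f n)) atTop (𝓝 0) := by
    intro f hf
    have := ((Real.continuous_sqrt.tendsto 0).comp hf).const_mul (2 * C)
    simpa using this
  obtain ⟨j, hj⟩ := ((hsq (tendsto_setIntegral_compl v)).eventually
    (gt_mem_nhds (half_pos hε))).exists
  obtain ⟨N, hN⟩ := eventually_atTop.1 ((hsq (tendsto_setIntegral_normSq h.pos hw hwA hwweak
    j)).eventually (gt_mem_nhds (half_pos hε)))
  refine ⟨N, fun n hn => ?_⟩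
  rw [Real.dist_eq, sub_zero]
  linarith [hbound n j, hN n hn]

/-- A minimizing sequence with nonzero weak limit converges strongly to a minimizer. -/
theorem Admissible.tendsto_of_weakTendsto {s p : ℝ} {m : ℕ} {W : ℂ → ℝ} (h : Admissible s p m W)
    {c : ℝ} (hc : 0 < c) {u : ℕ → L2} {v : L2} (hu : ∀ n, MemHs s (u n))
    (hv : MemHs s v) (hv0 : v ≠ 0) {A : ℝ} (hA : ∀ n, hsNorm s (u n) ≤ A)
    (hweak : WeakTendsto u v) (hweakD : WeakTendsto (fun n => fracD s (u n)) (fracD s v))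
    (hcharge : Tendsto (fun n => ‖u n‖ ^ 2) atTop (𝓝 c))
    (hJ : Tendsto (fun n => J s W (u n)) atTop (𝓝 (Jinf s W c))) :
    ‖v‖ ^ 2 = c ∧ J s W v = Jinf s W c ∧
      Tendsto (fun n => hsNorm s (u n - v)) atTop (𝓝 0) := by
  have hvn : 0 < ‖v‖ := norm_pos_iff.2 hv0
  have hw : ∀ n, MemHs s (u n - v) := fun n => (hu n).sub hv
  have hwc : Tendsto (fun n => ‖u n - v‖ ^ 2) atTop (𝓝 (c - ‖v‖ ^ 2)) := by
    have := (hcharge.sub_const (‖v‖ ^ 2)).sub hweak.normSq_sub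
    rw [sub_zero] at this
    refine this.congr fun n => ?_
    ring
  have hwD := hweakD.normSq_sub
  have hwp := h.pot_splitting hu hv hA hweak
  have hwJ : Tendsto (fun n => J s W (u n - v)) atTop (𝓝 (Jinf s W c - J s W v)) := by
    have := ((hJ.sub_const (J s W v)).sub (hwD.const_mul (1 / 2))).sub hwp
    rw [mul_zero, sub_zero, sub_zero] at this
    refine this.congr fun n => ?_
    rw [J, J, J, fracD_sub (hu n) hv]
    ring
  have hle : ‖v‖ ^ 2 ≤ c := by
    have := ge_of_tendsto' hwc fun n => sq_nonneg _
    linarith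
  -- The remainder u_n - v carries charge near c - ‖v‖² < c, so it costs at least its share of
  -- `Jinf`. In the limit J(v) is at most the share of v, which contradicts the strict inequality
  -- for v unless ‖v‖² = c.
  have hev : ∀ᶠ n in atTop, ‖u n - v‖ ^ 2 / c * Jinf s W c ≤ J s W (u n - v) := by
    have h1 : c - ‖v‖ ^ 2 < c := by
      have : 0 < ‖v‖ ^ 2 := by positivity
      linarith
    filter_upwards [hwc.eventually (gt_mem_nhds h1)] with n hn
    exact h.scale_le (hw n) hc hn.le
  have hlim := le_of_tendsto_of_tendsto ((hwc.div_const c).mul_const (Jinf s W c)) hwJ hev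
  have hJv : J s W v ≤ ‖v‖ ^ 2 / c * Jinf s W c := by
    have : (c - ‖v‖ ^ 2) / c * Jinf s W c = Jinf s W c - ‖v‖ ^ 2 / c * Jinf s W c := by
      field_simp
    linarith
  have heq : ‖v‖ ^ 2 = c := by
    by_contra hne
    exact absurd hJv (not_le.2 (h.scale_lt hv hv0 (lt_of_le_of_ne hle hne)))
  have hJeq : J s W v = Jinf s W c := by
    rw [heq, div_self hc.ne', one_mul] at hJv
    exact le_antisymm hJv (h.Jinf_le hv heq)
  refine ⟨heq, hJeq, ?_⟩
  rw [heq, sub_self] at hwc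
  rw [hJeq, sub_self] at hwJ
  have hwn : Tendsto (fun n => ‖u n - v‖) atTop (𝓝 0) := by
    have := (Real.continuous_sqrt.tendsto 0).comp hwc
    rw [Real.sqrt_zero] at this
    refine this.congr fun n => ?_
    simp [Real.sqrt_sq]
  have hA0 : 0 ≤ A := (hsNorm_nonneg _ _).trans (hA 0)
  -- The remainder now tends to 0 in L² and so does its `J`; its potential is L²-continuous, so its
  -- kinetic energy tends to 0 as well.
  have hpot : Tendsto (fun n => pot W (u n - v)) atTop (𝓝 0) := by
    obtain ⟨C, hC, hlip⟩ := h.pot_sub_le (A + hsNorm s v)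
    have h1 := hwn.const_mul C
    rw [mul_zero] at h1
    refine squeeze_zero_norm (fun n => ?_) h1
    have h2 := hlip (u n - v) 0 (hw n) (memHs_zero s) (by
      have h1 := hsNorm_sub_le (hu n) (memHs_zero s) hv
      have h2 := hsNorm_sub_comm (memHs_zero s) hv
      rw [sub_zero] at h1 h2
      rw [h2] at h1
      linarith [hA n]) (by
      rw [hsNorm_zero]; linarith [hsNorm_nonneg s v])
    rwa [h.pot_zero, sub_zero, sub_zero] at h2
  have hD : Tendsto (fun n => ‖fracD s (u n - v)‖ ^ 2) atTop (𝓝 0) := by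
    have := (hwJ.sub hpot).const_mul 2
    rw [sub_zero, mul_zero] at this
    refine this.congr fun n => ?_
    rw [J]
    ring
  have := (Real.continuous_sqrt.tendsto 0).comp (by simpa using hwc.add hD :
    Tendsto (fun n => ‖u n - v‖ ^ 2 + ‖fracD s (u n - v)‖ ^ 2) atTop (𝓝 0))
  rw [Real.sqrt_zero] at this
  exact this

theorem Admissible.bounded_of_J_le {s p : ℝ} {m : ℕ} {W : ℂ → ℝ} (h : Admissible s p m W)
    (B M : ℝ) : ∃ A : ℝ, 0 < A ∧ ∀ u : L2, MemHs s u → ‖u‖ ^ 2 ≤ B → J s W u ≤ M →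
      hsNorm s u ≤ A := by
  obtain ⟨K, hK, hco⟩ := h.coercive (B := |B| + 1) (by positivity)
  refine ⟨Real.sqrt (|B| + 4 * (|M| + K)) + 1, by positivity, fun u hu hB hM => ?_⟩
  have h0 : ‖u‖ ≤ |B| + 1 := by
    nlinarith [le_abs_self B, abs_nonneg B, norm_nonneg u, sq_nonneg (‖u‖ - 1)]
  have h1 := hco u hu h0
  have h2 : hsNorm s u ≤ Real.sqrt (|B| + 4 * (|M| + K)) := by
    refine Real.sqrt_le_sqrt ?_
    linarith [le_abs_self B, le_abs_self M]
  linarith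

/-- Minimizing sequences are compact up to translations. -/
theorem Admissible.minimizing_compact {s p : ℝ} {m : ℕ} {W : ℂ → ℝ} (h : Admissible s p m W)
    {c : ℝ} (hc : 0 < c) (hneg : Jinf s W c < 0) {u : ℕ → L2} (hu : ∀ n, MemHs s (u n))
    (hcharge : Tendsto (fun n => ‖u n‖ ^ 2) atTop (𝓝 c))
    (hJ : Tendsto (fun n => J s W (u n)) atTop (𝓝 (Jinf s W c))) :
    ∃ (k : ℕ → ℕ) (τ : ℕ → ℝ) (v : L2), StrictMono k ∧ MemHs s v ∧ ‖v‖ ^ 2 = c ∧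
      J s W v = Jinf s W c ∧
      Tendsto (fun n => hsNorm s (translate (τ n) (u (k n)) - v)) atTop (𝓝 0) := by
  obtain ⟨B, hB⟩ := hcharge.bddAbove_range
  obtain ⟨M, hM⟩ := hJ.bddAbove_range
  have hB' : ∀ n, ‖u n‖ ^ 2 ≤ B := fun n => hB ⟨n, rfl⟩
  have hM' : ∀ n, J s W (u n) ≤ M := fun n => hM ⟨n, rfl⟩
  obtain ⟨A, hA0, hA⟩ := h.bounded_of_J_le B M
  have hA' : ∀ n, hsNorm s (u n) ≤ A := fun n => hA _ (hu n) (hB' n) (hM' n)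
  have hB0 : 0 ≤ B := (sq_nonneg _).trans (hB' 0)
  -- the sequence does not vanish
  set ε := -Jinf s W c / (4 * (B + 1)) with hε
  have hε0 : 0 < ε := div_pos (by linarith) (by positivity)
  obtain ⟨C, hC, hsm⟩ := h.small ε hε0
  set η := -Jinf s W c / (4 * (C + 1)) with hη
  have hη0 : 0 < η := div_pos (by linarith) (by positivity)
  have hk : 3 ≤ m + 1 := by have := h.two_le; omega
  obtain ⟨C', -, hb⟩ := integral_pow_le_hsNorm h.half_le (k := m + 1) (by omega)
  -- Eventually J(u_n) < Jinf/2, hence -∫N(|u_n|) > |Jinf|/2. The quadratic part of the bound on N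
  -- takes at most |Jinf|/4 by the choice of ε; the rest must come from the power m+1.
  have hlow : ∀ᶠ n in atTop, η ≤ ∫ x, ‖u n x‖ ^ (m + 1) := by
    have h1 : Jinf s W c < Jinf s W c / 2 := by linarith
    filter_upwards [hJ.eventually (gt_mem_nhds h1)] with n hn
    have h2 : -∫ x, (ε * ‖u n x‖ ^ 2 + C * ‖u n x‖ ^ (m + 1)) ≤ pot W (u n) := by
      rw [← integral_neg]
      exact integral_mono (((integrable_normSq _).const_mul _).add
        ((hb _ (hu n)).1.const_mul _)).neg (h.integrable_NC (hu n))
        fun x => (abs_le.1 (hsm (u n x))).1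
    rw [integral_add ((integrable_normSq _).const_mul _) ((hb _ (hu n)).1.const_mul _),
      integral_const_mul, integral_const_mul, ← normSq_eq_integral] at h2
    have h3 : pot W (u n) ≤ J s W (u n) := by
      unfold J
      nlinarith [sq_nonneg ‖fracD s (u n)‖]
    have h4 : ε * ‖u n‖ ^ 2 ≤ -Jinf s W c / 4 := by
      have h5 : ε * (4 * (B + 1)) = -Jinf s W c := by rw [hε]; field_simp
      nlinarith [hB' n]
    have h6 : 0 ≤ ∫ x, ‖u n x‖ ^ (m + 1) := integral_nonneg fun x => by positivity
    rw [hη, div_le_iff₀ (by positivity)]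
    nlinarith
  obtain ⟨n₀, hn₀⟩ := eventually_atTop.1 hlow
  obtain ⟨R, η', hη', hloc⟩ := exists_translate_inner_ge h.half_le hk A hη0
  have hy : ∀ n, ∃ y : ℝ, η' ≤ ‖(inner ℂ (kern R) (translate (-y) (u (n + n₀))) : ℂ)‖ :=
    fun n => hloc _ (hu _) (hA' _) (hn₀ _ (by omega))
  choose y hy using hy
  set z : ℕ → L2 := fun n => translate (-(y n)) (u (n + n₀)) with hz
  have hzm : ∀ n, MemHs s (z n) := fun n => (hu _).translate _
  have hzA : ∀ n, hsNorm s (z n) ≤ A := fun n => by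
    rw [hz, hsNorm_translate (hu _)]; exact hA' _
  obtain ⟨k, v, hk, hv, hweak, hweakD⟩ := exists_weak_subseq_hs h.pos.le hzm hzA
  -- The lower bound on the pairing with the fixed kernel passes to the weak limit.
  have hv0 : v ≠ 0 := by
    rintro rfl
    have h1 := (hweak (kern R)).norm
    rw [inner_zero_right, norm_zero] at h1
    exact absurd (ge_of_tendsto' h1 fun n => hy (k n)) (not_le.2 hη')
  have hsub : Tendsto (fun n => k n + n₀) atTop atTop :=
    tendsto_atTop_mono (fun n => Nat.le_add_right _ _) hk.tendsto_atTop
  obtain ⟨e1, e2, e3⟩ := h.tendsto_of_weakTendsto hc (fun n => hzm (k n)) hv hv0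
    (fun n => hzA (k n)) hweak hweakD (by
      refine (hcharge.comp hsub).congr fun n => ?_
      simp only [hz, Function.comp, norm_translate]) (by
      refine (hJ.comp hsub).congr fun n => ?_
      simp only [hz, Function.comp, J_translate W (hu _)])
  exact ⟨fun n => k n + n₀, fun n => -(y (k n)), v, fun a b hab =>
    Nat.add_lt_add_right (hk hab) n₀, hv, e1, e2, e3⟩

/-! ### The Euler–Lagrange equation -/

open Classical in
/-- The superposition operator `u ↦ W'(u)`. -/
def gradL2 (W : ℂ → ℝ) (u : L2) : L2 :=
  if h : MemLp (fun x => cgrad W (u x)) 2 (volume : Measure ℝ) then h.toLp _ else 0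

theorem Admissible.continuous_cgrad {s p : ℝ} {m : ℕ} {W : ℂ → ℝ} (h : Admissible s p m W) :
    Continuous (cgrad W) := by
  have h1 : Continuous (fderiv ℝ W) := h.contDiff.continuous_fderiv (by norm_num)
  unfold cgrad
  fun_prop

theorem Admissible.memLp_cgrad {s p : ℝ} {m : ℕ} {W : ℂ → ℝ} (h : Admissible s p m W) {u : L2}
    (hu : MemHs s u) : MemLp (fun x => cgrad W (u x)) 2 (volume : Measure ℝ) := by
  obtain ⟨C, hC, hb⟩ := h.grad_le
  obtain ⟨C₂, -, hg⟩ := memLp_growth h.half_le (m := m) (by have := h.two_le; omega)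
  refine (hg u hu).1.of_le_mul
    (h.continuous_cgrad.comp_aestronglyMeasurable (Lp.aestronglyMeasurable u)) (c := C)
    (ae_of_all _ fun x => ?_)
  rw [Real.norm_of_nonneg (by positivity)]
  exact hb _

theorem Admissible.gradL2_coeFn {s p : ℝ} {m : ℕ} {W : ℂ → ℝ} (h : Admissible s p m W) {u : L2}
    (hu : MemHs s u) : gradL2 W u =ᵐ[volume] fun x => cgrad W (u x) := by
  rw [gradL2, dif_pos (h.memLp_cgrad hu)]
  exact MemLp.coeFn_toLp _

theorem Admissible.norm_gradL2_le {s p : ℝ} {m : ℕ} {W : ℂ → ℝ} (h : Admissible s p m W) (A : ℝ) :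
    ∃ C : ℝ, 0 ≤ C ∧ ∀ u : L2, MemHs s u → hsNorm s u ≤ A → ‖gradL2 W u‖ ≤ C := by
  obtain ⟨C, hC, hb⟩ := h.grad_le
  obtain ⟨C₂, hC₂, hg⟩ := memLp_growth h.half_le (m := m) (by have := h.two_le; omega)
  refine ⟨Real.sqrt (C ^ 2 * (C₂ * (A ^ 2 + A ^ (2 * m)))), Real.sqrt_nonneg _,
    fun u hu huA => Real.le_sqrt_of_sq_le ?_⟩
  obtain ⟨h1, h2⟩ := hg u hu
  have hi := (memLp_two_iff_integrable_sq h1.1).1 h1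
  have h3 : ‖gradL2 W u‖ ^ 2 ≤ C ^ 2 * ∫ x, (‖u x‖ + ‖u x‖ ^ m) ^ 2 := by
    rw [normSq_eq_integral, ← integral_const_mul]
    refine integral_mono_ae (integrable_normSq _) (hi.const_mul _) ?_
    filter_upwards [h.gradL2_coeFn hu] with x hx
    rw [hx, ← mul_pow]
    exact pow_le_pow_left₀ (norm_nonneg _) (hb _) 2
  refine h3.trans ?_
  have h4 := hsNorm_nonneg s u
  have h5 : hsNorm s u ^ 2 + hsNorm s u ^ (2 * m) ≤ A ^ 2 + A ^ (2 * m) := by gcongr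
  have h6 : C₂ * (hsNorm s u ^ 2 + hsNorm s u ^ (2 * m)) ≤ C₂ * (A ^ 2 + A ^ (2 * m)) := by gcongr
  exact mul_le_mul_of_nonneg_left (h2.trans h6) (sq_nonneg C)

theorem Admissible.rhsPairing_eq {s p : ℝ} {m : ℕ} {W : ℂ → ℝ} (h : Admissible s p m W)
    (φ : L2) {u : L2} (hu : MemHs s u) :
    rhsPairing s W φ u = 1 / 2 * inner ℂ (fracD (2 * s) φ) u + 1 / 2 * inner ℂ φ (gradL2 W u) := by
  rw [rhsPairing, inner_eq_integral φ]
  congr 2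
  refine integral_congr_ae ?_
  filter_upwards [h.gradL2_coeFn hu] with x hx
  rw [hx]

theorem coeFn_add_smul (a b : ℂ) (u v : L2) :
    (a • u + b • v : L2) =ᵐ[volume] fun x => a * u x + b * v x := by
  filter_upwards [Lp.coeFn_add (a • u) (b • v), Lp.coeFn_smul a u, Lp.coeFn_smul b v]
    with x h1 h2 h3
  rw [h1, Pi.add_apply, h2, h3]
  rfl

/-- Derivative of the potential energy along a great circle. -/
theorem Admissible.hasDerivAt_integral_W {s p : ℝ} {m : ℕ} {W : ℂ → ℝ} (h : Admissible s p m W)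
    {v w : L2} (hv : MemHs s v) (hw : MemHs s w) :
    HasDerivAt (fun t : ℝ => ∫ x, W ((Real.cos t : ℂ) * v x + (Real.sin t : ℂ) * w x))
      (inner ℂ (gradL2 W v) w : ℂ).re 0 := by
  obtain ⟨C, hC, hb⟩ := h.grad_le
  obtain ⟨C', -, hk⟩ := integral_pow_le_hsNorm h.half_le (k := m + 1) (by have := h.two_le; omega)
  set z : ℝ → ℝ → ℂ := fun t x => (Real.cos t : ℂ) * v x + (Real.sin t : ℂ) * w x with hz
  set z' : ℝ → ℝ → ℂ := fun t x => -(Real.sin t : ℂ) * v x + (Real.cos t : ℂ) * w x with hz'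
  set g : ℝ → ℝ := fun x => ‖v x‖ + ‖w x‖ with hg
  have hzm : ∀ t, AEStronglyMeasurable (z t) volume := fun t =>
    ((Lp.aestronglyMeasurable v).const_mul _).add ((Lp.aestronglyMeasurable w).const_mul _)
  have hbd : ∀ (a b : ℝ) (x : ℝ), |a| ≤ 1 → |b| ≤ 1 → ‖(a : ℂ) * v x + (b : ℂ) * w x‖ ≤ g x := by
    intro a b x ha hb'
    refine (norm_add_le _ _).trans ?_
    rw [norm_mul, norm_mul, Complex.norm_real, Complex.norm_real, Real.norm_eq_abs,
      Real.norm_eq_abs]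
    exact add_le_add (mul_le_of_le_one_left (norm_nonneg _) ha)
      (mul_le_of_le_one_left (norm_nonneg _) hb')
  have hg0 : ∀ x, 0 ≤ g x := fun x => by positivity
  have hzg : ∀ t x, ‖z t x‖ ≤ g x := fun t x =>
    hbd _ _ x (Real.abs_cos_le_one t) (Real.abs_sin_le_one t)
  have hzg' : ∀ t x, ‖z' t x‖ ≤ g x := by
    intro t x
    have := hbd (-Real.sin t) (Real.cos t) x (by rw [abs_neg]; exact Real.abs_sin_le_one t)
      (Real.abs_cos_le_one t)
    rwa [Complex.ofReal_neg] at this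
  have hgm : AEStronglyMeasurable g volume :=
    (Lp.aestronglyMeasurable v).norm.add (Lp.aestronglyMeasurable w).norm
  have hgi : ∀ k : ℕ, 2 ≤ k → Integrable fun x => g x ^ k := by
    intro k hk2
    obtain ⟨C'', -, hk'⟩ := integral_pow_le_hsNorm h.half_le hk2
    refine (((hk' v hv).1.add (hk' w hw).1).const_mul (2 ^ (k - 1))).mono' (hgm.pow k)
      (ae_of_all _ fun x => ?_)
    have := hg0 x
    rw [Real.norm_of_nonneg (by positivity)]
    exact add_pow_le (norm_nonneg _) (norm_nonneg _) k
  have hbound : Integrable fun x => C * (g x ^ 2 + g x ^ (m + 1)) :=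
    ((hgi 2 le_rfl).add (hgi (m + 1) (by have := h.two_le; omega))).const_mul C
  have hder : ∀ t x, HasDerivAt (fun t => W (z t x)) (fderiv ℝ W (z t x) (z' t x)) t := by
    intro t x
    have h1 : HasDerivAt (fun t => z t x) (z' t x) t := by
      have hc := ((Complex.ofRealCLM.hasFDerivAt (x := Real.cos t)).comp_hasDerivAt t
        (Real.hasDerivAt_cos t)).mul_const (v x)
      have hs := ((Complex.ofRealCLM.hasFDerivAt (x := Real.sin t)).comp_hasDerivAt t
        (Real.hasDerivAt_sin t)).mul_const (w x)
      have := hc.add hs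
      simp only [Complex.ofRealCLM_apply, Complex.ofReal_neg] at this
      exact this
    exact (h.differentiable (z t x)).hasFDerivAt.comp_hasDerivAt t h1
  have hz0 : ∀ x, z 0 x = v x := fun x => by simp [hz]
  have hz0' : ∀ x, z' 0 x = w x := fun x => by simp [hz']
  have hWi : Integrable fun x => W (z 0 x) := by
    simp_rw [hz0]
    have h1 : (fun x => W (v x)) = fun x => NC W (v x) + E₀ W * ‖v x‖ ^ 2 := by
      ext x; simp [NC]
    rw [h1]
    exact (h.integrable_NC hv).add ((integrable_normSq v).const_mul _)
  -- As |cos|, |sin| ≤ 1, both the curve and its velocity are bounded by g = |v|+|w| for every t, so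
  -- one integrable function dominates the derivative for all times.
  have key := hasDerivAt_integral_of_dominated_loc_of_deriv_le (μ := (volume : Measure ℝ))
    (F := fun t x => W (z t x)) (F' := fun t x => fderiv ℝ W (z t x) (z' t x)) (x₀ := (0 : ℝ))
    (s := univ) (bound := fun x => C * (g x ^ 2 + g x ^ (m + 1))) univ_mem
    (Eventually.of_forall fun t => h.contDiff.continuous.comp_aestronglyMeasurable (hzm t)) hWi
    (by
      simp_rw [hz0, hz0', fderiv_eq_re_cgrad]
      exact Complex.continuous_re.comp_aestronglyMeasurable
        ((Complex.continuous_conj.comp_aestronglyMeasurable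
          (h.continuous_cgrad.comp_aestronglyMeasurable (Lp.aestronglyMeasurable v))).mul
          (Lp.aestronglyMeasurable w)))
    (ae_of_all _ fun x t _ => by
      rw [fderiv_eq_re_cgrad, Real.norm_eq_abs]
      refine (Complex.abs_re_le_norm _).trans ?_
      rw [norm_mul, RCLike.norm_conj]
      have h1 := hg0 x
      have h2 : ‖cgrad W (z t x)‖ ≤ C * (g x + g x ^ m) := by
        refine (hb _).trans ?_
        have := hzg t x
        gcongr
      calc _ ≤ C * (g x + g x ^ m) * g x := by
            gcongr
            exact hzg' t x
        _ = _ := by ring)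
    hbound (ae_of_all _ fun x t _ => hder t x)
  convert! key.2 using 1
  rw [inner_eq_integral, ← Complex.reCLM_apply,
    ← ContinuousLinearMap.integral_comp_comm _ (integrable_conj_mul _ _)]
  refine integral_congr_ae ?_
  filter_upwards [h.gradL2_coeFn hv] with x hx
  rw [hz0, hz0', fderiv_eq_re_cgrad, hx, Complex.reCLM_apply]

/-- `v` minimizes `J` among the states of charge `c`. -/
structure IsMinimizer (s : ℝ) (W : ℂ → ℝ) (c : ℝ) (v : L2) : Prop where
  memHs : MemHs s v
  charge : ‖v‖ ^ 2 = c
  eq_inf : J s W v = Jinf s W c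

theorem re_inner_comm (u v : L2) : (inner ℂ u v : ℂ).re = (inner ℂ v u : ℂ).re :=
  inner_re_symm (𝕜 := ℂ) u v

theorem normSq_cos_sin (t : ℝ) (a b : L2) :
    ‖(Real.cos t : ℂ) • a + (Real.sin t : ℂ) • b‖ ^ 2 = Real.cos t ^ 2 * ‖a‖ ^ 2 +
      2 * (Real.cos t * Real.sin t) * (inner ℂ a b : ℂ).re + Real.sin t ^ 2 * ‖b‖ ^ 2 := by
  have h := norm_add_sq (𝕜 := ℂ) ((Real.cos t : ℂ) • a) ((Real.sin t : ℂ) • b)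
  rw [h, inner_smul_left, inner_smul_right, norm_smul, norm_smul, mul_pow, mul_pow,
    Complex.norm_real, Complex.norm_real, Real.norm_eq_abs, Real.norm_eq_abs, sq_abs, sq_abs,
    Complex.conj_ofReal, ← mul_assoc, ← Complex.ofReal_mul]
  have : RCLike.re (((Real.cos t * Real.sin t : ℝ) : ℂ) * inner ℂ a b) =
    (Real.cos t * Real.sin t) * (inner ℂ a b : ℂ).re := Complex.re_ofReal_mul _ _
  rw [this]
  ring

/-- The differential of the energy at `v`, in the direction `w`. -/
def dE (s : ℝ) (W : ℂ → ℝ) (v w : L2) : ℝ :=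
  (inner ℂ (fracD s v) (fracD s w) : ℂ).re + (inner ℂ (gradL2 W v) w : ℂ).re

theorem dE_smul {s : ℝ} (W : ℂ → ℝ) (v : L2) {w : L2} (hw : MemHs s w) (a : ℝ) :
    dE s W v ((a : ℂ) • w) = a * dE s W v w := by
  rw [dE, dE, fracD_smul _ hw, inner_smul_right, inner_smul_right, Complex.re_ofReal_mul,
    Complex.re_ofReal_mul]
  ring

theorem dE_add {s : ℝ} (W : ℂ → ℝ) (v : L2) {w w' : L2} (hw : MemHs s w) (hw' : MemHs s w') :
    dE s W v (w + w') = dE s W v w + dE s W v w' := by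
  rw [dE, dE, dE, fracD_add hw hw', inner_add_right, inner_add_right, Complex.add_re,
    Complex.add_re]
  ring

/-- For w orthogonal to v and of the same norm, the great circle cos t·v + sin t·w stays exactly on
the sphere of charge c. The energy along it is minimal at t = 0. -/
theorem Admissible.dE_eq_zero {s p : ℝ} {m : ℕ} {W : ℂ → ℝ} (h : Admissible s p m W) {c : ℝ}
    {v w : L2} (hv : IsMinimizer s W c v) (hw : MemHs s w) (hnorm : ‖w‖ ^ 2 = c)
    (horth : (inner ℂ v w : ℂ).re = 0) : dE s W v w = 0 := by
  set q : ℝ → L2 := fun t => (Real.cos t : ℂ) • v + (Real.sin t : ℂ) • w with hq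
  have hqm : ∀ t, MemHs s (q t) := fun t => (hv.memHs.smul _).add (hw.smul _)
  have hqn : ∀ t, ‖q t‖ ^ 2 = c := by
    intro t
    rw [hq, normSq_cos_sin, horth, hv.charge, hnorm]
    have := Real.sin_sq_add_cos_sq t
    linear_combination c * this
  have hEn : ∀ t, energy s W (q t) = 1 / 2 * (Real.cos t ^ 2 * ‖fracD s v‖ ^ 2 +
      2 * (Real.cos t * Real.sin t) * (inner ℂ (fracD s v) (fracD s w) : ℂ).re +
      Real.sin t ^ 2 * ‖fracD s w‖ ^ 2) +
        ∫ x, W ((Real.cos t : ℂ) * v x + (Real.sin t : ℂ) * w x) := by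
    intro t
    rw [energy, hq, fracD_add (hv.memHs.smul _) (hw.smul _), fracD_smul _ hv.memHs,
      fracD_smul _ hw, normSq_cos_sin]
    congr 1
    refine integral_congr_ae ?_
    filter_upwards [coeFn_add_smul (Real.cos t : ℂ) (Real.sin t : ℂ) v w] with x hx
    rw [hx]
  have hmin : IsLocalMin (fun t => energy s W (q t)) 0 := by
    refine Eventually.of_forall fun t => ?_
    have h0 : q 0 = v := by simp [hq]
    simp only [h0]
    rw [h.energy_eq hv.memHs, h.energy_eq (hqm t), hqn, hv.charge, hv.eq_inf]
    linarith [h.Jinf_le (hqm t) (hqn t)]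
  have hder : HasDerivAt (fun t => energy s W (q t)) (dE s W v w) 0 := by
    simp_rw [hEn]
    have hc := Real.hasDerivAt_cos 0
    have hs := Real.hasDerivAt_sin 0
    have h1 := ((((hc.pow 2).mul_const (‖fracD s v‖ ^ 2)).add
      (((hc.mul hs).const_mul 2).mul_const (inner ℂ (fracD s v) (fracD s w) : ℂ).re)).add
        ((hs.pow 2).mul_const (‖fracD s w‖ ^ 2))).const_mul (1 / 2)
    have h2 := h1.add (h.hasDerivAt_integral_W hv.memHs hw)
    convert! h2 using 1
    simp [dE]
  exact hmin.hasDerivAt_eq_zero hder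

/-- The Lagrange multiplier. -/
def multiplier (s : ℝ) (W : ℂ → ℝ) (c : ℝ) (v : L2) : ℝ := dE s W v v / (2 * c)

/-- Removing the real component of w along v leaves an orthogonal vector; once rescaled to norm √c
it is an admissible direction, and linearity gives the multiplier. -/
theorem Admissible.dE_eq {s p : ℝ} {m : ℕ} {W : ℂ → ℝ} (h : Admissible s p m W) {c : ℝ}
    (hc : 0 < c) {v w : L2} (hv : IsMinimizer s W c v) (hw : MemHs s w) :
    dE s W v w = 2 * multiplier s W c v * (inner ℂ v w : ℂ).re := by
  set a : ℝ := (inner ℂ v w : ℂ).re / c with ha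
  set w' : L2 := w + ((-a : ℝ) : ℂ) • v with hw'
  have hwm : MemHs s w' := hw.add (hv.memHs.smul _)
  have hvv : (inner ℂ v v : ℂ).re = c := by
    rw [← hv.charge]
    exact inner_self_eq_norm_sq (𝕜 := ℂ) v
  have horth : (inner ℂ v w' : ℂ).re = 0 := by
    rw [hw', inner_add_right, inner_smul_right, Complex.add_re, Complex.re_ofReal_mul, hvv, ha]
    field_simp
    ring
  have h0 : dE s W v w' = 0 := by
    rcases eq_or_ne w' 0 with h0 | h0
    · rw [h0]
      simp [dE, fracD_zero]
    · have hn : 0 < ‖w'‖ := norm_pos_iff.2 h0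
      set b : ℝ := Real.sqrt c / ‖w'‖ with hb
      have hb0 : 0 < b := by positivity
      have h1 := h.dE_eq_zero hv (hwm.smul (b : ℂ)) (by
        rw [norm_smul, Complex.norm_real, Real.norm_of_nonneg hb0.le, hb,
          div_mul_cancel₀ _ hn.ne', Real.sq_sqrt hc.le]) (by
        rw [inner_smul_right, Complex.re_ofReal_mul, horth, mul_zero])
      rw [dE_smul W v hwm] at h1
      exact (mul_eq_zero.1 h1).resolve_left hb0.ne'
  rw [hw', dE_add W v hw (hv.memHs.smul _), dE_smul W v hv.memHs] at h0
  rw [multiplier]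
  have : dE s W v w = a * dE s W v v := by linarith
  rw [this, ha]
  field_simp

theorem Admissible.euler_lagrange {s p : ℝ} {m : ℕ} {W : ℂ → ℝ} (h : Admissible s p m W) {c : ℝ}
    (hc : 0 < c) {v w : L2} (hv : IsMinimizer s W c v) (hw : MemHs s w) :
    (inner ℂ (fracD s w) (fracD s v) : ℂ) + inner ℂ w (gradL2 W v) =
      2 * multiplier s W c v * inner ℂ w v := by
  have h1 : ∀ w : L2, MemHs s w → (((inner ℂ (fracD s w) (fracD s v) : ℂ) +
      inner ℂ w (gradL2 W v) - 2 * multiplier s W c v * inner ℂ w v)).re = 0 := by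
    intro w hw
    have h2 := h.dE_eq hc hv hw
    rw [dE, re_inner_comm _ (fracD s w), re_inner_comm _ w, re_inner_comm v] at h2
    rw [Complex.sub_re, Complex.add_re, h2, show (2 : ℂ) * (multiplier s W c v : ℂ) =
      ((2 * multiplier s W c v : ℝ) : ℂ) by push_cast; ring, Complex.re_ofReal_mul, sub_self]
  have h3 := h1 w hw
  -- Variations are real, so they give only the real part; the direction iw gives the imaginary
  -- part.
  have h4 := h1 (Complex.I • w) (hw.smul _)
  rw [fracD_smul _ hw, inner_smul_left, inner_smul_left, inner_smul_left, Complex.conj_I] at h4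
  rw [← sub_eq_zero]
  refine Complex.ext h3 ?_
  rw [show -Complex.I * (inner ℂ (fracD s w) (fracD s v) : ℂ) +
      -Complex.I * inner ℂ w (gradL2 W v) - 2 * multiplier s W c v * (-Complex.I * inner ℂ w v) =
      -Complex.I * ((inner ℂ (fracD s w) (fracD s v) : ℂ) + inner ℂ w (gradL2 W v) -
        2 * multiplier s W c v * inner ℂ w v) by ring] at h4
  simpa using h4

/-- Minimizers satisfy the stationary equation, and have two times as many derivatives. -/
theorem Admissible.hasD_minimizer {s p : ℝ} {m : ℕ} {W : ℂ → ℝ} (h : Admissible s p m W) {c : ℝ}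
    (hc : 0 < c) {v : L2} (hv : IsMinimizer s W c v) :
    HasD (2 * s) v (((2 * multiplier s W c v : ℝ) : ℂ) • v - gradL2 W v) := by
  have hs := h.pos.le
  -- Band limited functions lie in every H^a, so one factor D^s of the weak equation can be moved
  -- onto them. All other terms are in L², which shows at once the regularity and the equation.
  refine hasD_of_inner (by linarith : 0 ≤ 2 * s) fun R φ => ?_
  have h1 := hasD_lowpass hs R φ
  have h2 := h1.comp (hasD_lowpass (by linarith : 0 ≤ 2 * s) R φ)
  rw [h2.inner_symm hv.memHs.hasD, inner_sub_right, inner_smul_right, eq_sub_iff_add_eq]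
  have h3 := h.euler_lagrange hc hv h1.memHs
  rw [h1.fracD_eq] at h3
  rw [h3]
  push_cast
  ring

theorem Admissible.isWeakStationary {s p : ℝ} {m : ℕ} {W : ℂ → ℝ} (h : Admissible s p m W) {c : ℝ}
    (hc : 0 < c) {v : L2} (hv : IsMinimizer s W c v) :
    IsWeakStationary s W (multiplier s W c v) v := by
  intro φ hφ
  have hs := h.pos.le
  have h1 : MemHs (2 * s) φ := hφ.memHs (by linarith)
  rw [h.rhsPairing_eq φ hv.memHs, h1.hasD.inner_symm (h.hasD_minimizer hc hv), inner_sub_right,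
    inner_smul_right]
  push_cast
  ring

/-- Uniform bounds for the minimizers of a given charge. -/
theorem Admissible.minimizer_bounded {s p : ℝ} {m : ℕ} {W : ℂ → ℝ} (h : Admissible s p m W)
    {c : ℝ} (hc : 0 < c) : ∃ A M : ℝ, 0 < A ∧ 0 < M ∧ ∀ v : L2, IsMinimizer s W c v →
      hsNorm s v ≤ A ∧ ∀ᵐ x, ‖v x‖ ≤ M := by
  obtain ⟨A, hA, hbA⟩ := h.bounded_of_J_le c (Jinf s W c)
  obtain ⟨G, hG, hbG⟩ := h.norm_gradL2_le A
  -- Here s ≥ 1/2 enters: H^(2s) embeds in L^∞. The H^(2s) norm is read off the equation, with Ω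
  -- bounding the multiplier through |dE(v)(v)| ≤ A·A + G·A.
  obtain ⟨C, hC, hbC⟩ := ae_norm_le_of_memHs (a := 2 * s) (by linarith [h.half_le])
  set Ω := (A * A + G * A) / (2 * c) with hΩ
  refine ⟨A, C * (A + (2 * Ω * A + G)), hA, by positivity, fun v hv => ?_⟩
  have hvA := hbA v hv.memHs hv.charge.le hv.eq_inf.le
  refine ⟨hvA, ?_⟩
  have hvG := hbG v hv.memHs hvA
  have hn := (norm_le_hsNorm s v).trans hvA
  have hd := (norm_fracD_le_hsNorm s v).trans hvA
  have hω : |multiplier s W c v| ≤ Ω := by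
    rw [multiplier, abs_div, abs_of_pos (by positivity : 0 < 2 * c), hΩ]
    refine div_le_div_of_nonneg_right ?_ (by positivity)
    rw [dE]
    refine (abs_add_le _ _).trans (add_le_add ?_ ?_)
    · refine (Complex.abs_re_le_norm _).trans ((norm_inner_le_norm _ _).trans ?_)
      gcongr
    · refine (Complex.abs_re_le_norm _).trans ((norm_inner_le_norm _ _).trans ?_)
      gcongr
  have hD := h.hasD_minimizer hc hv
  filter_upwards [hbC v hD.memHs] with x hx
  refine hx.trans ?_
  have h1 := hsNorm_le_add (2 * s) v
  rw [hD.fracD_eq] at h1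
  have h2 : ‖((2 * multiplier s W c v : ℝ) : ℂ) • v - gradL2 W v‖ ≤ 2 * Ω * A + G := by
    refine (norm_sub_le _ _).trans (add_le_add ?_ hvG)
    rw [norm_smul, Complex.norm_real, Real.norm_eq_abs, abs_mul, abs_two]
    gcongr
  gcongr
  linarith

/-! ### Symmetries, standing waves, and stability of the set of minimizers -/

theorem J_smul {s p : ℝ} {m : ℕ} {W : ℂ → ℝ} (h : Admissible s p m W) {c : ℂ} (hc : ‖c‖ = 1)
    {u : L2} (hu : MemHs s u) : J s W (c • u) = J s W u := by
  rw [J, J, fracD_smul c hu, norm_smul, hc, one_mul, pot, pot]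
  congr 1
  refine integral_congr_ae ?_
  filter_upwards [Lp.coeFn_smul c u] with x hx
  rw [hx, Pi.smul_apply, smul_eq_mul, NC, NC, h.radial, norm_mul, hc, one_mul, ← h.radial]

theorem IsMinimizer.translate {s c : ℝ} {W : ℂ → ℝ} {v : L2} (hv : IsMinimizer s W c v) (τ : ℝ) :
    IsMinimizer s W c (translate τ v) :=
  ⟨hv.memHs.translate τ, by rw [norm_translate, hv.charge],
    by rw [J_translate W hv.memHs, hv.eq_inf]⟩

theorem Admissible.isMinimizer_smul {s p : ℝ} {m : ℕ} {W : ℂ → ℝ} (h : Admissible s p m W)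
    {a : ℂ} (ha : ‖a‖ = 1) {c : ℝ} {v : L2} (hv : IsMinimizer s W c v) :
    IsMinimizer s W c (a • v) :=
  ⟨hv.memHs.smul a, by rw [norm_smul, ha, one_mul, hv.charge],
    by rw [J_smul h ha hv.memHs, hv.eq_inf]⟩

theorem Admissible.gradL2_smul {s p : ℝ} {m : ℕ} {W : ℂ → ℝ} (h : Admissible s p m W)
    {a : ℂ} (ha : ‖a‖ = 1) {v : L2} (hv : MemHs s v) : gradL2 W (a • v) = a • gradL2 W v := by
  refine Lp.ext ?_
  filter_upwards [h.gradL2_coeFn hv, h.gradL2_coeFn (hv.smul a), Lp.coeFn_smul a v,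
    Lp.coeFn_smul a (gradL2 W v)] with x h1 h2 h3 h4
  rw [h2, h4, h3, Pi.smul_apply, Pi.smul_apply, h1, smul_eq_mul, smul_eq_mul,
    cgrad_rotate h.differentiable h.radial ha]

theorem norm_cexp_neg_I_mul (ω t : ℝ) : ‖Complex.exp (-Complex.I * (ω : ℂ) * (t : ℂ))‖ = 1 := by
  rw [show -Complex.I * (ω : ℂ) * (t : ℂ) = ((-(ω * t) : ℝ) : ℂ) * Complex.I by push_cast; ring]
  exact Complex.norm_exp_ofReal_mul_I _

theorem hasDerivAt_cexp_neg_I_mul (a : ℂ) (t : ℝ) :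
    HasDerivAt (fun t : ℝ => Complex.exp (-Complex.I * a * (t : ℂ)))
      (Complex.exp (-Complex.I * a * (t : ℂ)) * (-Complex.I * a)) t := by
  have h1 : HasDerivAt (fun t : ℝ => -Complex.I * a * (t : ℂ)) (-Complex.I * a) t := by
    simpa using (Complex.ofRealCLM.hasDerivAt (x := t)).const_mul (-Complex.I * a)
  exact h1.cexp

/-- Weak stationary states give standing waves. -/
theorem Admissible.isSolution_standing {s p : ℝ} {m : ℕ} {W : ℂ → ℝ} (h : Admissible s p m W)
    {ω : ℝ} {u : L2} (hu : MemHs s u) (hω : IsWeakStationary s W ω u) :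
    IsSolution s W univ (fun t : ℝ => Complex.exp (-Complex.I * (ω : ℂ) * (t : ℂ)) • u) where
  mem t _ := hu.smul _
  cont t _ := by
    have h1 : (fun t' : ℝ => hsNorm s (Complex.exp (-Complex.I * (ω : ℂ) * (t' : ℂ)) • u -
        Complex.exp (-Complex.I * (ω : ℂ) * (t : ℂ)) • u)) =
        fun t' : ℝ => ‖Complex.exp (-Complex.I * (ω : ℂ) * (t' : ℂ)) -
          Complex.exp (-Complex.I * (ω : ℂ) * (t : ℂ))‖ * hsNorm s u := by
      ext t'
      rw [← sub_smul, hsNorm_smul _ hu]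
    rw [h1, nhdsWithin_univ]
    have h2 : Continuous fun t' : ℝ => ‖Complex.exp (-Complex.I * (ω : ℂ) * (t' : ℂ)) -
        Complex.exp (-Complex.I * (ω : ℂ) * (t : ℂ))‖ * hsNorm s u := by fun_prop
    simpa using h2.tendsto t
  eqn φ hφ t _ := by
    have h1 := hω φ hφ
    rw [h.rhsPairing_eq φ hu] at h1
    have hn := norm_cexp_neg_I_mul ω t
    rw [h.rhsPairing_eq φ (hu.smul _), h.gradL2_smul hn hu, inner_smul_right, inner_smul_right]
    have h2 := ((hasDerivAt_cexp_neg_I_mul (ω : ℂ) t).mul_const (inner ℂ φ u : ℂ)).hasDerivWithinAt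
      (s := univ)
    simp_rw [inner_smul_right]
    convert! h2 using 1
    linear_combination (-Complex.I * Complex.exp (-Complex.I * (ω : ℂ) * (t : ℂ))) * h1

/-- States whose charge and energy are almost those of the minimizers are close to a minimizer. -/
theorem Admissible.exists_close_minimizer {s p : ℝ} {m : ℕ} {W : ℂ → ℝ} (h : Admissible s p m W)
    {c : ℝ} (hc : 0 < c) (hneg : Jinf s W c < 0) {ε : ℝ} (hε : 0 < ε) :
    ∃ δ > 0, ∀ w : L2, MemHs s w → |‖w‖ ^ 2 - c| < δ → |J s W w - Jinf s W c| < δ →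
      ∃ v, IsMinimizer s W c v ∧ hsNorm s (w - v) < ε := by
  -- A sequence of counterexamples would be minimizing with charges tending to c, hence convergent
  -- after translations; translating the limit back gives a minimizer close to a member of the
  -- sequence.
  by_contra! hcon
  choose u hu h1 h2 h3 using fun n : ℕ => hcon (1 / ((n : ℝ) + 1)) (by positivity)
  have hlim := tendsto_one_div_add_atTop_nhds_zero_nat (𝕜 := ℝ)
  have hch : Tendsto (fun n => ‖u n‖ ^ 2) atTop (𝓝 c) :=
    tendsto_iff_norm_sub_tendsto_zero.2 (squeeze_zero (fun _ => norm_nonneg _)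
      (fun n => (h1 n).le) hlim)
  have hJ : Tendsto (fun n => J s W (u n)) atTop (𝓝 (Jinf s W c)) :=
    tendsto_iff_norm_sub_tendsto_zero.2 (squeeze_zero (fun _ => norm_nonneg _)
      (fun n => (h2 n).le) hlim)
  obtain ⟨k, τ, v, -, hv, hvc, hvJ, hlim⟩ := h.minimizing_compact hc hneg hu hch hJ
  obtain ⟨n, hn⟩ := (hlim.eventually (gt_mem_nhds hε)).exists
  have hm : IsMinimizer s W c v := ⟨hv, hvc, hvJ⟩
  have h4 := h3 (k n) _ (hm.translate (-τ n))
  rw [← hsNorm_translate ((hu _).sub (hm.translate _).memHs) (τ n), translate_sub,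
    translate_translate, add_neg_cancel, translate_zero] at h4
  exact absurd hn (not_lt.2 h4)

/-- `J` and the charge are locally uniformly continuous for the `H^s` norm. -/
theorem Admissible.J_sub_le {s p : ℝ} {m : ℕ} {W : ℂ → ℝ} (h : Admissible s p m W) (A : ℝ) :
    ∃ C : ℝ, 0 < C ∧ ∀ u v : L2, MemHs s u → MemHs s v → hsNorm s u ≤ A → hsNorm s v ≤ A →
      |J s W u - J s W v| ≤ C * hsNorm s (u - v) ∧
        |‖u‖ ^ 2 - ‖v‖ ^ 2| ≤ C * hsNorm s (u - v) := by
  obtain ⟨C, hC, hb⟩ := h.pot_sub_le A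
  refine ⟨C + 2 * |A| + 1, by positivity, fun u v hu hv huA hvA => ?_⟩
  have hsq : ∀ a b : L2, ‖a‖ ≤ A → ‖b‖ ≤ A → |‖a‖ ^ 2 - ‖b‖ ^ 2| ≤ 2 * |A| * ‖a - b‖ := by
    intro a b ha hb
    rw [sq_sub_sq, abs_mul, abs_of_nonneg (by positivity : 0 ≤ ‖a‖ + ‖b‖)]
    have := abs_norm_sub_norm_le a b
    have hA := le_abs_self A
    refine mul_le_mul (by linarith) this (abs_nonneg _) (by positivity)
  have h1 := hsq u v ((norm_le_hsNorm s u).trans huA) ((norm_le_hsNorm s v).trans hvA)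
  have h2 := hsq (fracD s u) (fracD s v) ((norm_fracD_le_hsNorm s u).trans huA)
    ((norm_fracD_le_hsNorm s v).trans hvA)
  rw [← fracD_sub hu hv] at h2
  have h3 := hb u v hu hv huA hvA
  have h4 := norm_le_hsNorm s (u - v)
  have h5 := norm_fracD_le_hsNorm s (u - v)
  have h6 := hsNorm_nonneg s (u - v)
  have h7 := mul_le_mul_of_nonneg_left h4 hC
  have h8 := mul_le_mul_of_nonneg_left h4 (by positivity : 0 ≤ 2 * |A|)
  have h9 := mul_le_mul_of_nonneg_left h5 (by positivity : 0 ≤ 2 * |A|)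
  have h10 : 0 ≤ C * hsNorm s (u - v) := by positivity
  have h11 : 0 ≤ |A| * hsNorm s (u - v) := by positivity
  constructor
  · rw [J, J]
    calc _ = |1 / 2 * (‖fracD s u‖ ^ 2 - ‖fracD s v‖ ^ 2) + (pot W u - pot W v)| := by ring_nf
      _ ≤ 1 / 2 * |‖fracD s u‖ ^ 2 - ‖fracD s v‖ ^ 2| + |pot W u - pot W v| := by
        refine (abs_add_le _ _).trans ?_
        rw [abs_mul, abs_of_nonneg (by norm_num : (0 : ℝ) ≤ 1 / 2)]
      _ ≤ _ := by nlinarith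
  · nlinarith

/-- Orbital stability, for states with the energy and the charge of a given initial state. -/
theorem Admissible.orbital_stability {s p : ℝ} {m : ℕ} {W : ℂ → ℝ} (h : Admissible s p m W)
    {c : ℝ} (hc : 0 < c) (hneg : Jinf s W c < 0) {ε : ℝ} (hε : 0 < ε) :
    ∃ δ > 0, ∀ u v w : L2, MemHs s u → IsMinimizer s W c v → hsNorm s (u - v) < δ → MemHs s w →
      energy s W w = energy s W u → charge w = charge u →
      ∃ v', IsMinimizer s W c v' ∧ hsNorm s (w - v') < ε := by
  obtain ⟨δ, hδ, hcl⟩ := h.exists_close_minimizer hc hneg hε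
  obtain ⟨A, M, hA, -, hAM⟩ := h.minimizer_bounded hc
  obtain ⟨C, hC, hJ⟩ := h.J_sub_le (A + 1)
  -- The 1 keeps u in the ball of radius A+1, where C is valid. No dynamics enters: w only shares
  -- the energy and the charge of u, hence its `J`.
  refine ⟨min 1 (δ / C), by positivity, fun u v w hu hv huv hw hE hch => ?_⟩
  have h1 := hsNorm_le_add_sub hu hv.memHs
  have h2 := (hAM v hv).1
  have h3 := lt_min_iff.1 huv
  obtain ⟨h4, h5⟩ := hJ u v hu hv.memHs (by linarith) (by linarith)
  have h6 : C * hsNorm s (u - v) < δ := by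
    rw [mul_comm]; exact (lt_div_iff₀ hC).1 h3.2
  rw [charge_eq_normSq, charge_eq_normSq] at hch
  rw [h.energy_eq hw, h.energy_eq hu, hch] at hE
  have h7 : J s W w = J s W u := by linarith
  refine hcl w hw ?_ ?_
  · rw [hch, ← hv.charge]; exact h5.trans_lt h6
  · rw [h7, ← hv.eq_inf]; exact h4.trans_lt h6

/-! ### Density of the test functions in `H^a` -/

/-- Every compactly supported smooth g is the inverse transform of the Schwartz function 𝓕 g, and
Fubini moves that inverse transform from 𝓕 g to F. -/
theorem ae_eq_zero_of_fourierInv_eq_zero {F : ℝ → ℂ} (hF : Integrable F)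
    (h : ∀ x, (𝓕⁻ F : ℝ → ℂ) x = 0) : ∀ᵐ ξ, F ξ = 0 := by
  refine ae_eq_zero_of_integral_contDiff_smul_eq_zero hF.locallyIntegrable fun g hg hgc => ?_
  have hg' : HasCompactSupport (fun x => (g x : ℂ)) :=
    hgc.comp_left (g := ((↑) : ℝ → ℂ)) (by simp)
  have hgd : ContDiff ℝ ((⊤ : ℕ∞) : WithTop ℕ∞) (fun x => (g x : ℂ)) :=
    Complex.ofRealCLM.contDiff.comp hg
  set φ : SchwartzMap ℝ ℂ := hg'.toSchwartzMap hgd with hφ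
  have hφx : ∀ x, φ x = (g x : ℂ) := fun x => rfl
  have h1 := integral_fourierInv_mul hF (𝓕 φ).integrable
  simp_rw [h, zero_mul, integral_zero] at h1
  rw [h1]
  rw [← SchwartzMap.fourierInv_coe, FourierTransform.fourierInv_fourier_eq]
  refine integral_congr_ae (ae_of_all _ fun x => ?_)
  simp only [hφx, Complex.real_smul, mul_comm]

theorem IsTest.translate {φ : L2} (h : IsTest φ) (τ : ℝ) : IsTest (translate τ φ) := by
  obtain ⟨f, hf, hc, hφ⟩ := h
  refine ⟨fun x => f (x - τ), hf.comp (contDiff_id.sub contDiff_const),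
    hc.comp_homeomorph (Homeomorph.subRight τ), ?_⟩
  filter_upwards [translate_coeFn τ φ, ae_comp_sub hφ τ] with x h1 h2
  rw [h1, h2]

theorem IsTest.add {φ ψ : L2} (h : IsTest φ) (h' : IsTest ψ) : IsTest (φ + ψ) := by
  obtain ⟨f, hf, hc, hφ⟩ := h
  obtain ⟨g, hg, hc', hψ⟩ := h'
  exact ⟨f + g, hf.add hg, hc.add hc', (Lp.coeFn_add φ ψ).trans (hφ.add hψ)⟩

theorem IsTest.smul {φ : L2} (c : ℂ) (h : IsTest φ) : IsTest (c • φ) := by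
  obtain ⟨f, hf, hc, hφ⟩ := h
  exact ⟨c • f, hf.const_smul c, hc.smul_left (f := fun _ => c), (Lp.coeFn_smul c φ).trans (hφ.const_smul c)⟩

theorem isTest_zero : IsTest 0 :=
  ⟨0, contDiff_const, HasCompactSupport.zero, Lp.coeFn_zero ℂ 2 _⟩

/-- There are test functions whose Fourier transform does not vanish near a given frequency. -/
theorem exists_isTest_fourier_ne_zero (ξ₀ : ℝ) : ∃ φ : L2, IsTest φ ∧
    ∀ᶠ U in (𝓝 ξ₀).smallSets, ∀ᵐ ξ, ξ ∈ U → (𝓕 φ : L2) ξ ≠ 0 := by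
  let b : ContDiffBump (0 : ℝ) := ⟨1, 2, one_pos, one_lt_two⟩
  -- A bump modulated to frequency ξ₀: its transform at ξ₀ is the integral of the bump, which is
  -- positive, and the transform is continuous.
  set f : ℝ → ℂ := fun x => Complex.exp (2 * Real.pi * Complex.I * ξ₀ * x) * (b x : ℂ) with hf
  have hfd : ContDiff ℝ ((⊤ : ℕ∞) : WithTop ℕ∞) f := by
    refine ContDiff.mul ?_ (Complex.ofRealCLM.contDiff.comp b.contDiff)
    exact (contDiff_const.mul Complex.ofRealCLM.contDiff).cexp
  have hfc : HasCompactSupport f :=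
    HasCompactSupport.mul_left (b.hasCompactSupport.comp_left (g := ((↑) : ℝ → ℂ)) (by simp))
  set φ : SchwartzMap ℝ ℂ := hfc.toSchwartzMap hfd with hφ
  have hφx : ∀ x, φ x = f x := fun x => rfl
  refine ⟨_, ⟨f, hfd, hfc, φ.coeFn_toLp 2 volume⟩, ?_⟩
  have h1 : (𝓕 φ) ξ₀ ≠ 0 := by
    rw [SchwartzMap.fourier_coe, Real.fourier_eq]
    have h2 : ∀ x : ℝ, (Real.fourierChar (-(inner ℝ x ξ₀)) : Circle) • φ x = (b x : ℂ) := by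
      intro x
      rw [hφx, hf, Circle.smul_def, smul_eq_mul, Real.fourierChar_apply, ← mul_assoc,
        ← Complex.exp_add]
      have : (inner ℝ x ξ₀ : ℝ) = ξ₀ * x := by simp
      rw [this]
      have h3 : (↑(2 * Real.pi * -(ξ₀ * x)) * Complex.I + 2 * Real.pi * Complex.I * ξ₀ * x : ℂ)
        = 0 := by push_cast; ring
      rw [h3, Complex.exp_zero, one_mul]
    simp_rw [h2]
    rw [integral_complex_ofReal]
    exact_mod_cast b.integral_pos.ne'
  have h2 : ∀ᶠ ξ in 𝓝 ξ₀, (𝓕 φ) ξ ≠ 0 := (𝓕 φ).continuous.continuousAt.eventually_ne h1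
  have h3 := eventually_smallSets_forall.2 h2
  filter_upwards [h3] with U hU
  rw [SchwartzMap.toLp_fourier_eq φ]
  filter_upwards [(𝓕 φ).coeFn_toLp 2 volume] with ξ hξ hξU
  rw [hξ]
  exact hU ξ hξU

/-- Applied to all translates of one φ, the hypothesis says that an integrable function has zero
inverse transform. So the conjugate of φ̂ times the claimed quantity vanishes almost everywhere, and
near each frequency some φ̂ has no zero. -/
theorem ae_eq_zero_of_forall_test {a : ℝ} (ha : 0 ≤ a) {f g : L2}
    (h : ∀ φ : L2, IsTest φ → (inner ℂ φ f : ℂ) + inner ℂ (fracD a φ) g = 0) :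
    ∀ᵐ ξ, (𝓕 f : L2) ξ + symb a ξ * (𝓕 g : L2) ξ = 0 := by
  have key : ∀ φ : L2, IsTest φ → ∀ᵐ ξ,
      conj ((𝓕 φ : L2) ξ) * ((𝓕 f : L2) ξ + symb a ξ * (𝓕 g : L2) ξ) = 0 := by
    intro φ hφ
    have hD := (hφ.memHs ha).hasD
    set F : ℝ → ℂ := fun ξ => conj ((𝓕 φ : L2) ξ) * (𝓕 f : L2) ξ +
      conj ((𝓕 (fracD a φ) : L2) ξ) * (𝓕 g : L2) ξ with hF
    have hFi : Integrable F := (integrable_conj_mul _ _).add (integrable_conj_mul _ _)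
    have h0 : ∀ τ, (𝓕⁻ F : ℝ → ℂ) τ = 0 := by
      intro τ
      rw [← h _ (hφ.translate τ), fracD_translate (hφ.memHs ha), ← inner_fourier,
        ← inner_fourier (translate τ _), inner_eq_integral, inner_eq_integral,
        ← integral_add (integrable_conj_mul _ _) (integrable_conj_mul _ _), Real.fourierInv_eq]
      refine integral_congr_ae ?_
      filter_upwards [fourier_translate τ φ, fourier_translate τ (fracD a φ)] with ξ h1 h2
      rw [h1, h2, map_mul, map_mul, ← Circle.coe_inv_eq_conj, ← AddChar.map_neg_eq_inv, neg_neg,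
        Circle.smul_def, smul_eq_mul]
      have : (inner ℝ ξ τ : ℝ) = τ * ξ := by simp
      rw [this, hF]
      ring
    filter_upwards [ae_eq_zero_of_fourierInv_eq_zero hFi h0, hD] with ξ h1 h2
    rw [hF] at h1
    simp only [h2, map_mul, symb_conj] at h1
    linear_combination h1
  have hloc : volume {ξ | ¬ ((𝓕 f : L2) ξ + symb a ξ * (𝓕 g : L2) ξ = 0)} = 0 := by
    refine measure_null_of_locally_null _ fun ξ₀ _ => ?_
    obtain ⟨φ, hφ, hev⟩ := exists_isTest_fourier_ne_zero ξ₀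
    obtain ⟨U, hU, hUp⟩ := (hev.exists_mem_of_smallSets)
    refine ⟨_, inter_mem self_mem_nhdsWithin (mem_nhdsWithin_of_mem_nhds hU), ?_⟩
    have h1 : ∀ᵐ ξ, ¬ (ξ ∈ {ξ | ¬ ((𝓕 f : L2) ξ + symb a ξ * (𝓕 g : L2) ξ = 0)} ∩ U) := by
      filter_upwards [key φ hφ, hUp] with ξ h1 h2 h3
      rcases mul_eq_zero.1 h1 with h4 | h4
      · exact h2 h3.2 ((map_eq_zero _).1 h4)
      · exact h3.1 h4
    rw [ae_iff] at h1
    simpa only [not_not, ofPred_mem_eq] using h1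
  exact hloc

/-- Test functions are dense in `H^a`. -/
theorem exists_isTest_close {a : ℝ} (ha : 0 ≤ a) {u u' : L2} (hu : HasD a u u') {ε : ℝ}
    (hε : 0 < ε) : ∃ φ : L2, IsTest φ ∧ ‖φ - u‖ < ε ∧ ‖fracD a φ - u'‖ < ε := by
  let K : Submodule ℂ (WithLp 2 (L2 × L2)) :=
    { carrier := {x | ∃ φ : L2, IsTest φ ∧ x = WithLp.toLp 2 (φ, fracD a φ)}
      add_mem' := by
        rintro _ _ ⟨φ, hφ, rfl⟩ ⟨ψ, hψ, rfl⟩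
        refine ⟨φ + ψ, hφ.add hψ, ?_⟩
        rw [fracD_add (hφ.memHs ha) (hψ.memHs ha)]
        rfl
      zero_mem' := ⟨0, isTest_zero, by rw [fracD_zero]; rfl⟩
      smul_mem' := by
        rintro c _ ⟨φ, hφ, rfl⟩
        refine ⟨c • φ, hφ.smul c, ?_⟩
        rw [fracD_smul c (hφ.memHs ha)]
        rfl }
  -- The closure of the graph over test functions is its double orthogonal complement, and every
  -- vector orthogonal to that graph is orthogonal to (u, u').
  have hmem : (WithLp.toLp 2 (u, u') : WithLp 2 (L2 × L2)) ∈ K.topologicalClosure := by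
    rw [← Submodule.orthogonal_orthogonal_eq_closure, Submodule.mem_orthogonal']
    intro y hy
    rw [Submodule.mem_orthogonal] at hy
    have h1 := ae_eq_zero_of_forall_test ha (f := y.fst) (g := y.snd) fun φ hφ => by
      have := hy _ ⟨φ, hφ, rfl⟩
      rwa [WithLp.prod_inner_apply] at this
    rw [WithLp.prod_inner_apply]
    change (inner ℂ u y.fst : ℂ) + inner ℂ u' y.snd = 0
    rw [← inner_fourier, ← inner_fourier u', inner_eq_integral, inner_eq_integral,
      ← integral_add (integrable_conj_mul _ _) (integrable_conj_mul _ _)]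
    refine integral_eq_zero_of_ae ?_
    filter_upwards [h1, hu] with ξ h2 h3
    rw [h3, map_mul, symb_conj, Pi.zero_apply]
    linear_combination conj ((𝓕 u : L2) ξ) * h2
  obtain ⟨_, ⟨φ, hφ, rfl⟩, hd⟩ := Metric.mem_closure_iff.1 hmem ε hε
  have h1 : ‖(WithLp.toLp 2 (φ - u, fracD a φ - u') : WithLp 2 (L2 × L2))‖ < ε := by
    rw [dist_comm, dist_eq_norm] at hd
    exact hd
  refine ⟨φ, hφ, lt_of_le_of_lt ?_ h1, lt_of_le_of_lt ?_ h1⟩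
  · exact WithLp.norm_fst_le _ (WithLp.toLp 2 (φ - u, fracD a φ - u') : WithLp 2 (L2 × L2))
  · exact WithLp.norm_snd_le _ (WithLp.toLp 2 (φ - u, fracD a φ - u') : WithLp 2 (L2 × L2))

/-! ### The energy estimate for the linear inhomogeneous equation -/

/-- `w` is a bounded weak solution of `i ∂ₜ w = ½ (D^a w + g)` on `[0, T)`. -/
structure IsWeakSolution (a T B : ℝ) (w g : ℝ → L2) : Prop where
  continuousOn : ContinuousOn w (Ico 0 T)
  norm_le : ∀ t ∈ Ico 0 T, ‖w t‖ ≤ B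
  norm_source_le : ∀ t ∈ Ico 0 T, ‖g t‖ ≤ B
  eqn : ∀ φ : L2, IsTest φ → ∀ t ∈ Ico 0 T,
    HasDerivWithinAt (fun t' => (inner ℂ φ (w t') : ℂ))
      (-Complex.I / 2 * (inner ℂ (fracD a φ) (w t) + inner ℂ φ (g t))) (Ico 0 T) t

/-- Extends the equation from test functions to all of H^a. Approximation in the graph norm makes
the time derivatives converge uniformly, because w and g are bounded in L². -/
theorem IsWeakSolution.hasDerivAt_inner {a T B : ℝ} (ha : 0 ≤ a) {w g : ℝ → L2}
    (h : IsWeakSolution a T B w g) {u u' : L2} (hu : HasD a u u') {t : ℝ} (ht : t ∈ Ioo 0 T) :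
    HasDerivAt (fun t' => (inner ℂ u (w t') : ℂ))
      (-Complex.I / 2 * (inner ℂ u' (w t) + inner ℂ u (g t))) t := by
  choose φ hφ h1 h2 using fun n : ℕ =>
    exists_isTest_close ha hu (ε := 1 / ((n : ℝ) + 1)) (by positivity)
  have hlim := tendsto_one_div_add_atTop_nhds_zero_nat (𝕜 := ℝ)
  have hB : 0 ≤ B := (norm_nonneg _).trans (h.norm_le t ⟨ht.1.le, ht.2⟩)
  refine hasDerivAt_of_tendstoUniformlyOn (l := atTop) isOpen_Ioo
    (f := fun n t' => (inner ℂ (φ n) (w t') : ℂ))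
    (f' := fun n t' => -Complex.I / 2 * (inner ℂ (fracD a (φ n)) (w t') + inner ℂ (φ n) (g t')))
    (g' := fun t' => -Complex.I / 2 * (inner ℂ u' (w t') + inner ℂ u (g t')))
    (s := Ioo 0 T) ?_ (Eventually.of_forall fun n x hx => ?_) (fun x hx => ?_) ht
  · rw [Metric.tendstoUniformlyOn_iff]
    intro ε hε
    have h3 : Tendsto (fun n : ℕ => 1 / ((n : ℝ) + 1) * B) atTop (𝓝 0) := by
      simpa using hlim.mul_const B
    filter_upwards [h3.eventually (gt_mem_nhds hε)] with n hn x hx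
    rw [dist_comm, dist_eq_norm, ← mul_sub, norm_mul]
    have hx' : x ∈ Ico 0 T := ⟨hx.1.le, hx.2⟩
    have h4 : ‖(inner ℂ (fracD a (φ n)) (w x) + inner ℂ (φ n) (g x) -
        (inner ℂ u' (w x) + inner ℂ u (g x)) : ℂ)‖ ≤
          1 / ((n : ℝ) + 1) * B + 1 / ((n : ℝ) + 1) * B := by
      rw [add_sub_add_comm, ← inner_sub_left, ← inner_sub_left]
      refine (norm_add_le _ _).trans (add_le_add ?_ ?_)
      · exact (norm_inner_le_norm _ _).trans
          (mul_le_mul (h2 n).le (h.norm_le x hx') (norm_nonneg _) (by positivity))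
      · exact (norm_inner_le_norm _ _).trans
          (mul_le_mul (h1 n).le (h.norm_source_le x hx') (norm_nonneg _) (by positivity))
    have h5 : ‖-Complex.I / 2‖ = 1 / 2 := by simp
    rw [h5]
    linarith
  · exact (h.eqn _ (hφ n) x ⟨hx.1.le, hx.2⟩).hasDerivAt (Ico_mem_nhds hx.1 hx.2)
  · refine Tendsto.inner (𝕜 := ℂ) ?_ tendsto_const_nhds
    exact tendsto_iff_norm_sub_tendsto_zero.2
      (squeeze_zero (fun _ => norm_nonneg _) (fun n => (h1 n).le) hlim)

theorem IsWeakSolution.hasDerivAt_inner_lowpass {a T B : ℝ} (ha : 0 ≤ a) {w g : ℝ → L2}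
    (h : IsWeakSolution a T B w g) (R : ℝ) (f : L2) {t : ℝ} (ht : t ∈ Ioo 0 T) :
    HasDerivAt (fun t' => (inner ℂ f (lowpass R (w t')) : ℂ))
      (-Complex.I / 2 * inner ℂ f (cutD a ha R (w t) + lowpass R (g t))) t := by
  have h1 := h.hasDerivAt_inner ha (hasD_lowpass ha R f) ht
  rw [inner_add_right, ← cutD_symm]
  simp only [lowpass, ← cutD_symm] at h1 ⊢
  exact h1

/-- On a frequency band D^a is bounded, so the low-pass part is Lipschitz in time; this serves to
differentiate its squared norm. -/
theorem IsWeakSolution.norm_lowpass_sub_le {a T B : ℝ} (ha : 0 ≤ a) {w g : ℝ → L2}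
    (h : IsWeakSolution a T B w g) (R : ℝ) : ∃ K : ℝ, 0 ≤ K ∧ ∀ t ∈ Ioo 0 T, ∀ t' ∈ Ioo 0 T,
      ‖lowpass R (w t') - lowpass R (w t)‖ ≤ K * |t' - t| := by
  rcases (Ioo (0 : ℝ) T).eq_empty_or_nonempty with he | ⟨t₀, ht₀⟩
  · refine ⟨0, le_rfl, fun t ht => ?_⟩
    rw [he] at ht
    exact absurd ht (notMem_empty t)
  have hB : 0 ≤ B := (norm_nonneg _).trans (h.norm_le t₀ ⟨ht₀.1.le, ht₀.2⟩)
  refine ⟨1 / 2 * (‖cutD a ha R‖ * B + B), by positivity, fun t ht t' ht' => ?_⟩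
  set K := 1 / 2 * (‖cutD a ha R‖ * B + B) with hK
  have key : ∀ f : L2, ‖(inner ℂ f (lowpass R (w t') - lowpass R (w t)) : ℂ)‖ ≤
      ‖f‖ * K * ‖t' - t‖ := by
    intro f
    rw [inner_sub_right]
    refine (convex_Ioo 0 T).norm_image_sub_le_of_norm_hasDerivWithin_le
      (fun x hx => (h.hasDerivAt_inner_lowpass ha R f hx).hasDerivWithinAt) (fun x hx => ?_) ht ht'
    have hx' : x ∈ Ico 0 T := ⟨hx.1.le, hx.2⟩
    have h5 : ‖-Complex.I / 2‖ = 1 / 2 := by simp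
    rw [norm_mul, h5]
    have h6 : ‖cutD a ha R (w x) + lowpass R (g x)‖ ≤ ‖cutD a ha R‖ * B + B := by
      refine (norm_add_le _ _).trans (add_le_add ?_ ?_)
      · exact ((cutD a ha R).le_opNorm _).trans
          (mul_le_mul_of_nonneg_left (h.norm_le x hx') (norm_nonneg _))
      · exact (norm_lowpass_le _ _).trans (h.norm_source_le x hx')
    have h7 := (norm_inner_le_norm (𝕜 := ℂ) f (cutD a ha R (w x) + lowpass R (g x))).trans
      (mul_le_mul_of_nonneg_left h6 (norm_nonneg f))
    rw [hK]
    linarith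
  set Δ := lowpass R (w t') - lowpass R (w t) with hΔ
  have h1 := key Δ
  rw [inner_self_eq_norm_sq_to_K, norm_pow, RCLike.norm_ofReal, abs_norm] at h1
  rcases (norm_nonneg Δ).eq_or_lt with h0 | h0
  · rw [← h0]
    positivity
  · rw [← Real.norm_eq_abs]
    nlinarith

/-- Write Pw for the low-pass part and v = Pw(t). In ‖Pw(t')‖² = 2Re⟨v, Pw(t')⟩ + ‖Pw(t') - v‖² -
‖v‖² the middle term is O(|t'-t|²), so a weak derivative suffices. The linear operator drops out:
its pairing is real and is multiplied by -i. -/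
theorem IsWeakSolution.hasDerivAt_normSq_lowpass {a T B : ℝ} (ha : 0 ≤ a) {w g : ℝ → L2}
    (h : IsWeakSolution a T B w g) (R : ℝ) {t : ℝ} (ht : t ∈ Ioo 0 T) :
    HasDerivAt (fun t' => ‖lowpass R (w t')‖ ^ 2)
      (inner ℂ (lowpass R (w t)) (lowpass R (g t)) : ℂ).im t := by
  obtain ⟨K, hK, hlip⟩ := h.norm_lowpass_sub_le ha R
  set v := lowpass R (w t) with hv
  have h1 := (Complex.reCLM.hasFDerivAt (x := (inner ℂ v (lowpass R (w t)) : ℂ))).comp_hasDerivAt t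
    (h.hasDerivAt_inner_lowpass ha R v ht)
  have h2 : HasDerivAt (fun t' => ‖lowpass R (w t') - v‖ ^ 2) 0 t := by
    have h3 : (fun t' => ‖lowpass R (w t') - v‖ ^ 2) =O[𝓝 t] fun t' => ‖t' - t‖ ^ 2 := by
      refine Asymptotics.IsBigO.of_bound (K ^ 2) ?_
      filter_upwards [Ioo_mem_nhds ht.1 ht.2] with t' ht'
      rw [Real.norm_of_nonneg (by positivity), Real.norm_of_nonneg (by positivity), ← mul_pow,
        Real.norm_eq_abs]
      exact pow_le_pow_left₀ (norm_nonneg _) (hlip t ht t' ht') 2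
    simpa using (h3.hasFDerivAt (𝕜 := ℝ) one_lt_two).hasDerivAt
  have h4 : (fun t' => ‖lowpass R (w t')‖ ^ 2) = fun t' =>
      2 * (inner ℂ v (lowpass R (w t')) : ℂ).re + ‖lowpass R (w t') - v‖ ^ 2 - ‖v‖ ^ 2 := by
    ext t'
    have := norm_sub_sq (𝕜 := ℂ) (lowpass R (w t')) v
    rw [this, re_inner_comm v]
    change _ = 2 * (inner ℂ (lowpass R (w t')) v : ℂ).re + (‖lowpass R (w t')‖ ^ 2 -
      2 * (inner ℂ (lowpass R (w t')) v : ℂ).re + ‖v‖ ^ 2) - ‖v‖ ^ 2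
    ring
  rw [h4]
  have h5 := ((h1.const_mul 2).add h2).sub_const (‖v‖ ^ 2)
  convert! h5 using 1
  have h6 : (inner ℂ v (cutD a ha R (w t)) : ℂ).im = 0 := by
    have h7 : (inner ℂ v (cutD a ha R (w t)) : ℂ) = inner ℂ (w t) (cutD a ha R (w t)) := by
      rw [hv, lowpass, cutD_symm]
      exact congrArg _ (lowpass_cutD ha R (w t))
    rw [h7, ← Complex.conj_eq_iff_im, inner_conj_symm, cutD_symm]
  rw [inner_add_right, Complex.reCLM_apply, mul_add, Complex.add_re]
  simp [Complex.mul_re, h6]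
  ring

/-- The Gronwall estimate for weak solutions. -/
theorem IsWeakSolution.normSq_le {a s T B L e : ℝ} (ha : 0 ≤ a) (hs : 0 < s) {w g : ℝ → L2}
    (h : IsWeakSolution a T B w g) (hmem : ∀ t ∈ Ico 0 T, MemHs s (w t)) (hL : 0 ≤ L)
    (hg : ∀ t ∈ Ico 0 T, ‖g t‖ ≤ L * ‖w t‖ + e) {t : ℝ} (ht : t ∈ Ico 0 T) :
    ‖w t‖ ^ 2 ≤ gronwallBound (‖w 0‖ ^ 2) (L + 1) (e ^ 2) t := by
  -- Clamping times to [0,t] makes the squared norm y continuous on the whole line.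
  set q : ℝ → ℝ := fun x => max 0 (min x t) with hq
  have hqI : ∀ x, q x ∈ Ico 0 T := fun x =>
    ⟨le_max_left _ _, max_lt (ht.1.trans_lt ht.2) ((min_le_right _ _).trans_lt ht.2)⟩
  have hqx : ∀ x ∈ Icc 0 t, q x = x := fun x hx => by
    simp only [hq]
    rw [min_eq_left hx.2, max_eq_right hx.1]
  have hq0 : q 0 = 0 := hqx 0 ⟨le_rfl, ht.1⟩
  set y : ℝ → ℝ := fun x => ‖w (q x)‖ ^ 2 with hy
  have hyc : Continuous y :=
    (h.continuousOn.comp_continuous (by fun_prop) hqI).norm.pow 2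
  have hy0 : ∀ x, 0 ≤ y x := fun x => sq_nonneg _
  set F : ℝ → ℝ := fun x => (L + 1) * y x + e ^ 2 with hF
  have hFc : Continuous F := by fun_prop
  have hF0 : ∀ x, 0 ≤ F x := fun x => by have := hy0 x; positivity
  -- w itself need not be differentiable in L². The C¹ function Φ dominates the squared norm of
  -- every low-pass part, hence y as R → ∞, and then Φ' = (L+1)y + e² ≤ (L+1)Φ + e² allows
  -- Gronwall's inequality.
  set Φ : ℝ → ℝ := fun x => y 0 + ∫ r in (0 : ℝ)..x, F r with hΦ
  have hΦd : ∀ x, HasDerivAt Φ (F x) x := fun x =>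
    ((hFc.integral_hasStrictDerivAt 0 x).hasDerivAt).const_add _
  have hΦc : Continuous Φ := continuous_iff_continuousAt.2 fun x => (hΦd x).continuousAt
  have hband : ∀ R, ∀ x ∈ Icc 0 t, ‖lowpass R (w x)‖ ^ 2 ≤ Φ x := by
    intro R x hx
    have hsub : Icc 0 t ⊆ Ico 0 T := fun z hz => ⟨hz.1, hz.2.trans_lt ht.2⟩
    have hder : ∀ z ∈ Ioo 0 t, HasDerivAt (fun z => Φ z - ‖lowpass R (w z)‖ ^ 2)
        (F z - (inner ℂ (lowpass R (w z)) (lowpass R (g z)) : ℂ).im) z := fun z hz =>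
      (hΦd z).sub (h.hasDerivAt_normSq_lowpass ha R ⟨hz.1, hz.2.trans ht.2⟩)
    have hmono : MonotoneOn (fun z => Φ z - ‖lowpass R (w z)‖ ^ 2) (Icc 0 t) := by
      refine monotoneOn_of_deriv_nonneg (convex_Icc 0 t) ?_ ?_ ?_
      · exact hΦc.continuousOn.sub
          (((lowpass R).continuous.comp_continuousOn (h.continuousOn.mono hsub)).norm.pow 2)
      · rw [interior_Icc]
        exact fun z hz => (hder z hz).differentiableAt.differentiableWithinAt
      · rw [interior_Icc]
        intro z hz
        rw [(hder z hz).deriv]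
        have hz' := hsub ⟨hz.1.le, hz.2.le⟩
        have h1 : (inner ℂ (lowpass R (w z)) (lowpass R (g z)) : ℂ).im ≤ ‖w z‖ * ‖g z‖ :=
          (le_abs_self _).trans ((Complex.abs_im_le_norm _).trans ((norm_inner_le_norm _ _).trans
            (mul_le_mul (norm_lowpass_le _ _) (norm_lowpass_le _ _) (norm_nonneg _)
              (norm_nonneg _))))
        have h2 := mul_le_mul_of_nonneg_left (hg z hz') (norm_nonneg (w z))
        simp only [hF, hy]
        rw [hqx z ⟨hz.1.le, hz.2.le⟩]
        -- The rate L+1 comes from ‖w‖(L‖w‖ + e) ≤ (L+1)‖w‖² + e².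
        nlinarith [sq_nonneg (‖w z‖ - e), sq_nonneg ‖w z‖, sq_nonneg e]
    have h1 := hmono ⟨le_rfl, ht.1⟩ hx hx.1
    have h2 : Φ 0 = ‖w 0‖ ^ 2 := by simp [hΦ, hy, hq0]
    have h3 := pow_le_pow_left₀ (norm_nonneg _) (norm_lowpass_le R (w 0)) 2
    simp only at h1
    linarith
  have hyΦ : ∀ x ∈ Icc 0 t, y x ≤ Φ x := by
    intro x hx
    have hx' : x ∈ Ico 0 T := ⟨hx.1, hx.2.trans_lt ht.2⟩
    have hlim : Tendsto (fun R => lowpass R (w x)) atTop (𝓝 (w x)) := by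
      rw [tendsto_iff_norm_sub_tendsto_zero]
      have h1 : Tendsto (fun R : ℝ => ‖fracD s (w x)‖ / (2 * Real.pi * R) ^ s) atTop (𝓝 0) :=
        ((tendsto_rpow_atTop hs).comp
          (tendsto_id.const_mul_atTop (by positivity))).const_div_atTop _
      refine squeeze_zero' (Eventually.of_forall fun _ => norm_nonneg _) ?_ h1
      filter_upwards [eventually_gt_atTop 0] with R hR
      rw [le_div_iff₀ (by positivity), mul_comm, norm_sub_rev]
      exact rpow_mul_norm_sub_lowpass_le hs.le hR.le (hmem x hx')
    simp only [hy]
    rw [hqx x hx]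
    exact le_of_tendsto (hlim.norm.pow 2) (Eventually.of_forall fun R => hband R x hx)
  have hΦ0 : ∀ x ∈ Icc 0 t, 0 ≤ Φ x := fun x hx => (hy0 x).trans (hyΦ x hx)
  have hgr := norm_le_gronwallBound_of_norm_deriv_right_le (f := Φ) (f' := F) (δ := ‖w 0‖ ^ 2)
    (K := L + 1) (ε := e ^ 2) (a := 0) (b := t) hΦc.continuousOn
    (fun x _ => (hΦd x).hasDerivWithinAt) (by simp [hΦ, hy, hq0]) (fun x hx => by
      have hx' : x ∈ Icc 0 t := ⟨hx.1, hx.2.le⟩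
      rw [Real.norm_of_nonneg (hF0 x), Real.norm_of_nonneg (hΦ0 x hx')]
      have := mul_le_mul_of_nonneg_left (hyΦ x hx') (by linarith : 0 ≤ L + 1)
      simp only [hF]
      linarith) t ⟨ht.1, le_rfl⟩
  have h1 := hyΦ t ⟨ht.1, le_rfl⟩
  simp only [hy] at h1
  rw [hqx t ⟨ht.1, le_rfl⟩] at h1
  rw [sub_zero] at hgr
  exact h1.trans ((le_abs_self _).trans hgr)

/-! ### The nonlinearity near bounded states -/

theorem Admissible.exists_lipschitz_cgrad {s p : ℝ} {m : ℕ} {W : ℂ → ℝ} (h : Admissible s p m W)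
    (B : ℝ) : ∃ L : ℝ, 0 ≤ L ∧ ∀ a b : ℂ, ‖a‖ ≤ B → ‖b‖ ≤ B →
      ‖cgrad W a - cgrad W b‖ ≤ L * ‖a - b‖ := by
  have h1 : ContDiff ℝ 1 (fderiv ℝ W) := h.contDiff.fderiv_right (by norm_num)
  have h2 : ContDiff ℝ 1 (cgrad W) := by
    unfold cgrad
    exact (Complex.ofRealCLM.contDiff.comp (h1.clm_apply contDiff_const)).add
      (contDiff_const.mul (Complex.ofRealCLM.contDiff.comp (h1.clm_apply contDiff_const)))
  obtain ⟨K, hK⟩ := (h2.locallyLipschitz.locallyLipschitzOn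
    (s := Metric.closedBall 0 B)).exists_lipschitzOnWith_of_compact (isCompact_closedBall 0 B)
  refine ⟨K, K.2, fun a b ha hb => ?_⟩
  rw [← dist_eq_norm, ← dist_eq_norm]
  exact hK.dist_le_mul a (mem_closedBall_zero_iff.2 ha) b (mem_closedBall_zero_iff.2 hb)

/-- The value x is not assumed bounded. In the ball of radius 2M+1 the gradient is Lipschitz.
Outside, |x-u| ≥ 1 absorbs W'(u), and |x| ≤ 2|x-v| turns the growth of W'(x) into |x-v|^m. Two
reference values are needed: u is compared with x, while x is known to be close to v only. -/
theorem Admissible.norm_cgrad_sub_le {s p : ℝ} {m : ℕ} {W : ℂ → ℝ} (h : Admissible s p m W)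
    {M : ℝ} (hM : 0 < M) : ∃ L : ℝ, 0 ≤ L ∧ ∀ x u v : ℂ, ‖u‖ ≤ M → ‖v‖ ≤ M →
      ‖cgrad W x - cgrad W u‖ ≤ L * ‖x - u‖ + L * ‖x - v‖ ^ m := by
  obtain ⟨L, hL, hlip⟩ := h.exists_lipschitz_cgrad (2 * M + 1)
  obtain ⟨C, hC, hgr⟩ := h.grad_le
  set D := C * (M + M ^ m) with hD
  have hD0 : 0 ≤ D := by positivity
  refine ⟨L + D + C * (2 * 2 ^ m), by positivity, fun x u v hu hv => ?_⟩
  rcases le_or_gt ‖x‖ (2 * M + 1) with hx | hx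
  · have h1 := hlip x u hx (by linarith)
    have h2 : 0 ≤ (D + C * (2 * 2 ^ m)) * ‖x - u‖ := by positivity
    have h3 : 0 ≤ (L + D + C * (2 * 2 ^ m)) * ‖x - v‖ ^ m := by positivity
    nlinarith
  · have hxu : 1 ≤ ‖x - u‖ := by linarith [norm_sub_norm_le x u]
    have hxv : ‖x‖ ≤ 2 * ‖x - v‖ := by linarith [norm_sub_norm_le x v]
    have h1 : ‖cgrad W u‖ ≤ D * ‖x - u‖ := by
      refine (hgr u).trans ?_
      have h2 : C * (‖u‖ + ‖u‖ ^ m) ≤ D := by rw [hD]; gcongr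
      exact h2.trans (le_mul_of_one_le_right hD0 hxu)
    have h2 : ‖cgrad W x‖ ≤ C * (2 * 2 ^ m) * ‖x - v‖ ^ m := by
      refine (hgr x).trans ?_
      have h3 : ‖x‖ ≤ ‖x‖ ^ m := le_self_pow₀ (by linarith) (by have := h.two_le; omega)
      have h4 : ‖x‖ ^ m ≤ 2 ^ m * ‖x - v‖ ^ m := by
        rw [← mul_pow]
        exact pow_le_pow_left₀ (norm_nonneg _) hxv m
      have h5 : ‖x‖ + ‖x‖ ^ m ≤ 2 * 2 ^ m * ‖x - v‖ ^ m := by linarith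
      exact (mul_le_mul_of_nonneg_left h5 hC).trans_eq (by ring)
    have h6 : 0 ≤ (L + C * (2 * 2 ^ m)) * ‖x - u‖ := by positivity
    have h7 : 0 ≤ (L + D) * ‖x - v‖ ^ m := by positivity
    have h8 := norm_sub_le (cgrad W x) (cgrad W u)
    nlinarith

/-- The difference of the nonlinear terms of a state `x`, close to a bounded state `v`, and of a
bounded state `u`. -/
theorem Admissible.norm_gradL2_sub_le {s p : ℝ} {m : ℕ} {W : ℂ → ℝ} (h : Admissible s p m W)
    {M : ℝ} (hM : 0 < M) : ∃ L : ℝ, 0 ≤ L ∧ ∀ χ u v : L2, MemHs s χ → MemHs s u → MemHs s v →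
      (∀ᵐ x, ‖u x‖ ≤ M) → (∀ᵐ x, ‖v x‖ ≤ M) →
      ‖gradL2 W χ - gradL2 W u‖ ≤ L * ‖χ - u‖ + L * hsNorm s (χ - v) ^ m := by
  obtain ⟨L, hL, hlip⟩ := h.norm_cgrad_sub_le hM
  obtain ⟨C, hC, hpow⟩ := integral_pow_le_hsNorm h.half_le (k := 2 * m)
    (by have := h.two_le; omega)
  set D := 2 * L * (1 + Real.sqrt C) with hD
  refine ⟨D, by positivity, fun χ u v hχ hu hv hub hvb => ?_⟩
  have h0 := hsNorm_nonneg s (χ - v)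
  refine le_of_sq_le_sq ?_ (by positivity)
  obtain ⟨hi, hb⟩ := hpow (χ - v) (hχ.sub hv)
  have h1 : ‖gradL2 W χ - gradL2 W u‖ ^ 2 ≤
      2 * L ^ 2 * ‖χ - u‖ ^ 2 + 2 * L ^ 2 * ∫ x, ‖(χ - v) x‖ ^ (2 * m) := by
    rw [normSq_eq_integral, normSq_eq_integral (χ - u), ← integral_const_mul,
      ← integral_const_mul, ← integral_add ((integrable_normSq _).const_mul _) (hi.const_mul _)]
    refine integral_mono_ae (integrable_normSq _)
      (((integrable_normSq _).const_mul _).add (hi.const_mul _)) ?_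
    filter_upwards [Lp.coeFn_sub (gradL2 W χ) (gradL2 W u), Lp.coeFn_sub χ u, Lp.coeFn_sub χ v,
      h.gradL2_coeFn hχ, h.gradL2_coeFn hu, hub, hvb] with x h1 h2 h3 h4 h5 h6 h7
    rw [h1, h2, h3, Pi.sub_apply, Pi.sub_apply, Pi.sub_apply, h4, h5, pow_mul' _ 2 m]
    have h8 := pow_le_pow_left₀ (norm_nonneg _) (hlip (χ x) (u x) (v x) h6 h7) 2
    refine h8.trans ?_
    nlinarith [sq_nonneg (L * ‖χ x - u x‖ - L * ‖χ x - v x‖ ^ m)]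
  have h2 : ∫ x, ‖(χ - v) x‖ ^ (2 * m) ≤ (Real.sqrt C * hsNorm s (χ - v) ^ m) ^ 2 := by
    rw [mul_pow, Real.sq_sqrt hC.le, ← pow_mul']
    exact hb
  have h3 := mul_le_mul_of_nonneg_left h2 (by positivity : 0 ≤ 2 * L ^ 2)
  have h4 : ‖gradL2 W χ - gradL2 W u‖ ^ 2 ≤
      (2 * L * (‖χ - u‖ + Real.sqrt C * hsNorm s (χ - v) ^ m)) ^ 2 := by
    have : 0 ≤ L ^ 2 * (‖χ - u‖ * (Real.sqrt C * hsNorm s (χ - v) ^ m)) := by positivity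
    nlinarith [sq_nonneg (L * ‖χ - u‖), sq_nonneg (L * (Real.sqrt C * hsNorm s (χ - v) ^ m))]
  refine h4.trans (pow_le_pow_left₀ (by positivity) ?_ 2)
  have h5 : 0 ≤ L * Real.sqrt C * ‖χ - u‖ := by positivity
  have h6 : 0 ≤ L * hsNorm s (χ - v) ^ m := by positivity
  rw [hD]
  nlinarith

/-- States close in `L²` to a minimizer and with almost the same energy are close in `H^s`. -/
theorem Admissible.hsNorm_sub_minimizer_le {s p : ℝ} {m : ℕ} {W : ℂ → ℝ}
    (h : Admissible s p m W) {c : ℝ} (hc : 0 < c) (A : ℝ) : ∃ C : ℝ, 0 ≤ C ∧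
      ∀ χ v : L2, MemHs s χ → hsNorm s χ ≤ A → IsMinimizer s W c v → hsNorm s v ≤ A →
        hsNorm s (χ - v) ^ 2 ≤ ‖χ - v‖ ^ 2 + 2 * |J s W χ - Jinf s W c| +
          2 * (C + ‖fracD (2 * s) v‖) * ‖χ - v‖ := by
  obtain ⟨C, hC, hb⟩ := h.pot_sub_le A
  refine ⟨C, hC, fun χ v hχ hχA hv hvA => ?_⟩
  have h1 := hb χ v hχ hv.memHs hχA hvA
  have hD := h.hasD_minimizer hc hv
  rw [hsNorm_sq, fracD_sub hχ hv.memHs, ← hv.eq_inf]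
  -- Expanding ‖D^s χ‖² around v, the cross term is a pairing of χ - v with D^(2s)v, which is in L²;
  -- the L² distance therefore controls it.
  have h2 : (inner ℂ (fracD s χ - fracD s v) (fracD s v) : ℂ) =
      inner ℂ (χ - v) (fracD (2 * s) v) := by
    rw [← fracD_sub hχ hv.memHs]
    exact (hχ.sub hv.memHs).hasD.inner_symm (hv.memHs.hasD.comp hD.memHs.hasD)
  have h3 : ‖fracD s χ‖ ^ 2 = ‖fracD s χ - fracD s v‖ ^ 2 +
      2 * (inner ℂ (fracD s χ - fracD s v) (fracD s v) : ℂ).re + ‖fracD s v‖ ^ 2 := by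
    have := norm_add_sq (𝕜 := ℂ) (fracD s χ - fracD s v) (fracD s v)
    rwa [sub_add_cancel] at this
  have h4 : |(inner ℂ (fracD s χ - fracD s v) (fracD s v) : ℂ).re| ≤
      ‖χ - v‖ * ‖fracD (2 * s) v‖ := by
    rw [h2]
    exact (Complex.abs_re_le_norm _).trans (norm_inner_le_norm _ _)
  have h5 : J s W χ - J s W v = 1 / 2 * ‖fracD s χ‖ ^ 2 - 1 / 2 * ‖fracD s v‖ ^ 2 +
      (pot W χ - pot W v) := by rw [J, J]; ring
  have h6 := le_abs_self (J s W χ - J s W v)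
  have h7 := (abs_le.1 h1).1
  have h8 := (abs_le.1 h4).1
  linarith

/-! ### The evolution of the minimizers -/

/-- The standing wave with profile `u`. -/
def standing (s : ℝ) (W : ℂ → ℝ) (c : ℝ) (u : L2) (t : ℝ) : L2 :=
  Complex.exp (-Complex.I * (multiplier s W c u : ℂ) * (t : ℂ)) • u

theorem Admissible.isMinimizer_standing {s p : ℝ} {m : ℕ} {W : ℂ → ℝ} (h : Admissible s p m W)
    {c : ℝ} {u : L2} (hu : IsMinimizer s W c u) (t : ℝ) :
    IsMinimizer s W c (standing s W c u t) :=
  h.isMinimizer_smul (norm_cexp_neg_I_mul _ t) hu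

theorem standing_zero (s : ℝ) (W : ℂ → ℝ) (c : ℝ) (u : L2) : standing s W c u 0 = u := by
  simp [standing]

theorem IsMinimizer.energy_eq {s p : ℝ} {m : ℕ} {W : ℂ → ℝ} (h : Admissible s p m W)
    {c : ℝ} {u : L2} (hu : IsMinimizer s W c u) :
    energy s W u = Jinf s W c + E₀ W * c := by
  rw [h.energy_eq hu.memHs, hu.eq_inf, hu.charge]

theorem IsSolution.mono {s : ℝ} {W : ℂ → ℝ} {I I' : Set ℝ} {ψ : ℝ → L2}
    (h : IsSolution s W I ψ) (hI : I' ⊆ I) : IsSolution s W I' ψ where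
  mem t ht := h.mem t (hI ht)
  cont t ht := (h.cont t (hI ht)).mono_left (nhdsWithin_mono t hI)
  eqn φ hφ t ht := (h.eqn φ hφ t (hI ht)).mono hI

theorem Admissible.isConservativeSolution_standing {s p : ℝ} {m : ℕ} {W : ℂ → ℝ}
    (h : Admissible s p m W) {c : ℝ} (hc : 0 < c) {u : L2} (hu : IsMinimizer s W c u) (τ : ℝ) :
    IsConservativeSolution s W τ u (standing s W c u) where
  sol := (h.isSolution_standing hu.memHs (h.isWeakStationary hc hu)).mono (subset_univ _)
  init := standing_zero s W c u
  energy_eq t _ := by rw [(h.isMinimizer_standing hu t).energy_eq h, hu.energy_eq h]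
  charge_eq t _ := by
    rw [charge_eq_normSq, charge_eq_normSq, (h.isMinimizer_standing hu t).charge, hu.charge]

theorem IsSolution.continuousOn {s : ℝ} {W : ℂ → ℝ} {I : Set ℝ} {ψ : ℝ → L2}
    (h : IsSolution s W I ψ) : ContinuousOn ψ I := fun t ht =>
  tendsto_iff_norm_sub_tendsto_zero.2
    (squeeze_zero (fun _ => norm_nonneg _) (fun _ => norm_le_hsNorm s _) (h.cont t ht))

/-- The difference of two bounded solutions. -/
theorem Admissible.isWeakSolution_sub {s p : ℝ} {m : ℕ} {W : ℂ → ℝ} (h : Admissible s p m W)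
    {A B T : ℝ} (hB : ∀ u : L2, MemHs s u → hsNorm s u ≤ A → ‖gradL2 W u‖ ≤ B) {χ ψ : ℝ → L2}
    (hχ : IsSolution s W (Ico 0 T) χ) (hψ : IsSolution s W (Ico 0 T) ψ)
    (hχA : ∀ t ∈ Ico 0 T, hsNorm s (χ t) ≤ A) (hψA : ∀ t ∈ Ico 0 T, hsNorm s (ψ t) ≤ A) :
    IsWeakSolution (2 * s) T (max (A + A) (B + B)) (fun t => χ t - ψ t)
      (fun t => gradL2 W (χ t) - gradL2 W (ψ t)) where
  continuousOn := hχ.continuousOn.sub hψ.continuousOn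
  norm_le t ht := (norm_sub_le _ _).trans ((add_le_add ((norm_le_hsNorm s _).trans (hχA t ht))
    ((norm_le_hsNorm s _).trans (hψA t ht))).trans (le_max_left _ _))
  norm_source_le t ht := (norm_sub_le _ _).trans ((add_le_add (hB _ (hχ.mem t ht) (hχA t ht))
    (hB _ (hψ.mem t ht) (hψA t ht))).trans (le_max_right _ _))
  eqn φ hφ t ht := by
    have h1 := (hχ.eqn φ hφ t ht).sub (hψ.eqn φ hφ t ht)
    rw [h.rhsPairing_eq φ (hχ.mem t ht), h.rhsPairing_eq φ (hψ.mem t ht)] at h1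
    simp_rw [inner_sub_right]
    convert! h1 using 1
    ring

theorem exists_gronwallBound_lt {K r : ℝ} (hK : 0 < K) (hr : 0 < r) (T : ℝ) :
    ∃ θ > 0, ∀ a ≤ θ, ∀ x ≤ T, 0 ≤ x → gronwallBound a K θ x < r := by
  have h1 : Tendsto (fun θ : ℝ => θ * Real.exp (K * T) + θ / K * (Real.exp (K * T) - 1)) (𝓝[>] 0)
      (𝓝 0) := by
    have : Continuous fun θ : ℝ => θ * Real.exp (K * T) + θ / K * (Real.exp (K * T) - 1) := by
      fun_prop
    simpa using (this.tendsto 0).mono_left nhdsWithin_le_nhds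
  obtain ⟨θ, h2, hθ⟩ := ((h1.eventually (gt_mem_nhds hr)).and self_mem_nhdsWithin).exists
  have hθ0 : 0 < θ := hθ
  refine ⟨θ, hθ0, fun a ha x hx hx0 => lt_of_le_of_lt ?_ h2⟩
  rw [gronwallBound_of_K_ne_0 hK.ne']
  have h3 : Real.exp (K * x) ≤ Real.exp (K * T) := Real.exp_le_exp.2 (by gcongr)
  exact add_le_add (mul_le_mul ha h3 (Real.exp_pos _).le hθ0.le)
    (mul_le_mul_of_nonneg_left (by linarith) (by positivity))

/-- Conservative solutions which start close to a minimizer stay close to its standing wave, on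
bounded time intervals. -/
theorem Admissible.exists_close_standing {s p : ℝ} {m : ℕ} {W : ℂ → ℝ} (h : Admissible s p m W)
    {c : ℝ} (hc : 0 < c) (hneg : Jinf s W c < 0) {u : L2} (hu : IsMinimizer s W c u) (T : ℝ)
    {r : ℝ} (hr : 0 < r) : ∃ δ > 0, ∀ v : L2, MemHs s v → hsNorm s (v - u) < δ →
      ∀ (σ : ℝ) (χ : ℝ → L2), IsConservativeSolution s W σ v χ → ∀ t ∈ Ico 0 σ, t ≤ T →
        hsNorm s (χ t) ≤ (h.minimizer_bounded hc).choose + 1 ∧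
        ‖χ t - standing s W c u t‖ < r := by
  have hspec := (h.minimizer_bounded hc).choose_spec
  set A := (h.minimizer_bounded hc).choose with hA
  obtain ⟨M, hA0, hM, hAM⟩ := hspec
  obtain ⟨B, hB, hgr⟩ := h.norm_gradL2_le (A + 1)
  obtain ⟨L, hL, hdiff⟩ := h.norm_gradL2_sub_le hM
  obtain ⟨θ, hθ, hgw⟩ := exists_gronwallBound_lt (by linarith : 0 < L + 1)
    (by positivity : 0 < r ^ 2) T
  have hm1 : m ≠ 0 := by have := h.two_le; omega
  -- The stability radius is chosen so that the nonlinear error L·ε^m is at most √θ, the source term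
  -- allowed by the Gronwall bound.
  obtain ⟨ε, ⟨hε0, hε1⟩, hεe⟩ : ∃ ε : ℝ, (0 < ε ∧ ε ≤ 1) ∧ L * ε ^ m ≤ Real.sqrt θ := by
    refine ⟨min 1 (Real.sqrt θ / (L + 1)), ⟨by positivity, min_le_left _ _⟩, ?_⟩
    set ε := min 1 (Real.sqrt θ / (L + 1)) with hε
    have hε0 : 0 < ε := by positivity
    have h1 : ε ^ m ≤ ε := pow_le_of_le_one hε0.le (min_le_left _ _) hm1
    have h2 : ε * (L + 1) ≤ Real.sqrt θ := (le_div_iff₀ (by positivity)).1 (min_le_right _ _)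
    nlinarith
  obtain ⟨δ, hδ, hst⟩ := h.orbital_stability hc hneg hε0
  refine ⟨min δ (Real.sqrt θ), by positivity, fun v hv hvu σ χ hχ t ht htT => ?_⟩
  obtain ⟨hvu1, hvu2⟩ := lt_min_iff.1 hvu
  -- The minimizer close to χ(t) varies with t and is unrelated to the standing wave of u. Only its
  -- uniform pointwise bound is used.
  have hnear : ∀ t ∈ Ico 0 σ, ∃ v', IsMinimizer s W c v' ∧ hsNorm s (χ t - v') < ε :=
    fun t ht => hst v u (χ t) hv hu hvu1 (hχ.sol.mem t ht) (hχ.energy_eq t ht) (hχ.charge_eq t ht)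
  have hχA : ∀ t ∈ Ico 0 σ, hsNorm s (χ t) ≤ A + 1 := by
    intro t ht
    obtain ⟨v', hv', hlt⟩ := hnear t ht
    have := hsNorm_le_add_sub (hχ.sol.mem t ht) hv'.memHs
    linarith [(hAM v' hv').1]
  refine ⟨hχA t ht, ?_⟩
  have hψ := h.isConservativeSolution_standing hc hu σ
  have hψA : ∀ t ∈ Ico 0 σ, hsNorm s (standing s W c u t) ≤ A + 1 := fun t _ => by
    linarith [(hAM _ (h.isMinimizer_standing hu t)).1]
  have hw := h.isWeakSolution_sub hgr hχ.sol hψ.sol hχA hψA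
  have hs := h.pos
  have key := hw.normSq_le (e := Real.sqrt θ) (by linarith : 0 ≤ 2 * s) hs
    (fun t ht => (hχ.sol.mem t ht).sub (hψ.sol.mem t ht)) hL (fun t ht => by
      obtain ⟨v', hv', hlt⟩ := hnear t ht
      have hmin := h.isMinimizer_standing hu t
      refine (hdiff _ _ v' (hχ.sol.mem t ht) hmin.memHs hv'.memHs (hAM _ hmin).2
        (hAM _ hv').2).trans ?_
      have h1 := pow_le_pow_left₀ (hsNorm_nonneg s _) hlt.le m
      have h2 := mul_le_mul_of_nonneg_left h1 hL
      linarith) ht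
  rw [Real.sq_sqrt hθ.le, hχ.init, hψ.init] at key
  have h1 : ‖v - u‖ ^ 2 ≤ θ := by
    rw [← Real.sq_sqrt hθ.le]
    exact pow_le_pow_left₀ (norm_nonneg _) ((norm_le_hsNorm s _).trans hvu2.le) 2
  exact lt_of_pow_lt_pow_left₀ 2 hr.le (key.trans_lt (hgw _ h1 t htT ht.1))

/-- Energy and charge are conserved, so J(χ(t)) = J(v) is close to the minimum; together with L²
closeness this controls the H^s distance by `Admissible.hsNorm_sub_minimizer_le`. -/
theorem Admissible.exists_hsNorm_close_standing {s p : ℝ} {m : ℕ} {W : ℂ → ℝ}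
    (h : Admissible s p m W) {c : ℝ} (hc : 0 < c) (hneg : Jinf s W c < 0) {u : L2}
    (hu : IsMinimizer s W c u) (T : ℝ) {ε : ℝ} (hε : 0 < ε) :
    ∃ δ > 0, ∀ v : L2, MemHs s v → hsNorm s (v - u) < δ →
      ∀ (σ : ℝ) (χ : ℝ → L2), IsConservativeSolution s W σ v χ → ∀ t ∈ Ico 0 σ, t ≤ T →
        hsNorm s (χ t - standing s W c u t) < ε := by
  have hspec := (h.minimizer_bounded hc).choose_spec
  set A := (h.minimizer_bounded hc).choose with hA
  obtain ⟨M, hA0, hM, hAM⟩ := hspec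
  obtain ⟨C₁, hC₁, hJ⟩ := h.J_sub_le (A + 1)
  obtain ⟨C₂, hC₂, hup⟩ := h.hsNorm_sub_minimizer_le hc (A + 1)
  set D := ‖fracD (2 * s) u‖ with hD
  obtain ⟨r, hr, hr'⟩ : ∃ r : ℝ, 0 < r ∧ r ^ 2 + 2 * (C₂ + D) * r < ε ^ 2 / 2 := by
    have : Continuous fun r : ℝ => r ^ 2 + 2 * (C₂ + D) * r := by fun_prop
    have h1 : Tendsto (fun r : ℝ => r ^ 2 + 2 * (C₂ + D) * r) (𝓝[>] 0) (𝓝 0) := by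
      simpa using (this.tendsto 0).mono_left nhdsWithin_le_nhds
    obtain ⟨r, h2, h3⟩ := ((h1.eventually (gt_mem_nhds (by positivity : 0 < ε ^ 2 / 2))).and
      self_mem_nhdsWithin).exists
    exact ⟨r, h3, h2⟩
  obtain ⟨δ, hδ, hcl⟩ := h.exists_close_standing hc hneg hu T hr
  -- The bound ε²/(4C₁) makes the energy term 2|J(v) - Jinf| smaller than ε²/2; the terms in r take
  -- the other half.
  refine ⟨min (min δ 1) (ε ^ 2 / (4 * C₁)), by positivity, fun v hv hvu σ χ hχ t ht htT => ?_⟩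
  obtain ⟨h1, h2⟩ := lt_min_iff.1 hvu
  obtain ⟨h3, h4⟩ := lt_min_iff.1 h1
  obtain ⟨h5, h6⟩ := hcl v hv h3 σ χ hχ t ht htT
  have hmin := h.isMinimizer_standing hu t
  have h7 := hup _ _ (hχ.sol.mem t ht) h5 hmin (by linarith [(hAM _ hmin).1])
  have hD2 : ‖fracD (2 * s) (standing s W c u t)‖ = D := by
    rw [standing, fracD_smul _ (h.hasD_minimizer hc hu).memHs, norm_smul, norm_cexp_neg_I_mul,
      one_mul]
  have hE := hχ.energy_eq t ht
  have hQ := hχ.charge_eq t ht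
  rw [charge_eq_normSq, charge_eq_normSq] at hQ
  rw [h.energy_eq (hχ.sol.mem t ht), h.energy_eq hv, hQ] at hE
  have h8 : J s W (χ t) = J s W v := by linarith
  have h9 := hsNorm_le_add_sub hv hu.memHs
  have h10 := (hAM u hu).1
  have h11 := (hJ v u hv hu.memHs (by linarith) (by linarith)).1
  rw [hu.eq_inf] at h11
  have h12 : hsNorm s (v - u) * (4 * C₁) < ε ^ 2 := (lt_div_iff₀ (by positivity)).1 h2
  rw [hD2, h8] at h7
  have h13 : ‖χ t - standing s W c u t‖ ^ 2 ≤ r ^ 2 := pow_le_pow_left₀ (norm_nonneg _) h6.le 2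
  have h14 : 2 * (C₂ + D) * ‖χ t - standing s W c u t‖ ≤ 2 * (C₂ + D) * r :=
    mul_le_mul_of_nonneg_left h6.le (by positivity)
  refine lt_of_pow_lt_pow_left₀ 2 hε.le ?_
  linarith

/-- The evolution of a minimizer is its standing wave. -/
theorem Admissible.isEvolution_standing {s p : ℝ} {m : ℕ} {W : ℂ → ℝ} (h : Admissible s p m W)
    {c : ℝ} (hc : 0 < c) (hneg : Jinf s W c < 0) {u : L2} (hu : IsMinimizer s W c u) (τ : ℝ) :
    IsEvolution s W τ u (standing s W c u) where
  sol := h.isConservativeSolution_standing hc hu τ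
  unique σ χ hχ t ht := by
    -- Uniqueness is stability with initial distance 0: the distance to the standing wave is below
    -- every ε.
    refine sub_eq_zero.1 (norm_le_zero_iff.1 (le_of_forall_pos_lt_add fun ε hε => ?_))
    obtain ⟨δ, hδ, hcl⟩ := h.exists_hsNorm_close_standing hc hneg hu τ hε
    have h1 := hcl u hu.memHs (by rwa [sub_self, hsNorm_zero]) σ χ hχ t
      ⟨ht.1, ht.2.trans_le (min_le_left _ _)⟩ (ht.2.trans_le (min_le_right _ _)).le
    rw [zero_add]
    exact (norm_le_hsNorm s _).trans_lt h1
  cont t _ ε hε := by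
    have hψ := h.isSolution_standing hu.memHs (h.isWeakStationary hc hu)
    have h1 := hψ.cont t (mem_univ t)
    rw [nhdsWithin_univ] at h1
    obtain ⟨η, hη, hηb⟩ := Metric.eventually_nhds_iff.1
      (h1.eventually (gt_mem_nhds (half_pos hε)))
    obtain ⟨δ, hδ, hcl⟩ := h.exists_hsNorm_close_standing hc hneg hu (t + 1) (half_pos hε)
    refine ⟨min (min η 1) δ, by positivity, fun v hv hvu σ χ hχ t' ht' htt => ?_⟩
    obtain ⟨h2, -⟩ := lt_min_iff.1 htt
    obtain ⟨h3, h4⟩ := lt_min_iff.1 h2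
    have h5 := hcl v hv (hvu.trans_le (min_le_right _ _)) σ χ hχ t' ht'
      (by linarith [(abs_lt.1 h4).2])
    have h6 : hsNorm s (standing s W c u t' - standing s W c u t) < ε / 2 :=
      hηb (by rwa [Real.dist_eq])
    have h7 := hsNorm_sub_le (hχ.sol.mem t' ht') (h.isMinimizer_standing hu t').memHs
      (h.isMinimizer_standing hu t).memHs
    linarith

theorem Admissible.lifespan_eq_top {s p : ℝ} {m : ℕ} {W : ℂ → ℝ} (h : Admissible s p m W)
    {c : ℝ} (hc : 0 < c) (hneg : Jinf s W c < 0) {u : L2} (hu : IsMinimizer s W c u) :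
    lifespan s W u = ⊤ := by
  refine ENNReal.eq_top_of_forall_nnreal_le fun r => ?_
  refine le_trans ?_ (le_iSup₂ (f := fun (τ : ℝ) (_ : ∃ ψ : ℝ → L2, IsEvolution s W τ u ψ) =>
    ENNReal.ofReal τ) (r : ℝ) ⟨_, h.isEvolution_standing hc hneg hu r⟩)
  rw [ENNReal.ofReal_coe_nnreal]

/-- Before the lifespan, the flow is given by a conservative solution. -/
theorem exists_flow_eq {s : ℝ} {W : ℂ → ℝ} {u : L2} {t : ℝ}
    (ht : ENNReal.ofReal t < lifespan s W u) : ∃ (τ : ℝ) (ψ : ℝ → L2), t < τ ∧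
      IsEvolution s W τ u ψ ∧ flow s W t u = ψ t := by
  obtain ⟨τ, ht'⟩ := lt_iSup_iff.1 ht
  obtain ⟨⟨ψ, hψ⟩, hlt⟩ := lt_iSup_iff.1 ht'
  have hτ : t < τ := lt_of_not_ge fun hle => hlt.not_ge (ENNReal.ofReal_le_ofReal hle)
  have hex : ∃ ψ : ℝ → L2, ∃ τ : ℝ, t < τ ∧ IsEvolution s W τ u ψ := ⟨ψ, τ, hτ, hψ⟩
  obtain ⟨τ', h1, h2⟩ := hex.choose_spec
  exact ⟨τ', hex.choose, h1, h2, by rw [flow, dif_pos hex]⟩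

/-! ### The set of minimizers is a hylomorphic set -/

theorem Admissible.mem_levelSet_iff {s p : ℝ} {m : ℕ} {W : ℂ → ℝ} (h : Admissible s p m W)
    {c : ℝ} {u : L2} : u ∈ levelSet s W (Jinf s W c + E₀ W * c) c ↔ IsMinimizer s W c u := by
  constructor
  · rintro ⟨h1, h2, h3⟩
    rw [charge_eq_normSq, abs_of_nonneg (sq_nonneg _)] at h3
    rw [h.energy_eq h1, h3] at h2
    exact ⟨h1, h3, by linarith⟩
  · intro hu
    refine ⟨hu.memHs, hu.energy_eq h, ?_⟩
    rw [charge_eq_normSq, abs_of_nonneg (sq_nonneg _), hu.charge]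

theorem Admissible.exists_minimizer {s p : ℝ} {m : ℕ} {W : ℂ → ℝ} (h : Admissible s p m W)
    {c : ℝ} (hc : 0 < c) (hneg : Jinf s W c < 0) : ∃ v, IsMinimizer s W c v := by
  obtain ⟨u, hu, hch, hJ⟩ := h.exists_minimizing hc
  obtain ⟨-, -, v, -, hv, hvc, hvJ, -⟩ := h.minimizing_compact hc hneg hu
    (by simp only [hch]; exact tendsto_const_nhds) hJ
  exact ⟨v, hv, hvc, hvJ⟩

theorem hsInfDist_le {s : ℝ} {u v : L2} {Γ : Set L2} (hv : v ∈ Γ) :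
    hsInfDist s u Γ ≤ hsNorm s (u - v) :=
  csInf_le ⟨0, by rintro _ ⟨w, -, rfl⟩; exact hsNorm_nonneg _ _⟩ ⟨v, hv, rfl⟩

theorem exists_hsNorm_lt_of_hsInfDist_lt {s r : ℝ} {u : L2} {Γ : Set L2} (hΓ : Γ.Nonempty)
    (h : hsInfDist s u Γ < r) : ∃ v ∈ Γ, hsNorm s (u - v) < r := by
  obtain ⟨_, ⟨v, hv, rfl⟩, h1⟩ := exists_lt_of_csInf_lt (hΓ.image _) h
  exact ⟨v, hv, h1⟩

theorem Admissible.isSolitonSet {s p : ℝ} {m : ℕ} {W : ℂ → ℝ} (h : Admissible s p m W)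
    {c : ℝ} (hc : 0 < c) (hneg : Jinf s W c < 0) :
    IsSolitonSet s W (levelSet s W (Jinf s W c + E₀ W * c) c) where
  global u hu := by
    rw [h.mem_levelSet_iff] at hu
    exact ⟨hu.memHs, h.lifespan_eq_top hc hneg hu⟩
  invariant u hu t ht hlt := by
    rw [h.mem_levelSet_iff] at hu
    obtain ⟨τ, ψ, hτ, hψ, heq⟩ := exists_flow_eq hlt
    -- `flow` uses an arbitrarily chosen evolution; uniqueness identifies it with the standing wave,
    -- which consists of minimizers.
    rw [heq, (h.isEvolution_standing hc hneg hu τ).unique τ ψ hψ.sol t ⟨ht, by rwa [min_self]⟩]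
    exact h.mem_levelSet_iff.2 (h.isMinimizer_standing hu t)
  stable ε hε := by
    obtain ⟨δ, hδ, hst⟩ := h.orbital_stability hc hneg hε
    obtain ⟨v₀, hv₀⟩ := h.exists_minimizer hc hneg
    -- Half of δ, because the infimum distance need not be attained and a minimizer at distance
    -- strictly less than δ is required.
    refine ⟨δ / 2, by positivity, fun u hu hd t ht hlt => ?_⟩
    obtain ⟨v, hv, huv⟩ := exists_hsNorm_lt_of_hsInfDist_lt ⟨v₀, h.mem_levelSet_iff.2 hv₀⟩
      (hd.trans_lt (half_lt_self hδ))
    obtain ⟨τ, ψ, hτ, hψ, heq⟩ := exists_flow_eq hlt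
    have htI : t ∈ Ico 0 τ := ⟨ht, hτ⟩
    obtain ⟨v', hv', h1⟩ := hst u v (ψ t) hu (h.mem_levelSet_iff.1 hv) huv
      (hψ.sol.sol.mem t htI) (hψ.sol.energy_eq t htI) (hψ.sol.charge_eq t htI)
    rw [heq]
    exact (hsInfDist_le (h.mem_levelSet_iff.2 hv')).trans h1.le
  compact u hu := by
    have hu' := fun n => h.mem_levelSet_iff.1 (hu n)
    obtain ⟨k, τ, v, hk, hv, -, -, hlim⟩ := h.minimizing_compact hc hneg (fun n => (hu' n).memHs)
      (by simp only [(hu' _).charge]; exact tendsto_const_nhds)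
      (by simp only [(hu' _).eq_inf]; exact tendsto_const_nhds)
    exact ⟨k, τ, v, hk, hv, hlim⟩

theorem Admissible.isHylomorphicSet {s p : ℝ} {m : ℕ} {W : ℂ → ℝ} (h : Admissible s p m W)
    {c : ℝ} (hc : 0 < c) (hneg : Jinf s W c < 0) :
    IsHylomorphicSet s W c (levelSet s W (Jinf s W c + E₀ W * c) c) := by
  refine ⟨h.isSolitonSet hc hneg, _, ⟨?_, ?_⟩, rfl⟩
  · obtain ⟨v, hv⟩ := h.exists_minimizer hc hneg
    obtain ⟨h1, h2, h3⟩ := h.mem_levelSet_iff.2 hv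
    exact ⟨v, ⟨h1, h3⟩, h2⟩
  · rintro _ ⟨u, ⟨hu, hch⟩, rfl⟩
    rw [charge_eq_normSq, abs_of_nonneg (sq_nonneg _)] at hch
    rw [h.energy_eq hu, hch]
    linarith [h.Jinf_le hu hch]

end FNLS

end

theorem mainTheorem3 (s : ℝ) (hs : 1 / 2 ≤ s) (W : ℂ → ℝ)
    (hreg : ContDiff ℝ 2 W) (hrad : ∀ z : ℂ, W z = W ((‖z‖ : ℝ) : ℂ))
    (hW0 : W 0 = 0 ∧ FNLS.cgrad W 0 = 0)
    (hW1 : ∃ r₀ : ℝ, 0 < r₀ ∧ FNLS.Nfun W r₀ < 0)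
    (hW2 : ∃ q₁ q₂ c₁ : ℝ, 2 < q₁ ∧ q₁ ≤ q₂ ∧
      ∀ r : ℝ, 0 ≤ r → |deriv (FNLS.Nfun W) r| ≤ c₁ * (r ^ (q₁ - 1) + r ^ (q₂ - 1)))
    (hW3 : ∃ p : ℝ, 2 < p ∧ p < 4 * s + 2 ∧ ∃ c : ℝ, 0 ≤ c ∧
      ∀ᶠ r : ℝ in Filter.atTop, -c * r ^ p ≤ FNLS.Nfun W r) :
    ∃ δmax : ℝ, 0 < δmax ∧ ∃ (c : ℝ → ℝ) (Γ : ℝ → Set FNLS.L2),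
      StrictAntiOn c (Set.Ioo 0 δmax) ∧
      ∀ δ ∈ Set.Ioo 0 δmax,
        0 < c δ ∧ FNLS.IsHylomorphicSet s W (c δ) (Γ δ) ∧ (Γ δ).Nonempty ∧
        ∀ u ∈ Γ δ, FNLS.IsHylomorphicSoliton s W u ∧ FNLS.MemHs (2 * s) u ∧
          ∃ ω : ℝ, FNLS.IsWeakStationary s W ω u ∧
            FNLS.IsSolution s W Set.univ
              (fun t : ℝ => Complex.exp (-Complex.I * (ω : ℂ) * (t : ℂ)) • u) := by
  obtain ⟨p, m, h⟩ := FNLS.exists_admissible s hs W hreg hrad hW0.1 hW1 hW2 hW3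
  obtain ⟨c₀, hc₀, hneg⟩ := h.exists_Jinf_neg
  -- The charges c₀ + 1 - δ decrease strictly in δ and exceed c₀ for δ < 1, so the infimum is
  -- negative at each of them.
  refine ⟨1, one_pos, fun δ => c₀ + 1 - δ, fun δ => FNLS.levelSet s W
    (FNLS.Jinf s W (c₀ + 1 - δ) + FNLS.E₀ W * (c₀ + 1 - δ)) (c₀ + 1 - δ),
    fun a _ b _ hab => sub_lt_sub_left hab _, fun δ hδ => ?_⟩
  have hc : 0 < c₀ + 1 - δ := by linarith [hδ.2]
  have hJ := hneg (c₀ + 1 - δ) (by linarith [hδ.2])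
  have hΓ := h.isHylomorphicSet hc hJ
  obtain ⟨v, hv⟩ := h.exists_minimizer hc hJ
  refine ⟨hc, hΓ, ⟨v, h.mem_levelSet_iff.2 hv⟩, fun u hu => ?_⟩
  have hmin := h.mem_levelSet_iff.1 hu
  have hst := h.isWeakStationary hc hmin
  exact ⟨⟨_, _, hΓ, hu⟩, (h.hasD_minimizer hc hmin).memHs, _, hst,
    h.isSolution_standing hmin.memHs hst⟩
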